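/- Let $K\ge 1$, $\beta\ge 0$ and biases $\varepsilon=(\varepsilon_1,\dots,\varepsilon_K)$ with $\varepsilon_k\ge 0$. Let $\Delta$ be the probability simplex in $\mathbb R^K$ if $\beta=0$, and its relative interior if $\beta>0$. For $\pi\in\Delta$ let $$p_k(\pi)=\frac{\theta_k(\pi)\,\pi_k^{-\beta}+\varepsilon_k}{\sum_{j=1}^K\bigl(\theta_j(\pi)\,\pi_j^{-\beta}+\varepsilon_j\bigr)},\qquad k=1,\dots,K,$$ where the attraction factor is either the cumulative mutual attraction $$\theta_k(\pi)=\sum_{j=1}^K M(\pi_k,\pi_j),\qquad M(x,y)=\frac{x^2+y^2-xy}{\max\{x,y\}},\quad M(0,0)=0,$$ or a constant, $\theta_k(\pi)=\theta>0$ for all $k$ and $\pi$. Individuals enter one at a time: group $k$ has $n_k(t)$ members at time $t=0,1,2,\dots$, $N(t)=\sum_k n_k(t)$, $\pi_k(t)=n_k(t)/N(t)$, and, conditionally on the past, the entrant at time $t$ joins group $k$ (so that $n_k(t+1)=n_k(t)+1$ and the other sizes do not change) with probability $p_k(\pi(t))$. The initial sizes are arbitrary with $N(0)>0$ and, if $\beta>0$,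 $n_k(0)>0$ for all $k$. **Theorem.** (a) For each of the two choices of $\theta_k$ there is exactly one fixed point $\pi^*\in\Delta$ of $p$, i.e. $\pi^*=p(\pi^*)$, and: 1. (symmetric bias) if $\varepsilon_1=\dots=\varepsilon_K$, then $\pi^*_k=1/K$ for all $k$; 2. (asymmetric bias) $\pi^*$ reflects the relative sizes of the biases: for all $j,k$, $\pi_j^*<\pi_k^*$ if and only if $\varepsilon_j<\varepsilon_k$; 3. (convergence) for all such initial sizes, almost surely $\lim_{t\to\infty}\pi_k(t)=\pi^*_k$ for all $k$; 4. (stability) $\pi^*$ is a globally asymptotically stable equilibrium of the mean dynamics $\frac{d\pi_k}{dt}=p_k(\pi)-\pi_k$ on $\Delta$: it is Lyapunov stable, and every solution $\pi:[0,\infty)\to\Delta$ converges to $\pi^*$. (b) (First-order formula.) Let $\theta_k\equiv\theta>0$ be constant and $\varepsilon_k=\epsilon+\eta_k\ge 0$ with $\epsilon>0$ and $\sum_k\eta_k=0$. Then, for fixed $K,\beta,\theta,\epsilon$, as $\eta\to 0$, $$\pi_k^*=\frac1K+\frac{\eta_k}{\theta K^{\beta+1}(1+\beta)+K\epsilon}+o\bigl(\max_j|\eta_j|\bigr),\qquad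 k=1,\dots,K.$$ -/

import Mathlib

open Filter Topology MeasureTheory ProbabilityTheory

noncomputable section

namespace GroupDynamics

/-- The mutual attraction `M(x, y) = (x² + y² - x y) / max{x, y}` of two group proportions, with the
value `0` at `x = y = 0`. -/
def mutualAttraction (x y : ℝ) : ℝ :=
  if max x y = 0 then 0 else (x ^ 2 + y ^ 2 - x * y) / max x y

/-- The cumulative attraction `θ_k = ∑_j M(π_k, π_j)` of group `k`; the term `j = k` is included. -/
def cumulativeAttraction {K : ℕ} (x : Fin K → ℝ) (k : Fin K) : ℝ :=
  ∑ j, mutualAttraction (x k) (x j)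

/-- The two versions of the attraction factor `θ_k`: the cumulative mutual attraction of the current
proportions, or one and the same constant `θ > 0` for all groups. -/
def IsAttractionFactor {K : ℕ} (Θ : (Fin K → ℝ) → Fin K → ℝ) : Prop :=
  Θ = cumulativeAttraction ∨ ∃ θ : ℝ, 0 < θ ∧ Θ = fun _ _ => θ

/-- The attraction potential `a_k = θ_k(π) π_k^{-β}`. -/
def attractionPotential {K : ℕ} (Θ : (Fin K → ℝ) → Fin K → ℝ) (β : ℝ) (x : Fin K → ℝ)
    (k : Fin K) : ℝ :=
  Θ x k * x k ^ (-β)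

/-- The probability `p_k(π) = (a_k + ε_k) / ∑_j (a_j + ε_j)` that a new entrant joins group `k`. -/
def choiceProb {K : ℕ} (Θ : (Fin K → ℝ) → Fin K → ℝ) (β : ℝ) (ε : Fin K → ℝ) (x : Fin K → ℝ)
    (k : Fin K) : ℝ :=
  (attractionPotential Θ β x k + ε k) / ∑ j, (attractionPotential Θ β x j + ε j)

/-- The vectors of proportions at which the choice probabilities are defined: the whole probability
simplex if `β = 0`, and its relative interior if `β ≠ 0` (where `π_k^{-β}` needs `π_k > 0`). -/
def stateSpace (K : ℕ) (β : ℝ) : Set (Fin K → ℝ) :=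
  {x | x ∈ stdSimplex ℝ (Fin K) ∧ (β ≠ 0 → ∀ k, 0 < x k)}

/-- The proportions `π_k = n_k / N`, where `N = ∑_j n_j`, of group sizes `n`. -/
def proportion {K : ℕ} (n : Fin K → ℕ) (k : Fin K) : ℝ :=
  (n k : ℝ) / ((∑ j, n j : ℕ) : ℝ)

/-- The stochastic process of group sizes: at each time `t` one new individual enters and joins the
group `X t`, and given the past `ℱ t` it joins group `k` with probability `p_k(π(t))`. -/
structure IsGroupProcess {K : ℕ} (Θ : (Fin K → ℝ) → Fin K → ℝ) (β : ℝ) (ε : Fin K → ℝ)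
    (n₀ : Fin K → ℕ) {Ω : Type*} [mΩ : MeasurableSpace Ω] (μ : Measure Ω) (ℱ : Filtration ℕ mΩ)
    (X : ℕ → Ω → Fin K) (n : ℕ → Ω → Fin K → ℕ) : Prop where
  init : ∀ ω, n 0 ω = n₀
  step : ∀ t ω k, n (t + 1) ω k = n t ω k + if X t ω = k then 1 else 0
  adapted : ∀ t, Measurable[ℱ (t + 1)] (X t)
  law : ∀ t k,
    μ[({ω | X t ω = k}.indicator fun _ => (1 : ℝ)) | ℱ t]
      =ᵐ[μ] fun ω => choiceProb Θ β ε (proportion (n t ω)) k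

/-- `x : [0, ∞) → stateSpace` solves the mean dynamics `dπ_k/dt = p_k(π) - π_k`. -/
def IsTrajectory {K : ℕ} (Θ : (Fin K → ℝ) → Fin K → ℝ) (β : ℝ) (ε : Fin K → ℝ)
    (x : ℝ → Fin K → ℝ) : Prop :=
  ∀ t, 0 ≤ t → x t ∈ stateSpace K β ∧
    HasDerivWithinAt x (choiceProb Θ β ε (x t) - x t) (Set.Ici 0) t

/-- `z` is a globally asymptotically stable equilibrium of the mean dynamics: it is Lyapunov stable,
and every trajectory converges to it. -/
def IsGloballyAsymptoticallyStable {K : ℕ} (Θ : (Fin K → ℝ) → Fin K → ℝ) (β : ℝ)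
    (ε : Fin K → ℝ) (z : Fin K → ℝ) : Prop :=
  (∀ δ > 0, ∃ γ > 0, ∀ x : ℝ → Fin K → ℝ, IsTrajectory Θ β ε x → dist (x 0) z < γ →
      ∀ t, 0 ≤ t → dist (x t) z < δ) ∧
    ∀ x : ℝ → Fin K → ℝ, IsTrajectory Θ β ε x → Tendsto x atTop (𝓝 z)

end GroupDynamics

end

/-!
Write `A_k(x) = θ_k(x) x_k^{-β}` for the attraction potential and `T(x)` for the sum of all
`A_k(x) + ε_k`, so that a fixed point `z` satisfies `A_k(z) + ε_k = T(z) z_k`. Everything rests on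
one monotonicity inequality (`IsAttractionFactor.exists_monotonicity`): if `A_k(z) ≤ S z_k` for all
`k`, then
`∑ (1 - z_k / x_k) (A_k(x) - A_k(z)) ≤ (S - c) ∑ (x_k - z_k)² / x_k` with a constant `c > 0`.
The weights `1 - z_k / x_k` are the gradient, along the simplex, of the relative entropy of `z` with
respect to `x`; hence at a fixed point the inequality, with `S = T(z)`, says that the relative
entropy is a strict Lyapunov function of the mean field (`IsAttractionFactor.exists_dissipation`).
For a constant attraction it holds term by term, because the potential decreases with the size. For
the cumulative mutual attraction one writes `M(x, y) = x + y - g(x, y)` with the overlap `g`, bounds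
`S` from below by the smallest group, and decomposes the sum into pairs. The inequality for a pair
is affine in the ratio of the weights `z_k^{-β}`, so that it suffices to verify it for the extreme
ratios; there it is an inequality for quadratic polynomials (`pair_inequality`). What the pairs
leave over is a quadratic form whose kernel is a product of two minimum kernels, which is positive
semidefinite (`sum_min_mul_min_nonneg`).

Uniqueness is immediate from the dissipation. Existence follows by continuation along the biases
`t ε`, `0 ≤ t ≤ 1`, from the uniform distribution at `t = 0`: the monotonicity inequality makes the
mean field locally strongly monotone near a fixed point, so that fixed points persist
(`IsAttractionFactor.fixedPoint_persists`), and they stay away from the boundary. The order of the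
fixed point is that of the biases because the potential grows more slowly than `S` times the size
(`IsAttractionFactor.potential_sub_lt`).

For the dynamics, the smallest group is chosen with probability bounded below, so that the shortfall
of the proportions below a small level decays (`IsAttractionFactor.exists_repulsion`), and the
proportions eventually stay in a compact part of the open simplex. There the relative entropy decays
at a rate proportional to itself. For the differential equation both statements are integrated with
Grönwall's inequality. For the process, the steps `1 / (N(t) + 1)` have a divergent sum and a
convergent sum of squares; the random fluctuations form an almost surely convergent series of
martingale differences (`ae_exists_tendsto_sum_of_condExp_eq_zero`), and a deterministic lemma of
Robbins–Monro type (`tendsto_zero_of_perturbed_decay`) is applied first to the shortfall and then to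
the relative entropy.

The first-order formula comes from linearizing the fixed point equation at the uniform distribution,
after the a priori bound `fixedPoint_abs_sub_le` on the distance of the fixed point from it.
-/

noncomputable section

namespace GroupDynamics

/-! ### Mutual attraction and overlap of two group sizes -/

/-- The overlap `2 m - m² / M` of two sizes with minimum `m` and maximum `M`: the amount by which
their mutual attraction falls short of their sum. -/
def overlap (x y : ℝ) : ℝ := 2 * min x y - min x y ^ 2 / max x y

theorem overlap_comm (x y : ℝ) : overlap x y = overlap y x := by
  unfold overlap; rw [min_comm, max_comm]

theorem overlap_self (x : ℝ) : overlap x x = x := by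
  unfold overlap
  rcases eq_or_ne x 0 with rfl | h
  · simp
  · simp only [min_self, max_self]; field_simp; ring

theorem overlap_of_le {x y : ℝ} (h : y ≤ x) : overlap x y = 2 * y - y ^ 2 / x := by
  unfold overlap; rw [min_eq_right h, max_eq_left h]

theorem mutualAttraction_comm (x y : ℝ) : mutualAttraction x y = mutualAttraction y x := by
  unfold mutualAttraction; rw [max_comm]; congr 2; ring

theorem mutualAttraction_of_le {x y : ℝ} (hx : 0 < x) (h : y ≤ x) :
    mutualAttraction x y = x - y + y ^ 2 / x := by
  unfold mutualAttraction
  rw [max_eq_left h, if_neg hx.ne']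
  field_simp; ring

theorem mutualAttraction_zero_zero : mutualAttraction 0 0 = 0 := by
  simp [mutualAttraction]

theorem mutualAttraction_self {x : ℝ} (hx : 0 ≤ x) : mutualAttraction x x = x := by
  rcases hx.eq_or_lt with rfl | h
  · exact mutualAttraction_zero_zero
  · rw [mutualAttraction_of_le h le_rfl]; field_simp; ring

theorem mutualAttraction_eq_sub_overlap {x y : ℝ} (hx : 0 < x) (hy : 0 < y) :
    mutualAttraction x y = x + y - overlap x y := by
  rcases le_total y x with h | h
  · rw [mutualAttraction_of_le hx h, overlap_of_le h]; ring
  · rw [mutualAttraction_comm, overlap_comm, mutualAttraction_of_le hy h, overlap_of_le h]; ring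

theorem mutualAttraction_nonneg {x : ℝ} (hx : 0 < x) (y : ℝ) :
    0 ≤ mutualAttraction x y := by
  unfold mutualAttraction
  split_ifs
  · exact le_rfl
  · have : 0 < max x y := lt_max_of_lt_left hx
    have : 0 ≤ x ^ 2 + y ^ 2 - x * y := by nlinarith [sq_nonneg (x - y)]
    positivity

/-! ### The three inequalities for a pair of groups -/

/-- Coordinates for a pair whose second member is the smaller one in both states: with the ratios
`r = Y / X`, `q = Q / P` and the relative deviations `a`, `b`, the change of the overlap is a linear
form in `a` and `b`. -/
theorem exists_ratios_of_same_order {X Y P Q : ℝ} (hX : 0 < X) (hY : 0 < Y) (hP : 0 < P)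
    (hQ : 0 < Q) (hQP : Q ≤ P) (hYX : Y ≤ X) :
    ∃ r q a b : ℝ, 0 < r ∧ r ≤ 1 ∧ 0 < q ∧ q ≤ 1 ∧ 1 - P / X = a ∧ 1 - Q / Y = b ∧
      Y = r * X ∧ Q / P = q ∧ min X Y = r * X ∧ (P - Q) ^ 2 / (P * Q) = (1 - q) ^ 2 / q ∧
      overlap X Y - overlap P Q = X * (r * ((2 - r - q) * b + q * a)) ∧
      mutualAttraction X Y = X * (1 - r + r ^ 2) := by
  refine ⟨Y / X, Q / P, _, _, by positivity, (div_le_one hX).2 hYX, by positivity,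
    (div_le_one hP).2 hQP, rfl, rfl, by field_simp, rfl, ?_, ?_, ?_, ?_⟩
  · rw [min_eq_right hYX]; field_simp
  · field_simp
  · rw [overlap_of_le hYX, overlap_of_le hQP]; field_simp; ring
  · rw [mutualAttraction_of_le hX hYX]; field_simp

/-- Coordinates for a pair whose order is reversed between the two states, with `ρ = X / Y` and
`q = Q / P`; here the deviation `b` of the second member is determined by that of the first. -/
theorem exists_ratios_of_reversed_order {X Y P Q : ℝ} (hX : 0 < X) (hY : 0 < Y) (hP : 0 < P)
    (hQ : 0 < Q) (hQP : Q ≤ P) (hXY : X ≤ Y) :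
    ∃ ρ q a b : ℝ, 0 < ρ ∧ ρ ≤ 1 ∧ 0 < q ∧ q ≤ 1 ∧ 1 - P / X = a ∧ 1 - Q / Y = b ∧
      b = 1 - q * ρ + q * ρ * a ∧
      X = ρ * Y ∧ Q / P = q ∧ min X Y = ρ * Y ∧ (P - Q) ^ 2 / (P * Q) = (1 - q) ^ 2 / q ∧
      overlap X Y - overlap P Q = Y * (ρ * ((1 - ρ) + (1 - q) ^ 2 + q * (2 - q) * a)) ∧
      mutualAttraction X Y = Y * (1 - ρ + ρ ^ 2) := by
  refine ⟨X / Y, Q / P, _, _, by positivity, (div_le_one hY).2 hXY, by positivity,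
    (div_le_one hP).2 hQP, rfl, rfl, ?_, by field_simp, rfl, ?_, ?_, ?_, ?_⟩
  · field_simp; ring
  · rw [min_eq_left hXY]; field_simp
  · field_simp
  · rw [overlap_comm, overlap_of_le hXY, overlap_of_le hQP]; field_simp; ring
  · rw [mutualAttraction_comm, mutualAttraction_of_le hY hXY]; field_simp

/-- A quadratic with nonnegative leading and constant coefficient and nonpositive discriminant is
nonnegative. -/
theorem quadratic_nonneg {A B C : ℝ} (hA : 0 ≤ A) (hC : 0 ≤ C) (h : B ^ 2 ≤ 4 * (A * C)) (a : ℝ) :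
    0 ≤ A * a ^ 2 + B * a + C := by
  rcases hA.eq_or_lt with rfl | hA
  · have : B = 0 := by nlinarith
    subst this; simpa using hC
  · have : 0 ≤ 4 * A * (A * a ^ 2 + B * a + C) := by nlinarith [sq_nonneg (2 * A * a + B)]
    exact nonneg_of_mul_nonneg_right this (by positivity)

/-- The pair inequality with equal weights `α = 1`. In the ratios of the two states the difference
of the two sides is a sum of squares if the order of the pair is preserved, and a quadratic
polynomial in `a = 1 - P / X` with nonpositive discriminant if it is reversed. -/
theorem pair_inequality_equal_weights {X Y P Q : ℝ} (hX : 0 < X) (hY : 0 < Y) (hP : 0 < P)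
    (hQ : 0 < Q) (hQP : Q ≤ P) :
    min X Y * (1 - P / X) * (1 - Q / Y) ≤
      ((1 - P / X) + (1 - Q / Y)) * (overlap X Y - overlap P Q) +
        (P - Q) ^ 2 / (P * Q) * Y * (1 - Q / Y) ^ 2 := by
  rcases le_total Y X with h | h
  · obtain ⟨r, q, a, b, hr, hr1, hq, hq1, ha, hb, hYr, hQq, hmin, hs, hΔ, -⟩ :=
      exists_ratios_of_same_order hX hY hP hQ hQP h
    rw [ha, hb, hmin, hs, hΔ, hYr, ← sub_nonneg]
    have hqr : q * r ≤ r := by nlinarith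
    have key : 0 ≤ (q * a + (1 - r) / 2 * b) ^ 2 + (1 - q * r - (1 - r) ^ 2 / 4) * b ^ 2 := by
      have : 0 ≤ 1 - q * r - (1 - r) ^ 2 / 4 := by nlinarith
      positivity
    have : (a + b) * (X * (r * ((2 - r - q) * b + q * a))) + (1 - q) ^ 2 / q * (r * X) * b ^ 2 -
        r * X * a * b = X * r / q *
          ((q * a + (1 - r) / 2 * b) ^ 2 + (1 - q * r - (1 - r) ^ 2 / 4) * b ^ 2) := by
      field_simp; ring
    rw [this]; positivity
  · obtain ⟨ρ, q, a, b, hρ, hρ1, hq, hq1, ha, hb, hba, hXρ, hQq, hmin, hs, hΔ, -⟩ :=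
      exists_ratios_of_reversed_order hX hY hP hQ hQP h
    rw [ha, hb, hmin, hs, hΔ, ← sub_nonneg]
    obtain ⟨v, hv⟩ : ∃ v, v = 1 - ρ := ⟨_, rfl⟩
    obtain ⟨w, hw⟩ : ∃ w, w = 1 - q := ⟨_, rfl⟩
    have hv0 : 0 ≤ v := by linarith
    have hw0 : 0 ≤ w := by linarith
    have hw1 : 0 ≤ 1 - w := by linarith
    have hv1 : 0 ≤ 1 - v := by linarith
    have hD : 0 ≤ v + ρ * w := by positivity
    have key := quadratic_nonneg (A := ρ * q * (2 - q))
      (B := ρ * ((1 + q * ρ) * v + 2 * w ^ 2))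
      (C := ρ * (v + ρ * w) * (v + w ^ 2) + w ^ 2 / q * (v + ρ * w) ^ 2)
      (by have : 0 ≤ 2 - q := by linarith
          positivity) (by positivity) ?_ a
    · have e : (a + b) * (Y * (ρ * (1 - ρ + (1 - q) ^ 2 + q * (2 - q) * a))) +
          (1 - q) ^ 2 / q * Y * b ^ 2 - ρ * Y * a * b = Y * (ρ * q * (2 - q) * a ^ 2 +
          ρ * ((1 + q * ρ) * v + 2 * w ^ 2) * a +
          (ρ * (v + ρ * w) * (v + w ^ 2) + w ^ 2 / q * (v + ρ * w) ^ 2)) := by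
        rw [hba, hv, hw]; field_simp; ring
      rw [e]; positivity
    · have main : ρ * ((1 + q * ρ) * v + 2 * w ^ 2) ^ 2 ≤
          4 * ((1 + w) * (v + ρ * w) * (ρ * q * v + w ^ 2)) := by
        obtain ⟨t, ht⟩ : ∃ t, t = q * ρ := ⟨_, rfl⟩
        have ht0 : 0 ≤ t := by rw [ht]; positivity
        have h1 : ρ * v ^ 4 ≤ ρ * v ^ 3 :=
          mul_le_mul_of_nonneg_left (pow_le_pow_of_le_one hv0 (by linarith) (by norm_num)) hρ.le
        have h2 : ρ ^ 2 * (w * v ^ 3) ≤ ρ * (w * v ^ 3) :=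
          mul_le_mul_of_nonneg_right (by nlinarith) (by positivity)
        have h3 : ρ ^ 3 * (w ^ 2 * v ^ 2) ≤ w ^ 2 * v ^ 2 :=
          mul_le_of_le_one_left (by positivity) (pow_le_one₀ hρ.le hρ1)
        have h4 : t * w * v ^ 3 ≤ t * w * v ^ 2 :=
          mul_le_mul_of_nonneg_left (pow_le_pow_of_le_one hv0 (by linarith) (by norm_num))
            (by positivity)
        have h5 : ρ * (w ^ 2 * v ^ 3) ≤ w ^ 2 * v ^ 2 := by
          have : w ^ 2 * v ^ 3 ≤ w ^ 2 * v ^ 2 :=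
            mul_le_mul_of_nonneg_left (pow_le_pow_of_le_one hv0 (by linarith) (by norm_num))
              (by positivity)
          exact (mul_le_of_le_one_left (by positivity) hρ1).trans this
        -- the discriminant, expanded into terms that are nonnegative on the unit cube
        have h6 : 4 * ((1 + w) * (v + ρ * w) * (ρ * q * v + w ^ 2)) -
            ρ * ((1 + q * ρ) * v + 2 * w ^ 2) ^ 2 = 4 * ρ * w ^ 3 + 4 * w ^ 3 * v +
            4 * ρ * t * w * v + 3 * t * v ^ 3 + t * w * v ^ 2 +
            3 * (t * w * v ^ 2 - t * w * v ^ 3) +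
            3 * (w ^ 2 * v ^ 2 - ρ * (w ^ 2 * v ^ 3)) + (w ^ 2 * v ^ 2 - ρ ^ 3 * (w ^ 2 * v ^ 2)) +
            2 * (ρ * (w * v ^ 3) - ρ ^ 2 * (w * v ^ 3)) + (ρ * v ^ 3 - ρ * v ^ 4) := by
          rw [ht, hv, hw]; ring
        have h7 : 0 ≤ 4 * ρ * w ^ 3 + 4 * w ^ 3 * v + 4 * ρ * t * w * v + 3 * t * v ^ 3 +
          t * w * v ^ 2 := by positivity
        linarith
      have e : 4 * (ρ * q * (2 - q) * (ρ * (v + ρ * w) * (v + w ^ 2) +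
          w ^ 2 / q * (v + ρ * w) ^ 2)) =
          ρ * (4 * ((1 + w) * (v + ρ * w) * (ρ * q * v + w ^ 2))) := by
        rw [hv, hw]; field_simp; ring
      rw [e, mul_pow, sq ρ, mul_assoc]
      exact mul_le_mul_of_nonneg_left main hρ.le

/-- The pair inequality with the weight `α = Q / P`, the least one that occurs for `β ≤ 1`. -/
theorem pair_inequality_proportional_weights {X Y P Q : ℝ} (hX : 0 < X) (hY : 0 < Y) (hP : 0 < P)
    (hQ : 0 < Q) (hQP : Q ≤ P) :
    Q / P * min X Y * (1 - P / X) * (1 - Q / Y) ≤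
      (1 - Q / P) * X * (1 - P / X) ^ 2 +
        (Q / P * (1 - P / X) + (1 - Q / Y)) * (overlap X Y - overlap P Q) := by
  rcases le_total Y X with h | h
  · obtain ⟨r, q, a, b, hr, hr1, hq, hq1, ha, hb, hYr, hQq, hmin, hs, hΔ, -⟩ :=
      exists_ratios_of_same_order hX hY hP hQ hQP h
    rw [ha, hb, hmin, hQq, hΔ, ← sub_nonneg]
    have hu : 0 ≤ 2 - r - q := by linarith
    have hu2 : 0 ≤ 1 - (2 - r - q) / 4 := by linarith
    have hw : 0 ≤ 1 - q := by linarith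
    have : (1 - q) * X * a ^ 2 + (q * a + b) * (X * (r * ((2 - r - q) * b + q * a))) -
        q * (r * X) * a * b = X * ((1 - q) * a ^ 2 + r * ((q * a + (2 - r - q) / 2 * b) ^ 2 +
          (2 - r - q) * (1 - (2 - r - q) / 4) * b ^ 2)) := by
      ring
    rw [this]; positivity
  · obtain ⟨ρ, q, a, b, hρ, hρ1, hq, hq1, ha, hb, hba, hXρ, hQq, hmin, hs, hΔ, -⟩ :=
      exists_ratios_of_reversed_order hX hY hP hQ hQP h
    rw [ha, hb, hmin, hQq, hΔ, ← sub_nonneg]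
    obtain ⟨v, hv⟩ : ∃ v, v = 1 - ρ := ⟨_, rfl⟩
    obtain ⟨w, hw⟩ : ∃ w, w = 1 - q := ⟨_, rfl⟩
    have hv0 : 0 ≤ v := by linarith
    have hw0 : 0 ≤ w := by linarith
    have hw1 : 0 ≤ 1 - w := by linarith
    have hv1 : 0 ≤ 1 - v := by linarith
    obtain ⟨D, hD⟩ : ∃ D, D = v + ρ * w := ⟨_, rfl⟩
    obtain ⟨E, hE⟩ : ∃ E, E = v + w ^ 2 := ⟨_, rfl⟩
    have hD0 : 0 ≤ D := by rw [hD]; positivity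
    have hE0 : 0 ≤ E := by rw [hE]; positivity
    have key := quadratic_nonneg (A := w + q ^ 2 * (1 + w + ρ * w))
      (B := q * ((1 + ρ) * E + D * w)) (C := D * E) (by positivity) (by positivity) ?_ a
    · have e : (1 - q) * X * a ^ 2 +
          (q * a + b) * (Y * (ρ * (1 - ρ + (1 - q) ^ 2 + q * (2 - q) * a))) - q * (ρ * Y) * a * b =
          Y * ρ * ((w + q ^ 2 * (1 + w + ρ * w)) * a ^ 2 + q * ((1 + ρ) * E + D * w) * a +
            D * E) := by
        rw [hba, hXρ, hE, hD, hv, hw]; ring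
      rw [e]; positivity
    · have hvw := mul_nonneg hv0 hw1
      have hDw : w ≤ D := by
        have : D = w + v * (1 - w) := by rw [hD, hv]; ring
        linarith
      have hDvw : D ≤ v + w := by
        rw [hD]
        linarith [mul_le_of_le_one_left hw0 hρ1]
      have hwE : w ^ 2 ≤ E := by rw [hE]; linarith
      have hq2 : q ^ 2 ≤ 1 := pow_le_one₀ hq.le hq1
      have hρ0 : 0 ≤ ρ := hρ.le
      have h1 : D ^ 2 * q ^ 2 * w ^ 2 ≤ D ^ 2 * q ^ 2 * E :=
        mul_le_mul_of_nonneg_left hwE (by positivity)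
      have h2 : D * q ^ 2 * E * D ≤ D * q ^ 2 * E * (v + w) :=
        mul_le_mul_of_nonneg_left hDvw (by positivity)
      have h3 : E * w ^ 2 * (q ^ 2 * (1 + ρ) ^ 2) ≤ E * w ^ 2 * (1 * 4) := by
        have : (1 + ρ) ^ 2 ≤ 2 ^ 2 := by gcongr; linarith
        have : (1 + ρ) ^ 2 ≤ 4 := by linarith
        gcongr
      have h4 : E * w * w ≤ E * w * D := mul_le_mul_of_nonneg_left hDw (by positivity)
      -- the discriminant, grouped into the differences bounded above and nonnegative terms
      have h5 : 4 * ((w + q ^ 2 * (1 + w + ρ * w)) * (D * E)) - (q * ((1 + ρ) * E + D * w)) ^ 2 =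
          (D ^ 2 * q ^ 2 * E - D ^ 2 * q ^ 2 * w ^ 2) +
          (D * q ^ 2 * E * (v + w) - D * q ^ 2 * E * D) +
          (E * w ^ 2 * (1 * 4) - E * w ^ 2 * (q ^ 2 * (1 + ρ) ^ 2)) +
          4 * (E * w * D - E * w * w) + D * E * q ^ 2 * (w + 2 * w * ρ + (2 + ρ) * v) +
          E * q ^ 2 * (1 + ρ) ^ 2 * ρ * w := by
        linear_combination -q ^ 2 * (1 + ρ) ^ 2 * E * hE + q ^ 2 * E * (1 + ρ) ^ 2 * hD -
          q ^ 2 * E * D * (3 + ρ) * hv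
      have h6 : 0 ≤ D * E * q ^ 2 * (w + 2 * w * ρ + (2 + ρ) * v) +
          E * q ^ 2 * (1 + ρ) ^ 2 * ρ * w := by positivity
      linarith

/-- The pair inequality with the weight `α = 0`, needed for `β ≥ 1`; the last term is the gain
that is available in this range. -/
theorem pair_inequality_one_weight {X Y P Q : ℝ} (hX : 0 < X) (hY : 0 < Y) (hP : 0 < P)
    (hQ : 0 < Q) (hQP : Q ≤ P) :
    0 ≤ X * (1 - P / X) ^ 2 + (1 - Q / Y) * (overlap X Y - overlap P Q) +
      mutualAttraction X Y * (1 - Q / Y) ^ 2 := by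
  rcases le_total Y X with h | h
  · obtain ⟨r, q, a, b, hr, hr1, hq, hq1, ha, hb, hYr, hQq, hmin, hs, hΔ, hM⟩ :=
      exists_ratios_of_same_order hX hY hP hQ hQP h
    rw [ha, hb, hM, hΔ]
    have hqr : q * r ≤ 1 := by nlinarith
    have hqr0 : 0 < q * r := by positivity
    have : X * a ^ 2 + b * (X * (r * ((2 - r - q) * b + q * a))) + X * (1 - r + r ^ 2) * b ^ 2 =
        X * ((a + q * r / 2 * b) ^ 2 + (1 - (q * r) ^ 2 / 4 + r * (1 - q)) * b ^ 2) := by ring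
    rw [this]
    have : 0 ≤ 1 - (q * r) ^ 2 / 4 + r * (1 - q) := by nlinarith
    positivity
  · obtain ⟨ρ, q, a, b, hρ, hρ1, hq, hq1, ha, hb, hba, hXρ, hQq, hmin, hs, hΔ, hM⟩ :=
      exists_ratios_of_reversed_order hX hY hP hQ hQP h
    rw [ha, hb, hM, hΔ]
    obtain ⟨v, hv⟩ : ∃ v, v = 1 - ρ := ⟨_, rfl⟩
    obtain ⟨w, hw⟩ : ∃ w, w = 1 - q := ⟨_, rfl⟩
    have hv0 : 0 ≤ v := by linarith
    have hw0 : 0 ≤ w := by linarith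
    have hw1 : 0 ≤ 1 - w := by linarith
    have hv1 : 0 ≤ 1 - v := by linarith
    obtain ⟨D, hD⟩ : ∃ D, D = v + ρ * w := ⟨_, rfl⟩
    have hD0 : 0 ≤ D := by rw [hD]; positivity
    have hbD : b = D + q * ρ * a := by rw [hba, hD, hv, hw]; ring
    have e : X * a ^ 2 + b * (Y * (ρ * (1 - ρ + (1 - q) ^ 2 + q * (2 - q) * a))) +
        Y * (1 - ρ + ρ ^ 2) * b ^ 2 =
        Y * (ρ * (1 - q ^ 2 * ρ) * a ^ 2 + ((2 + w + (1 - v + v ^ 2)) * b ^ 2 +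
          -(2 * D + v ^ 2 + w) * b + D ^ 2)) := by
      rw [hXρ]
      have : (1 - ρ + (1 - q) ^ 2 + q * (2 - q) * a) * ρ =
        (1 + w) * b - (v ^ 2 + w) := by rw [hba, hv, hw]; ring
      have h2 : (b - D) ^ 2 = (q * ρ * a) ^ 2 := by rw [hbD]; ring
      have hρv : ρ = 1 - v := by linarith
      have h3 : Y * (1 - ρ + ρ ^ 2) * b ^ 2 = Y * (1 - v + v ^ 2) * b ^ 2 := by rw [hρv]; ring
      rw [h3]
      linear_combination Y * b * this - Y * h2
    rw [e]
    have hA : 0 ≤ 1 - q ^ 2 * ρ := by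
      linarith [mul_le_one₀ (pow_le_one₀ (n := 2) hq.le hq1) hρ.le hρ1]
    have key := quadratic_nonneg (A := 2 + w + (1 - v + v ^ 2)) (B := -(2 * D + v ^ 2 + w))
      (C := D ^ 2) (by linarith [sq_nonneg v]) (by positivity) ?_ b
    · have h1 := mul_nonneg (mul_nonneg hρ.le hA) (sq_nonneg a)
      exact mul_nonneg hY.le (add_nonneg h1 key)
    -- the linear coefficient is compared with `D` before the discriminant is estimated
    · have h1 : 2 * D + v ^ 2 + w ≤ D * (3 + v * w) := by
        have : D * (3 + v * w) - (2 * D + v ^ 2 + w) =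
          v * (1 - v) * ((1 - w) + w ^ 2) := by rw [hD, hv]; ring
        have : 0 ≤ v * (1 - v) * ((1 - w) + w ^ 2) := by positivity
        linarith
      have h2 : (3 + v * w) ^ 2 ≤ 4 * (3 + w - v + v ^ 2) := by
        have h3 : 0 ≤ 3 - 4 * v + 4 * v ^ 2 := by nlinarith [sq_nonneg (2 * v - 1)]
        have h4 : 0 ≤ 7 - 3 * v := by linarith
        have : 4 * (3 + w - v + v ^ 2) - (3 + v * w) ^ 2 = (1 - w) * (3 - 4 * v + 4 * v ^ 2) +
          w * ((1 - v) * (7 - 3 * v)) + v ^ 2 * (w * (1 - w)) := by ring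
        have : 0 ≤ (1 - w) * (3 - 4 * v + 4 * v ^ 2) +
          w * ((1 - v) * (7 - 3 * v)) + v ^ 2 * (w * (1 - w)) := by positivity
        linarith
      have h3 : 0 ≤ 2 * D + v ^ 2 + w := by positivity
      calc (-(2 * D + v ^ 2 + w)) ^ 2 = (2 * D + v ^ 2 + w) ^ 2 := by ring
        _ ≤ (D * (3 + v * w)) ^ 2 := by gcongr
        _ = D ^ 2 * (3 + v * w) ^ 2 := by ring
        _ ≤ D ^ 2 * (4 * (3 + w - v + v ^ 2)) := by gcongr
        _ = _ := by ring

/-- The three inequalities for a pair combined: the weight `α` of the member that is larger in the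
second state lies between the two extreme weights for which the inequality is known, and the
inequality is affine in `α`. -/
theorem pair_inequality {X Y P Q α c : ℝ} (hX : 0 < X) (hY : 0 < Y) (hP : 0 < P)
    (hQ : 0 < Q) (hQP : Q ≤ P) (hα1 : α ≤ 1)
    (hα : (c = 0 ∧ Q / P ≤ α) ∨ (c = 1 ∧ 0 ≤ α)) :
    α * min X Y * (1 - P / X) * (1 - Q / Y) ≤
      (1 - α) * X * (1 - P / X) ^ 2 +
        (α * (1 - P / X) + (1 - Q / Y)) * (overlap X Y - overlap P Q) +
        (P - Q) ^ 2 / (P * Q) * Y * (1 - Q / Y) ^ 2 +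
        c * mutualAttraction X Y * (α * (1 - P / X) ^ 2 + (1 - Q / Y) ^ 2) := by
  have h1 := pair_inequality_equal_weights hX hY hP hQ hQP
  have hs : 0 ≤ (P - Q) ^ 2 / (P * Q) * Y * (1 - Q / Y) ^ 2 := by positivity
  have hα0 : 0 ≤ α := by
    rcases hα with ⟨-, h⟩ | ⟨-, h⟩
    · exact le_trans (by positivity) h
    · exact h
  generalize ha : 1 - P / X = a at *
  generalize hb : 1 - Q / Y = b at *
  rcases hα with ⟨rfl, hq⟩ | ⟨rfl, -⟩
  · have h2 := pair_inequality_proportional_weights hX hY hP hQ hQP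
    rw [ha, hb] at h2
    generalize Q / P = q at *
    generalize overlap X Y - overlap P Q = Δ at *
    generalize (P - Q) ^ 2 / (P * Q) * Y * b ^ 2 = s at *
    rcases hα1.eq_or_lt with rfl | hα1
    · linarith
    · have hq1 : 0 < 1 - q := by linarith
      have := mul_le_mul_of_nonneg_left h1 (sub_nonneg.2 hq)
      have := mul_le_mul_of_nonneg_left h2 (sub_nonneg.2 hα1.le)
      refine le_of_mul_le_mul_left ?_ hq1
      nlinarith [mul_nonneg hs (sub_nonneg.2 hα1.le)]
  · have h2 := pair_inequality_one_weight hX hY hP hQ hQP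
    rw [ha, hb] at h2
    have hM := mutualAttraction_nonneg hX Y
    generalize overlap X Y - overlap P Q = Δ at *
    generalize (P - Q) ^ 2 / (P * Q) * Y * b ^ 2 = s at *
    generalize mutualAttraction X Y = M at *
    have := mul_le_mul_of_nonneg_left h1 hα0
    have := mul_nonneg (sub_nonneg.2 hα1) h2
    have h3 : 0 ≤ M * (α * a ^ 2) := by positivity
    have h4 : 0 ≤ α * (M * b ^ 2) := by positivity
    have h5 := mul_nonneg hs (sub_nonneg.2 hα1)
    linarith

/-! ### Positivity of minimum kernels -/

/-- Multiplying a positive semidefinite kernel by `min (α i) (α j)` with `α ≥ 0` keeps it positive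
semidefinite: split off the least `α k` and induct on the remaining indices. -/
theorem sum_min_mul_nonneg {ι : Type*} [DecidableEq ι] {G : ι → ι → ℝ} {e : ι → ℝ}
    (hG : ∀ s : Finset ι, 0 ≤ ∑ i ∈ s, ∑ j ∈ s, G i j * (e i * e j)) (s : Finset ι) :
    ∀ α : ι → ℝ, (∀ i ∈ s, 0 ≤ α i) →
      0 ≤ ∑ i ∈ s, ∑ j ∈ s, min (α i) (α j) * G i j * (e i * e j) := by
  induction s using Finset.strongInduction with
  | H s ih =>
    intro α hα
    rcases s.eq_empty_or_nonempty with rfl | hs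
    · simp
    obtain ⟨k, hk, hmin⟩ := s.exists_min_image α hs
    have h1 := ih (s.erase k) (Finset.erase_ssubset hk) (fun i => α i - α k)
      (fun i hi => sub_nonneg.2 (hmin i (Finset.mem_of_mem_erase hi)))
    have h2 := mul_nonneg (hα k hk) (hG s)
    have h3 : ∑ i ∈ s, ∑ j ∈ s, min (α i - α k) (α j - α k) * G i j * (e i * e j) =
        ∑ i ∈ s.erase k, ∑ j ∈ s.erase k,
          min (α i - α k) (α j - α k) * G i j * (e i * e j) := by
      rw [← Finset.add_sum_erase s _ hk]
      have : ∑ j ∈ s, min (α k - α k) (α j - α k) * G k j * (e k * e j) = 0 := by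
        refine Finset.sum_eq_zero fun j hj => ?_
        rw [sub_self, min_eq_left (sub_nonneg.2 (hmin j hj))]; ring
      rw [this, zero_add]
      refine Finset.sum_congr rfl fun i hi => ?_
      rw [← Finset.add_sum_erase s _ hk]
      rw [sub_self, min_eq_right (sub_nonneg.2 (hmin i (Finset.mem_of_mem_erase hi)))]; ring
    rw [← h3] at h1
    have h4 : ∑ i ∈ s, ∑ j ∈ s, min (α i) (α j) * G i j * (e i * e j) =
        α k * ∑ i ∈ s, ∑ j ∈ s, G i j * (e i * e j) +
        ∑ i ∈ s, ∑ j ∈ s, min (α i - α k) (α j - α k) * G i j * (e i * e j) := by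
      simp only [Finset.mul_sum, ← Finset.sum_add_distrib]
      refine Finset.sum_congr rfl fun i _ => Finset.sum_congr rfl fun j _ => ?_
      rw [min_sub_sub_right]; ring
    rw [h4]; positivity

/-- The product of two minimum kernels is positive semidefinite. -/
theorem sum_min_mul_min_nonneg {ι : Type*} [Fintype ι] [DecidableEq ι] {α x : ι → ℝ} (e : ι → ℝ)
    (hα : ∀ i, 0 ≤ α i) (hx : ∀ i, 0 ≤ x i) :
    0 ≤ ∑ i, ∑ j, min (α i) (α j) * min (x i) (x j) * (e i * e j) := by
  refine sum_min_mul_nonneg (fun s => ?_) _ α fun i _ => hα i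
  have := sum_min_mul_nonneg (G := fun _ _ => 1) (e := e) (fun s => ?_) s x fun i _ => hx i
  · simpa using this
  · simp only [one_mul]
    rw [← Finset.sum_mul_sum]; exact mul_self_nonneg _

/-! ### The monotonicity inequality for the attraction potential -/

/-- The `χ²`-type deviation `∑ x_k (1 - z_k / x_k)² = ∑ (x_k - z_k)² / x_k` of `z` from `x`. -/
def deviation {K : ℕ} (x z : Fin K → ℝ) : ℝ := ∑ k, x k * (1 - z k / x k) ^ 2

theorem deviation_nonneg {K : ℕ} {x z : Fin K → ℝ} (hx : ∀ k, 0 < x k) : 0 ≤ deviation x z :=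
  Finset.sum_nonneg fun k _ => mul_nonneg (hx k).le (sq_nonneg _)

/-- The potential decreases with the own size at fixed attraction, so that its change is controlled
by that of the attraction; for `β ≥ 1` there is an additional gain. -/
theorem potential_diff_le {β x z θ₁ θ₂ c : ℝ} (hβ : 0 ≤ β) (hc : c = 0 ∨ (c = 1 ∧ 1 ≤ β))
    (hx : 0 < x) (hz : 0 < z) (hθ : 0 ≤ θ₁) :
    (1 - z / x) * (θ₁ * x ^ (-β) - θ₂ * z ^ (-β)) ≤
      z ^ (-β) * ((1 - z / x) * (θ₁ - θ₂) - c * θ₁ * (1 - z / x) ^ 2) := by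
  have hxz : x ^ (-β) = z ^ (-β) * (z / x) ^ β := by
    rw [Real.div_rpow hz.le hx.le, Real.rpow_neg hz.le, Real.rpow_neg hx.le]
    have := (Real.rpow_pos_of_pos hz β).ne'
    field_simp
  have hα : 0 < z ^ (-β) := Real.rpow_pos_of_pos hz _
  rw [hxz]
  obtain ⟨t, ht⟩ : ∃ t, t = z / x := ⟨_, rfl⟩
  have ht0 : 0 < t := by rw [ht]; positivity
  rw [← ht]
  have key : (1 - t) * (t ^ β - 1) ≤ -(c * (1 - t) ^ 2) := by
    rcases le_total t 1 with h | h
    · rcases hc with rfl | ⟨rfl, hβ1⟩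
      · have := Real.rpow_le_one ht0.le h hβ
        nlinarith
      · have : t ^ β ≤ t ^ (1 : ℝ) := Real.rpow_le_rpow_of_exponent_ge ht0 h hβ1
        rw [Real.rpow_one] at this
        nlinarith
    · rcases hc with rfl | ⟨rfl, hβ1⟩
      · have := Real.one_le_rpow h hβ
        nlinarith
      · have : t ^ (1 : ℝ) ≤ t ^ β := Real.rpow_le_rpow_of_exponent_le h hβ1
        rw [Real.rpow_one] at this
        nlinarith
  have := mul_le_mul_of_nonneg_left key (mul_nonneg hα.le hθ)
  linarith

/-- The excess `(z - m)² / (m z)` of the relative attraction of a group of size `m` towards a larger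
group of size `z` over `1`. -/
def excess (m z : ℝ) : ℝ := (z - m) ^ 2 / (m * z)

theorem excess_nonneg {m z : ℝ} (hm : 0 < m) (hz : 0 < z) : 0 ≤ excess m z := by
  unfold excess; positivity

/-- Replacing the size `Q` of the smaller member of a pair by the least size `m` of all groups only
increases the excess. -/
theorem excess_le_of_le {m Q P : ℝ} (hm : 0 < m) (hmQ : m ≤ Q) (hQP : Q ≤ P) :
    (P - Q) ^ 2 / (P * Q) ≤ excess m P := by
  have hQ : 0 < Q := hm.trans_le hmQ
  have hP : 0 < P := hQ.trans_le hQP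
  unfold excess
  rw [div_le_div_iff₀ (by positivity) (by positivity)]
  have : (P - m) ^ 2 * (P * Q) - (P - Q) ^ 2 * (m * P) =
    P * ((Q - m) * (P ^ 2 - m * Q)) := by ring
  have h2 : m * Q ≤ P * P := mul_le_mul (hmQ.trans hQP) hQP hQ.le hP.le
  have : 0 ≤ P * ((Q - m) * (P ^ 2 - m * Q)) :=
    mul_nonneg hP.le (mul_nonneg (by linarith) (by linarith))
  linarith

/-- The pair inequality multiplied by the larger weight `αQ` and split into the contributions of the
two members, with the remaining weights enlarged to the maximal weight `μ`. -/
theorem weighted_pair_inequality {X Y P Q m αP αQ μ c : ℝ} (hX : 0 < X) (hY : 0 < Y)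
    (hm : 0 < m) (hmQ : m ≤ Q) (hQP : Q ≤ P) (hαP : 0 < αP) (hα : αP ≤ αQ) (hμ : αQ ≤ μ)
    (hc : (c = 0 ∧ Q / P ≤ αP / αQ) ∨ c = 1) :
    αP * min X Y * ((1 - P / X) * (1 - Q / Y)) ≤
      (μ * (1 + excess m Q) * (X * (1 - P / X) ^ 2) - αP * (X * (1 - P / X) ^ 2) +
          αP * (1 - P / X) * (overlap X Y - overlap P Q) +
          c * αP * mutualAttraction X Y * (1 - P / X) ^ 2) +
        (μ * (1 + excess m P) * (Y * (1 - Q / Y) ^ 2) - αQ * (Y * (1 - Q / Y) ^ 2) +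
          αQ * (1 - Q / Y) * (overlap X Y - overlap P Q) +
          c * αQ * mutualAttraction X Y * (1 - Q / Y) ^ 2) := by
  have hQ : 0 < Q := hm.trans_le hmQ
  have hP : 0 < P := hQ.trans_le hQP
  have hαQ : 0 < αQ := hαP.trans_le hα
  have h := pair_inequality (α := αP / αQ) (c := c) hX hY hP hQ hQP ((div_le_one hαQ).2 hα)
    (by rcases hc with hc | hc
        · exact Or.inl hc
        · exact Or.inr ⟨hc, by positivity⟩)
  have hs := excess_le_of_le hm hmQ hQP
  have hsQ := excess_nonneg hm hQ
  have hs0 : 0 ≤ (P - Q) ^ 2 / (P * Q) := by positivity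
  generalize hα' : αP / αQ = α at *
  obtain rfl : αP = α * αQ := by rw [← hα']; field_simp
  generalize 1 - P / X = a at *
  generalize 1 - Q / Y = b at *
  generalize overlap X Y - overlap P Q = Δ at *
  generalize mutualAttraction X Y = M at *
  generalize min X Y = n at *
  generalize (P - Q) ^ 2 / (P * Q) = s at *
  have hXa : 0 ≤ X * a ^ 2 := by positivity
  have hYb : 0 ≤ Y * b ^ 2 := by positivity
  have h1 := mul_le_mul_of_nonneg_left h hαQ.le
  have hμ0 : 0 ≤ μ := hαQ.le.trans hμ
  have h2 : αQ * s * (Y * b ^ 2) ≤ μ * excess m P * (Y * b ^ 2) := by gcongr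
  have h3 : αQ * (X * a ^ 2) ≤ μ * (X * a ^ 2) := by gcongr
  have h4 : αQ * (Y * b ^ 2) ≤ μ * (Y * b ^ 2) := by gcongr
  have h5 : 0 ≤ μ * excess m Q * (X * a ^ 2) := by positivity
  linarith

/-- The summand, for the ordered pair `(k, l)`, of the lower bound for the dissipation. -/
def pairTerm {K : ℕ} (β m c : ℝ) (x z : Fin K → ℝ) (k l : Fin K) : ℝ :=
  m ^ (-β) * (1 + excess m (z l)) * (x k * (1 - z k / x k) ^ 2) -
    z k ^ (-β) * (x k * (1 - z k / x k) ^ 2) +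
    z k ^ (-β) * (1 - z k / x k) * (overlap (x k) (x l) - overlap (z k) (z l)) +
    c * z k ^ (-β) * mutualAttraction (x k) (x l) * (1 - z k / x k) ^ 2

/-- The contributions of a pair dominate the entry of a product of two minimum kernels, with a
surplus on the diagonal. -/
theorem kernel_le_pairTerm_add {K : ℕ} {β m c : ℝ} {x z : Fin K → ℝ} (hβ : 0 ≤ β)
    (hc : (c = 0 ∧ β ≤ 1) ∨ (c = 1 ∧ 1 ≤ β)) (hx : ∀ k, 0 < x k) (hm : 0 < m)
    (hz : ∀ k, m ≤ z k) (k l : Fin K) :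
    min (z k ^ (-β)) (z l ^ (-β)) * min (x k) (x l) * ((1 - z k / x k) * (1 - z l / x l)) +
        (if k = l then z k ^ (-β) * (x k * (1 - z k / x k) ^ 2) else 0) ≤
      pairTerm β m c x z k l + pairTerm β m c x z l k := by
  have hz0 : ∀ k, 0 < z k := fun k => hm.trans_le (hz k)
  have hα0 : ∀ k, 0 < z k ^ (-β) := fun k => Real.rpow_pos_of_pos (hz0 k) _
  have hμ : ∀ k, z k ^ (-β) ≤ m ^ (-β) := fun k =>
    Real.rpow_le_rpow_of_nonpos hm (hz k) (by linarith)
  rcases eq_or_ne k l with rfl | hkl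
  · have hc0 : 0 ≤ c := by rcases hc with h | h <;> rw [h.1]; norm_num
    have hd : x k - z k = x k * (1 - z k / x k) := by have := (hx k).ne'; field_simp
    rw [if_pos rfl, min_self, min_self, pairTerm, overlap_self, overlap_self, hd,
      mutualAttraction_self (hx k).le]
    have h0 := excess_nonneg hm (hz0 k)
    have h1 := hμ k
    have h2 := hα0 k
    have h3 : 0 ≤ x k * (1 - z k / x k) ^ 2 := mul_nonneg (hx k).le (sq_nonneg _)
    generalize 1 - z k / x k = e at *
    have h4 : z k ^ (-β) * (x k * e ^ 2) ≤ m ^ (-β) * (1 + excess m (z k)) * (x k * e ^ 2) := by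
      apply mul_le_mul_of_nonneg_right _ h3
      nlinarith
    have hxk := hx k
    have h5 : 0 ≤ c * z k ^ (-β) * x k * e ^ 2 := by positivity
    linarith
  · rw [if_neg hkl, add_zero]
    have main : ∀ k l : Fin K, z l ≤ z k →
        min (z k ^ (-β)) (z l ^ (-β)) * min (x k) (x l) *
          ((1 - z k / x k) * (1 - z l / x l)) ≤
        pairTerm β m c x z k l + pairTerm β m c x z l k := by
      intro k l h
      have hα : z k ^ (-β) ≤ z l ^ (-β) := Real.rpow_le_rpow_of_nonpos (hz0 l) h (by linarith)
      rw [min_eq_left hα]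
      have := weighted_pair_inequality (c := c) (hx k) (hx l) hm (hz l) h (hα0 k) hα (hμ l) (by
        rcases hc with ⟨hc, hβ1⟩ | ⟨hc, -⟩
        · refine Or.inl ⟨hc, ?_⟩
          have hq : z l / z k ≤ 1 := (div_le_one (hz0 k)).2 h
          have hq0 : 0 < z l / z k := div_pos (hz0 l) (hz0 k)
          have e : z k ^ (-β) / z l ^ (-β) = (z l / z k) ^ β := by
            rw [Real.div_rpow (hz0 l).le (hz0 k).le, Real.rpow_neg (hz0 l).le,
              Real.rpow_neg (hz0 k).le]
            field_simp
          rw [e]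
          calc z l / z k = (z l / z k) ^ (1 : ℝ) := (Real.rpow_one _).symm
            _ ≤ (z l / z k) ^ β := Real.rpow_le_rpow_of_exponent_ge hq0 hq hβ1
        · exact Or.inr hc)
      refine this.trans (le_of_eq ?_)
      rw [pairTerm, pairTerm, overlap_comm (x l), overlap_comm (z l), mutualAttraction_comm (x l)]
    rcases le_total (z l) (z k) with h | h
    · exact main k l h
    · have := main l k h
      rw [min_comm (z l ^ (-β)), min_comm (x l), mul_comm (1 - z l / x l), add_comm] at this
      exact this

/-- For the cumulative mutual attraction, the potential is monotone relative to any level `S` that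
dominates the payoffs `A_k(z) / z_k`, with the margin `1/2`. -/
theorem cumulative_monotonicity {K : ℕ} {β S : ℝ} {x z : Fin K → ℝ} (hβ : 0 ≤ β)
    (hx : ∀ k, 0 < x k) (hz : ∀ k, 0 < z k) (hxs : ∑ k, x k = 1) (hzs : ∑ k, z k = 1)
    (hS : ∀ k, attractionPotential cumulativeAttraction β z k ≤ S * z k) :
    ∑ k, (1 - z k / x k) * (attractionPotential cumulativeAttraction β x k -
      attractionPotential cumulativeAttraction β z k) ≤ (S - 1 / 2) * deviation x z := by
  classical
  have hne : (Finset.univ : Finset (Fin K)).Nonempty := by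
    rw [Finset.nonempty_iff_ne_empty]; intro h; rw [h] at hxs; simp at hxs
  obtain ⟨i, -, hi⟩ := Finset.univ.exists_min_image z hne
  have hi : ∀ k, z i ≤ z k := fun k => hi k (Finset.mem_univ k)
  obtain ⟨c, hc⟩ : ∃ c : ℝ, (c = 0 ∧ β ≤ 1) ∨ (c = 1 ∧ 1 ≤ β) := by
    rcases le_total β 1 with h | h
    · exact ⟨0, Or.inl ⟨rfl, h⟩⟩
    · exact ⟨1, Or.inr ⟨rfl, h⟩⟩
  have hW := deviation_nonneg (z := z) hx
  -- the smallest group of `z` gives the lower bound for the level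
  have hSlow : z i ^ (-β) * ∑ l, (1 + excess (z i) (z l)) ≤ S := by
    refine le_of_mul_le_mul_right ?_ (hz i)
    refine le_trans (le_of_eq ?_) (hS i)
    rw [attractionPotential, cumulativeAttraction, mul_comm _ (z i ^ (-β)), mul_assoc,
      Finset.sum_mul]
    congr 1
    refine Finset.sum_congr rfl fun l _ => ?_
    rw [mutualAttraction_comm, mutualAttraction_of_le (hz l) (hi l), excess]
    have := (hz i).ne'; have := (hz l).ne'
    field_simp; ring
  -- summing the pair inequalities
  have hpairs : deviation x z ≤ 2 * ∑ k, ∑ l, pairTerm β (z i) c x z k l := by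
    have h1 : ∑ k, ∑ l, (min (z k ^ (-β)) (z l ^ (-β)) * min (x k) (x l) *
        ((1 - z k / x k) * (1 - z l / x l)) +
        (if k = l then z k ^ (-β) * (x k * (1 - z k / x k) ^ 2) else 0)) ≤
        ∑ k, ∑ l, (pairTerm β (z i) c x z k l + pairTerm β (z i) c x z l k) :=
      Finset.sum_le_sum fun k _ => Finset.sum_le_sum fun l _ =>
        kernel_le_pairTerm_add hβ hc hx (hz i) hi k l
    have h2 := sum_min_mul_min_nonneg (α := fun k => z k ^ (-β)) (x := x)
      (fun k => 1 - z k / x k) (fun k => (Real.rpow_pos_of_pos (hz k) _).le) fun k => (hx k).le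
    have h3 : deviation x z ≤ ∑ k, z k ^ (-β) * (x k * (1 - z k / x k) ^ 2) := by
      refine Finset.sum_le_sum fun k _ => ?_
      refine le_mul_of_one_le_left (mul_nonneg (hx k).le (sq_nonneg _)) ?_
      refine Real.one_le_rpow_of_pos_of_le_one_of_nonpos (hz k) ?_ (by linarith)
      rw [← hzs]; exact Finset.single_le_sum (fun j _ => (hz j).le) (Finset.mem_univ k)
    simp only [Finset.sum_add_distrib, Finset.sum_ite_eq, Finset.mem_univ, if_true] at h1
    rw [Finset.sum_comm (f := fun k l => pairTerm β (z i) c x z l k)] at h1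
    linarith
  have hd : ∀ k, x k - z k = x k * (1 - z k / x k) := fun k => by
    have := (hx k).ne'; field_simp
  have hdsum : ∑ l, (x l - z l) = 0 := by rw [Finset.sum_sub_distrib, hxs, hzs, sub_self]
  have hle : ∀ k, (1 - z k / x k) * (attractionPotential cumulativeAttraction β x k -
      attractionPotential cumulativeAttraction β z k) ≤
      z i ^ (-β) * (∑ l, (1 + excess (z i) (z l))) * (x k * (1 - z k / x k) ^ 2) -
        ∑ l, pairTerm β (z i) c x z k l := by
    intro k
    refine (potential_diff_le (c := c) hβ ?_ (hx k) (hz k) ?_).trans (le_of_eq ?_)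
    · rcases hc with h | h
      · exact Or.inl h.1
      · exact Or.inr h
    · exact Finset.sum_nonneg fun l _ => mutualAttraction_nonneg (hx k) (x l)
    -- the terms `x_l - z_l` of the attraction sum to zero, so only those of group `k` remain
    · have e1 : cumulativeAttraction x k - cumulativeAttraction z k =
          ∑ l, ((x k - z k) - (overlap (x k) (x l) - overlap (z k) (z l))) := by
        have : ∑ l, ((x k - z k) - (overlap (x k) (x l) - overlap (z k) (z l))) =
          ∑ l, ((x k - z k) + (x l - z l) - (overlap (x k) (x l) - overlap (z k) (z l))) := by
          simp only [Finset.sum_sub_distrib, Finset.sum_add_distrib] at hdsum ⊢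
          linarith
        rw [this, cumulativeAttraction, cumulativeAttraction, ← Finset.sum_sub_distrib]
        refine Finset.sum_congr rfl fun l _ => ?_
        rw [mutualAttraction_eq_sub_overlap (hx k) (hx l),
          mutualAttraction_eq_sub_overlap (hz k) (hz l)]; ring
      rw [e1, cumulativeAttraction]
      simp only [Finset.mul_sum, Finset.sum_mul, ← Finset.sum_sub_distrib]
      refine Finset.sum_congr rfl fun l _ => ?_
      rw [pairTerm, hd k]; ring
  calc _ ≤ ∑ k, (z i ^ (-β) * (∑ l, (1 + excess (z i) (z l))) * (x k * (1 - z k / x k) ^ 2) -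
        ∑ l, pairTerm β (z i) c x z k l) := Finset.sum_le_sum fun k _ => hle k
    _ = z i ^ (-β) * (∑ l, (1 + excess (z i) (z l))) * deviation x z -
        ∑ k, ∑ l, pairTerm β (z i) c x z k l := by
      rw [Finset.sum_sub_distrib, ← Finset.mul_sum, deviation]
    _ ≤ S * deviation x z - deviation x z / 2 := by
      have := mul_le_mul_of_nonneg_right hSlow hW
      linarith
    _ = _ := by ring

/-! ### Bounds and Lipschitz continuity of the attraction factors -/

theorem mutualAttraction_zero_right {x : ℝ} (hx : 0 ≤ x) : mutualAttraction x 0 = x := by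
  rcases hx.eq_or_lt with rfl | h
  · exact mutualAttraction_zero_zero
  · rw [mutualAttraction_of_le h hx]; simp

theorem mutualAttraction_bounds {x y : ℝ} (hx : 0 ≤ x) (hy : 0 ≤ y) :
    y / 2 ≤ mutualAttraction x y ∧ mutualAttraction x y ≤ x + y := by
  wlog h : y ≤ x generalizing x y
  · have hxy : x ≤ y := (not_le.1 h).le
    obtain ⟨h1, h2⟩ := this hy hx hxy
    rw [mutualAttraction_comm, add_comm x]
    refine ⟨?_, h2⟩
    have hy0 : 0 < y := hx.trans_lt (not_le.1 h)
    rw [mutualAttraction_of_le hy0 hxy]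
    have : y - x + x ^ 2 / y - y / 2 = ((y - x) ^ 2 + x ^ 2) / (2 * y) := by field_simp; ring
    have : 0 ≤ ((y - x) ^ 2 + x ^ 2) / (2 * y) := by positivity
    linarith
  · rcases hx.eq_or_lt with rfl | hx0
    · obtain rfl : y = 0 := le_antisymm h hy
      simp [mutualAttraction_zero_zero]
    rw [mutualAttraction_of_le hx0 h]
    have e : x - y + y ^ 2 / x - y / 2 = ((x - y) ^ 2 + (x - y) * y / 2 + y ^ 2 / 2) / x := by
      field_simp; ring
    have h1 : 0 ≤ ((x - y) ^ 2 + (x - y) * y / 2 + y ^ 2 / 2) / x := by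
      have := sub_nonneg.2 h
      positivity
    have h2 : y ^ 2 / x ≤ y := by rw [div_le_iff₀ hx0]; nlinarith
    constructor <;> linarith

theorem mutualAttraction_lipschitz_left {a b y : ℝ} (ha : 0 ≤ a) (hab : a ≤ b) (hy : 0 ≤ y) :
    |mutualAttraction b y - mutualAttraction a y| ≤ b - a := by
  rcases hy.eq_or_lt with rfl | hy0
  · rw [mutualAttraction_zero_right ha, mutualAttraction_zero_right (ha.trans hab),
      abs_of_nonneg (sub_nonneg.2 hab)]
  have above : ∀ a b : ℝ, y ≤ a → a ≤ b →
      |mutualAttraction b y - mutualAttraction a y| ≤ b - a := by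
    intro a b hya hab
    have ha0 : 0 < a := hy0.trans_le hya
    have hb0 : 0 < b := ha0.trans_le hab
    rw [mutualAttraction_of_le hb0 (hya.trans hab), mutualAttraction_of_le ha0 hya]
    have e : b - y + y ^ 2 / b - (a - y + y ^ 2 / a) = (b - a) * (1 - y / a * (y / b)) := by
      field_simp; ring
    have h1 : y / a * (y / b) ≤ 1 :=
      mul_le_one₀ ((div_le_one ha0).2 hya) (by positivity) ((div_le_one hb0).2 (hya.trans hab))
    have h2 : 0 ≤ y / a * (y / b) := by positivity
    rw [e, abs_mul, abs_of_nonneg (sub_nonneg.2 hab), abs_of_nonneg (by linarith)]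
    exact mul_le_of_le_one_right (sub_nonneg.2 hab) (by linarith)
  have below : ∀ a b : ℝ, 0 ≤ a → a ≤ b → b ≤ y →
      |mutualAttraction b y - mutualAttraction a y| ≤ b - a := by
    intro a b ha hab hby
    rw [mutualAttraction_comm b, mutualAttraction_comm a, mutualAttraction_of_le hy0 hby,
      mutualAttraction_of_le hy0 (hab.trans hby)]
    have e : y - b + b ^ 2 / y - (y - a + a ^ 2 / y) = (b - a) * ((a + b) / y - 1) := by
      field_simp; ring
    have h1 : (a + b) / y ≤ 2 := by rw [div_le_iff₀ hy0]; linarith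
    have h2 : 0 ≤ (a + b) / y := div_nonneg (by linarith) hy
    rw [e, abs_mul, abs_of_nonneg (sub_nonneg.2 hab)]
    exact mul_le_of_le_one_right (sub_nonneg.2 hab) (abs_le.2 ⟨by linarith, by linarith⟩)
  rcases le_total y a with h | h
  · exact above a b h hab
  rcases le_total b y with h' | h'
  · exact below a b ha hab h'
  · calc _ = |(mutualAttraction b y - mutualAttraction y y) +
          (mutualAttraction y y - mutualAttraction a y)| := by ring_nf
      _ ≤ _ := abs_add_le _ _
      _ ≤ (b - y) + (y - a) := add_le_add (above y b le_rfl h') (below a y ha h le_rfl)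
      _ = b - a := by ring

theorem mutualAttraction_lipschitz {a b y : ℝ} (ha : 0 ≤ a) (hb : 0 ≤ b) (hy : 0 ≤ y) :
    |mutualAttraction b y - mutualAttraction a y| ≤ |b - a| := by
  rcases le_total a b with h | h
  · rw [abs_of_nonneg (sub_nonneg.2 h)]; exact mutualAttraction_lipschitz_left ha h hy
  · rw [abs_sub_comm, abs_sub_comm b, abs_of_nonneg (sub_nonneg.2 h)]
    exact mutualAttraction_lipschitz_left hb h hy

variable {K : ℕ} {Θ : (Fin K → ℝ) → Fin K → ℝ} {β : ℝ} {ε x z : Fin K → ℝ}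

theorem le_one_of_mem_stdSimplex (hx : x ∈ stdSimplex ℝ (Fin K)) (k : Fin K) : x k ≤ 1 := by
  rw [← hx.2]; exact Finset.single_le_sum (fun j _ => hx.1 j) (Finset.mem_univ k)

theorem IsAttractionFactor.exists_bounds (hΘ : IsAttractionFactor Θ) :
    ∃ c C : ℝ, 0 < c ∧ 0 < C ∧ ∀ x ∈ stdSimplex ℝ (Fin K), ∀ k, c ≤ Θ x k ∧ Θ x k ≤ C := by
  rcases hΘ with rfl | ⟨θ, hθ, rfl⟩
  · refine ⟨1 / 2, K + 1, by norm_num, by positivity, fun x hx k => ⟨?_, ?_⟩⟩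
    · calc (1 : ℝ) / 2 = ∑ j, x j / 2 := by rw [← Finset.sum_div, hx.2]
        _ ≤ _ := Finset.sum_le_sum fun j _ => (mutualAttraction_bounds (hx.1 k) (hx.1 j)).1
    · calc cumulativeAttraction x k ≤ ∑ j, (x k + x j) :=
            Finset.sum_le_sum fun j _ => (mutualAttraction_bounds (hx.1 k) (hx.1 j)).2
        _ = K * x k + 1 := by rw [Finset.sum_add_distrib, hx.2]; simp
        _ ≤ K + 1 := by
          have := le_one_of_mem_stdSimplex hx k
          have : (K : ℝ) * x k ≤ K * 1 := by gcongr
          linarith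
  · exact ⟨θ, θ, hθ, hθ, fun x _ k => ⟨le_rfl, le_rfl⟩⟩

theorem IsAttractionFactor.exists_lipschitz (hΘ : IsAttractionFactor Θ) :
    ∃ L : ℝ, 0 ≤ L ∧ ∀ x ∈ stdSimplex ℝ (Fin K), ∀ y ∈ stdSimplex ℝ (Fin K), ∀ k,
      |Θ x k - Θ y k| ≤ L * ‖x - y‖ := by
  rcases hΘ with rfl | ⟨θ, hθ, rfl⟩
  · refine ⟨2 * K, by positivity, fun x hx y hy k => ?_⟩
    have hn : ∀ j, |x j - y j| ≤ ‖x - y‖ := fun j => by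
      simpa using norm_le_pi_norm (x - y) j
    calc |cumulativeAttraction x k - cumulativeAttraction y k|
        = |∑ j, (mutualAttraction (x k) (x j) - mutualAttraction (y k) (y j))| := by
          rw [cumulativeAttraction, cumulativeAttraction, Finset.sum_sub_distrib]
      _ ≤ ∑ j, |mutualAttraction (x k) (x j) - mutualAttraction (y k) (y j)| :=
          Finset.abs_sum_le_sum_abs _ _
      _ ≤ ∑ _j : Fin K, 2 * ‖x - y‖ := by
          refine Finset.sum_le_sum fun j _ => ?_
          have h1 := mutualAttraction_lipschitz (hy.1 k) (hx.1 k) (hx.1 j)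
          have h2 := mutualAttraction_lipschitz (hy.1 j) (hx.1 j) (hy.1 k)
          rw [mutualAttraction_comm (x j), mutualAttraction_comm (y j)] at h2
          have h3 := abs_sub_le (mutualAttraction (x k) (x j)) (mutualAttraction (y k) (x j))
            (mutualAttraction (y k) (y j))
          linarith [hn k, hn j]
      _ = 2 * K * ‖x - y‖ := by simp; ring
  · exact ⟨0, le_rfl, fun x _ y _ k => by simp⟩

theorem IsAttractionFactor.const_apply (hΘ : IsAttractionFactor Θ) (a : ℝ) (j k : Fin K) :
    Θ (fun _ => a) j = Θ (fun _ => a) k := by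
  rcases hΘ with rfl | ⟨θ, hθ, rfl⟩ <;> rfl

theorem one_le_rpow_neg (hβ : 0 ≤ β) (hx : x ∈ stateSpace K β) (k : Fin K) :
    1 ≤ x k ^ (-β) := by
  rcases eq_or_ne β 0 with rfl | h
  · simp
  · exact Real.one_le_rpow_of_pos_of_le_one_of_nonpos (hx.2 h k)
      (le_one_of_mem_stdSimplex hx.1 k) (by linarith)

theorem rpow_neg_le_rpow_neg (hβ : 0 ≤ β) (hx : x ∈ stateSpace K β) {j k : Fin K}
    (h : x j ≤ x k) : x k ^ (-β) ≤ x j ^ (-β) := by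
  rcases eq_or_ne β 0 with rfl | hβ0
  · simp
  · exact Real.rpow_le_rpow_of_nonpos (hx.2 hβ0 j) h (by linarith)

theorem IsAttractionFactor.nonneg (hΘ : IsAttractionFactor Θ) (hx : x ∈ stdSimplex ℝ (Fin K))
    (k : Fin K) : 0 ≤ Θ x k := by
  obtain ⟨c, C, hc, -, h⟩ := hΘ.exists_bounds
  exact hc.le.trans (h x hx k).1

/-- The margin by which the attraction potential is monotone relative to a level `S` that dominates
the payoffs `A_k(z) / z_k`. This is the property from which uniqueness, convergence and stability
of the fixed point are derived. -/
theorem IsAttractionFactor.exists_monotonicity (hΘ : IsAttractionFactor Θ) (hβ : 0 ≤ β) :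
    ∃ c : ℝ, 0 < c ∧ ∀ (S : ℝ) (x z : Fin K → ℝ), x ∈ stdSimplex ℝ (Fin K) →
      z ∈ stdSimplex ℝ (Fin K) → (∀ k, 0 < x k) → (∀ k, 0 < z k) →
      (∀ k, attractionPotential Θ β z k ≤ S * z k) →
      ∑ k, (1 - z k / x k) * (attractionPotential Θ β x k - attractionPotential Θ β z k) ≤
        (S - c) * deviation x z := by
  rcases hΘ with rfl | ⟨θ, hθ, rfl⟩
  · exact ⟨1 / 2, by norm_num, fun S x z hx hz hx0 hz0 hS =>
      cumulative_monotonicity hβ hx0 hz0 hx.2 hz.2 hS⟩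
  · refine ⟨θ, hθ, fun S x z hx hz hx0 hz0 hS => ?_⟩
    have h1 : ∑ k, (1 - z k / x k) * (attractionPotential (fun _ _ => θ) β x k -
        attractionPotential (fun _ _ => θ) β z k) ≤ 0 := by
      refine Finset.sum_nonpos fun k _ => ?_
      have := potential_diff_le (θ₂ := θ) (c := 0) hβ (Or.inl rfl) (hx0 k) (hz0 k) hθ.le
      simpa [attractionPotential] using this
    have h2 : 0 ≤ S - θ := by
      have hne : (Finset.univ : Finset (Fin K)).Nonempty := by
        rw [Finset.nonempty_iff_ne_empty]; intro h
        have := hx.2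
        rw [h] at this; simp at this
      obtain ⟨k, -⟩ := hne
      have hk := hS k
      have h3 : 1 ≤ z k ^ (-β) := one_le_rpow_neg hβ ⟨hz, fun _ => hz0⟩ k
      have h4 := le_one_of_mem_stdSimplex hz k
      have h5 : θ ≤ θ * z k ^ (-β) := le_mul_of_one_le_right hθ.le h3
      simp only [attractionPotential] at hk
      by_contra! hlt
      have h6 : S * z k < θ := by
        rcases le_total S 0 with hS0 | hS0
        · exact (mul_nonpos_of_nonpos_of_nonneg hS0 (hz0 k).le).trans_lt hθ
        · exact (mul_le_of_le_one_right hS0 h4).trans_lt (by linarith)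
      linarith
    exact h1.trans (mul_nonneg h2 (deviation_nonneg hx0))

/-- Along a fixed level `S` dominating the payoffs, the potential grows more slowly than `S` times
the group size; hence larger groups at a fixed point have larger biases. -/
theorem IsAttractionFactor.potential_sub_lt (hΘ : IsAttractionFactor Θ) (hβ : 0 ≤ β) {S : ℝ}
    (hz : z ∈ stdSimplex ℝ (Fin K)) (hz0 : ∀ k, 0 < z k)
    (hS : ∀ k, attractionPotential Θ β z k ≤ S * z k) {j k : Fin K} (h : z j < z k) :
    attractionPotential Θ β z k - attractionPotential Θ β z j < S * (z k - z j) := by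
  have hzs : z ∈ stateSpace K β := ⟨hz, fun _ => hz0⟩
  have hmono := rpow_neg_le_rpow_neg hβ hzs h.le
  have hS0 : 0 < S := by
    have h1 := hS k
    have h2 : 0 < attractionPotential Θ β z k := by
      obtain ⟨c, C, hc, -, hb⟩ := hΘ.exists_bounds
      exact mul_pos (hc.trans_le (hb z hz k).1) (Real.rpow_pos_of_pos (hz0 k) _)
    by_contra! hle
    have := mul_nonpos_of_nonpos_of_nonneg hle (hz0 k).le
    linarith
  have h1 : attractionPotential Θ β z k - attractionPotential Θ β z j ≤
      z j ^ (-β) * (Θ z k - Θ z j) := by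
    have := mul_le_mul_of_nonneg_left hmono (hΘ.nonneg hz k)
    simp only [attractionPotential]; linarith
  rcases hΘ with rfl | ⟨θ, hθ, rfl⟩
  -- the smallest group bounds the level from below, since `M(z_i, z_l) ≥ z_i` for all `l`
  · have hne : (Finset.univ : Finset (Fin K)).Nonempty := ⟨j, Finset.mem_univ j⟩
    obtain ⟨i, -, hi⟩ := Finset.univ.exists_min_image z hne
    have hi : ∀ k, z i ≤ z k := fun k => hi k (Finset.mem_univ k)
    have hpos : 0 < z j ^ (-β) := Real.rpow_pos_of_pos (hz0 j) _
    have hlow : z j ^ (-β) * K ≤ S := by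
      have hSi := hS i
      have h2 : (K : ℝ) * z i ≤ cumulativeAttraction z i := by
        calc (K : ℝ) * z i = ∑ _l : Fin K, z i := by simp
          _ ≤ _ := by
            refine Finset.sum_le_sum fun l _ => ?_
            rw [mutualAttraction_comm, mutualAttraction_of_le (hz0 l) (hi l)]
            have : z l - z i + z i ^ 2 / z l - z i = (z l - z i) ^ 2 / z l := by
              have := (hz0 l).ne'
              field_simp; ring
            have : 0 ≤ (z l - z i) ^ 2 / z l := div_nonneg (sq_nonneg _) (hz0 l).le
            linarith
      have h3 : z j ^ (-β) ≤ z i ^ (-β) := rpow_neg_le_rpow_neg hβ hzs (hi j)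
      refine le_of_mul_le_mul_right ?_ (hz0 i)
      calc z j ^ (-β) * K * z i ≤ z i ^ (-β) * K * z i := by
            have := (hz0 i).le
            have := Real.rpow_nonneg this (-β)
            gcongr
        _ = (K * z i) * z i ^ (-β) := by ring
        _ ≤ cumulativeAttraction z i * z i ^ (-β) :=
            mul_le_mul_of_nonneg_right h2 (Real.rpow_nonneg (hz0 i).le _)
        _ ≤ S * z i := hSi
    have h4 : cumulativeAttraction z k - cumulativeAttraction z j < K * (z k - z j) := by
      calc _ = ∑ l, (mutualAttraction (z k) (z l) - mutualAttraction (z j) (z l)) := by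
            rw [Finset.sum_sub_distrib]; rfl
        _ < ∑ _l : Fin K, (z k - z j) := by
            refine Finset.sum_lt_sum (fun l _ => (le_abs_self _).trans
              (mutualAttraction_lipschitz_left (hz0 j).le h.le (hz0 l).le))
              ⟨k, Finset.mem_univ k, ?_⟩
            rw [mutualAttraction_self (hz0 k).le, mutualAttraction_comm,
              mutualAttraction_of_le (hz0 k) h.le]
            have e : z k - z j - (z k - (z k - z j + z j ^ 2 / z k)) = (z k - z j) ^ 2 / z k := by
              have := (hz0 k).ne'
              field_simp; ring
            have : 0 < (z k - z j) ^ 2 / z k := div_pos (pow_pos (sub_pos.2 h) 2) (hz0 k)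
            linarith
        _ = _ := by simp [mul_sub]
    calc _ ≤ _ := h1
      _ < z j ^ (-β) * (K * (z k - z j)) := mul_lt_mul_of_pos_left h4 hpos
      _ = z j ^ (-β) * K * (z k - z j) := by ring
      _ ≤ S * (z k - z j) := mul_le_mul_of_nonneg_right hlow (sub_pos.2 h).le
  · have := mul_pos hS0 (sub_pos.2 h)
    simp only [sub_self, mul_zero] at h1
    linarith

/-! ### Total potential, choice probabilities and fixed points -/

/-- The normalizing sum `∑ (a_j + ε_j)` of the choice probabilities. -/
def totalPotential (Θ : (Fin K → ℝ) → Fin K → ℝ) (β : ℝ) (ε : Fin K → ℝ) (x : Fin K → ℝ) : ℝ :=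
  ∑ j, (attractionPotential Θ β x j + ε j)

theorem IsAttractionFactor.potential_pos (hΘ : IsAttractionFactor Θ) (hβ : 0 ≤ β)
    (hx : x ∈ stateSpace K β) (k : Fin K) : 0 < attractionPotential Θ β x k := by
  obtain ⟨c, C, hc, -, hb⟩ := hΘ.exists_bounds
  exact mul_pos (hc.trans_le (hb x hx.1 k).1)
    (zero_lt_one.trans_le (one_le_rpow_neg hβ hx k))

theorem IsAttractionFactor.totalPotential_pos (hΘ : IsAttractionFactor Θ) (hβ : 0 ≤ β)
    (hε : ∀ k, 0 ≤ ε k) (hx : x ∈ stateSpace K β) : 0 < totalPotential Θ β ε x := by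
  refine Finset.sum_pos (fun k _ => add_pos_of_pos_of_nonneg (hΘ.potential_pos hβ hx k) (hε k)) ?_
  rw [Finset.nonempty_iff_ne_empty]; intro h
  have := hx.1.2
  rw [h] at this; simp at this

theorem IsAttractionFactor.choiceProb_pos (hΘ : IsAttractionFactor Θ) (hβ : 0 ≤ β)
    (hε : ∀ k, 0 ≤ ε k) (hx : x ∈ stateSpace K β) (k : Fin K) : 0 < choiceProb Θ β ε x k :=
  div_pos (add_pos_of_pos_of_nonneg (hΘ.potential_pos hβ hx k) (hε k))
    (hΘ.totalPotential_pos hβ hε hx)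

theorem IsAttractionFactor.sum_choiceProb (hΘ : IsAttractionFactor Θ) (hβ : 0 ≤ β)
    (hε : ∀ k, 0 ≤ ε k) (hx : x ∈ stateSpace K β) : ∑ k, choiceProb Θ β ε x k = 1 := by
  have := (hΘ.totalPotential_pos hβ hε hx).ne'
  simp only [choiceProb, ← Finset.sum_div]
  exact div_self this

theorem IsAttractionFactor.choiceProb_eq_iff (hΘ : IsAttractionFactor Θ) (hβ : 0 ≤ β)
    (hε : ∀ k, 0 ≤ ε k) (hx : x ∈ stateSpace K β) : choiceProb Θ β ε x = x ↔
      ∀ k, attractionPotential Θ β x k + ε k = totalPotential Θ β ε x * x k := by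
  have h := hΘ.totalPotential_pos hβ hε hx
  rw [funext_iff]
  refine forall_congr' fun k => ?_
  rw [choiceProb, ← totalPotential, div_eq_iff h.ne', mul_comm]

/-- The smallest group attracts newcomers with a probability bounded away from `0`. -/
theorem IsAttractionFactor.exists_le_choiceProb (hΘ : IsAttractionFactor Θ) (hβ : 0 ≤ β)
    {E : ℝ} (hE : 0 ≤ E) : ∃ c : ℝ, 0 < c ∧ ∀ ε : Fin K → ℝ, (∀ k, 0 ≤ ε k) → ∑ k, ε k ≤ E →
      ∀ x ∈ stateSpace K β, ∀ i, (∀ k, x i ≤ x k) → c ≤ choiceProb Θ β ε x i := by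
  obtain ⟨c, C, hc, hC, hb⟩ := hΘ.exists_bounds
  refine ⟨c / (K * C + E + 1), by positivity, fun ε hε hεE x hx i hi => ?_⟩
  have h1 := one_le_rpow_neg hβ hx i
  have hT : totalPotential Θ β ε x ≤ (K * C + E + 1) * x i ^ (-β) := by
    calc totalPotential Θ β ε x ≤ ∑ k, (C * x i ^ (-β) + ε k) := by
          refine Finset.sum_le_sum fun k _ => add_le_add_left ?_ _
          exact mul_le_mul (hb x hx.1 k).2 (rpow_neg_le_rpow_neg hβ hx (hi k))
            (zero_le_one.trans (one_le_rpow_neg hβ hx k)) hC.le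
      _ = K * C * x i ^ (-β) + ∑ k, ε k := by
          rw [Finset.sum_add_distrib]; simp; ring
      _ ≤ _ := by
          have := le_mul_of_one_le_right hE h1
          have : 0 ≤ x i ^ (-β) := zero_le_one.trans h1
          linarith
  rw [choiceProb, ← totalPotential, div_le_div_iff₀ (by positivity)
    (hΘ.totalPotential_pos hβ hε hx)]
  calc c * totalPotential Θ β ε x ≤ c * ((K * C + E + 1) * x i ^ (-β)) := by gcongr
    _ = (c * x i ^ (-β)) * (K * C + E + 1) := by ring
    _ ≤ (attractionPotential Θ β x i + ε i) * (K * C + E + 1) := by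
      refine mul_le_mul_of_nonneg_right ?_ (by positivity)
      have : c * x i ^ (-β) ≤ attractionPotential Θ β x i :=
        mul_le_mul_of_nonneg_right (hb x hx.1 i).1 (by positivity)
      linarith [hε i]

theorem IsAttractionFactor.exists_totalPotential_le (hΘ : IsAttractionFactor Θ) (hβ : 0 ≤ β)
    {a : ℝ} (ha : 0 < a) : ∃ C : ℝ, 0 < C ∧ ∀ x ∈ stdSimplex ℝ (Fin K), (∀ k, a ≤ x k) →
      totalPotential Θ β ε x ≤ C := by
  obtain ⟨c, C, hc, hC, hb⟩ := hΘ.exists_bounds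
  refine ⟨∑ k, (C * a ^ (-β) + |ε k|) + 1, by positivity, fun x hx hxa => ?_⟩
  have : totalPotential Θ β ε x ≤ ∑ k, (C * a ^ (-β) + |ε k|) := by
    refine Finset.sum_le_sum fun k _ => add_le_add ?_ (le_abs_self _)
    exact mul_le_mul (hb x hx k).2 (Real.rpow_le_rpow_of_nonpos ha (hxa k) (by linarith))
      (Real.rpow_nonneg (hx.1 k) _) hC.le
  linarith

theorem sum_one_sub_div_mul_self (hx : x ∈ stdSimplex ℝ (Fin K)) (hz : z ∈ stdSimplex ℝ (Fin K))
    (hx0 : ∀ k, 0 < x k) : ∑ k, (1 - z k / x k) * x k = 0 := by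
  have : ∀ k, (1 - z k / x k) * x k = x k - z k := fun k => by have := (hx0 k).ne'; field_simp
  simp only [this, Finset.sum_sub_distrib, hx.2, hz.2, sub_self]

theorem sum_one_sub_div_mul (hx : x ∈ stdSimplex ℝ (Fin K)) (hz : z ∈ stdSimplex ℝ (Fin K))
    (hx0 : ∀ k, 0 < x k) : ∑ k, (1 - z k / x k) * z k = -deviation x z := by
  have h1 := sum_one_sub_div_mul_self hx hz hx0
  have : ∀ k, (1 - z k / x k) * z k = (1 - z k / x k) * x k - x k * (1 - z k / x k) ^ 2 :=
    fun k => by have := (hx0 k).ne'; field_simp; ring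
  simp only [this, Finset.sum_sub_distrib, h1, deviation, zero_sub]

/-- Towards a fixed point `z` the mean field is dissipative with respect to the relative entropy:
the weights `1 - z_k / x_k` form its gradient on the simplex. -/
theorem IsAttractionFactor.exists_dissipation (hΘ : IsAttractionFactor Θ) (hβ : 0 ≤ β) :
    ∃ c : ℝ, 0 < c ∧ ∀ ε : Fin K → ℝ, (∀ k, 0 ≤ ε k) →
      ∀ z ∈ stateSpace K β, choiceProb Θ β ε z = z →
      ∀ x ∈ stdSimplex ℝ (Fin K), (∀ k, 0 < x k) →
      ∑ k, (1 - z k / x k) * (choiceProb Θ β ε x k - x k) ≤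
        -(c / totalPotential Θ β ε x * deviation x z) := by
  obtain ⟨c, hc, h⟩ := hΘ.exists_monotonicity (K := K) hβ
  refine ⟨c, hc, fun ε hε z hz hfix x hx hx0 => ?_⟩
  have hz0 : ∀ k, 0 < z k := fun k => by rw [← hfix]; exact hΘ.choiceProb_pos hβ hε hz k
  have hfix' := (hΘ.choiceProb_eq_iff hβ hε hz).1 hfix
  have hT := hΘ.totalPotential_pos hβ hε (x := x) ⟨hx, fun _ => hx0⟩
  have h1 := h (totalPotential Θ β ε z) x z hx hz.1 hx0 hz0
    fun k => by rw [← hfix' k]; linarith [hε k]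
  have h2 := sum_one_sub_div_mul_self hx hz.1 hx0
  have h3 := sum_one_sub_div_mul hx hz.1 hx0
  have h4 : ∑ k, (1 - z k / x k) * (choiceProb Θ β ε x k - x k) =
      (∑ k, (1 - z k / x k) * (attractionPotential Θ β x k - attractionPotential Θ β z k) -
        totalPotential Θ β ε z * deviation x z) / totalPotential Θ β ε x := by
    have e : ∀ k, (1 - z k / x k) * (choiceProb Θ β ε x k - x k) =
        ((1 - z k / x k) * (attractionPotential Θ β x k - attractionPotential Θ β z k) +
          totalPotential Θ β ε z * ((1 - z k / x k) * z k)) / totalPotential Θ β ε x -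
          (1 - z k / x k) * x k := by
      intro k
      have e1 : choiceProb Θ β ε x k =
        (attractionPotential Θ β x k + ε k) / totalPotential Θ β ε x := rfl
      rw [e1, eq_sub_of_add_eq' (hfix' k)]
      ring
    simp only [e, Finset.sum_sub_distrib, h2, ← Finset.sum_div, Finset.sum_add_distrib,
      ← Finset.mul_sum, h3]
    ring
  rw [h4, div_le_iff₀ hT]
  have : -(c / totalPotential Θ β ε x * deviation x z) * totalPotential Θ β ε x =
    -(c * deviation x z) := by field_simp
  rw [this]; linarith

theorem eq_of_deviation_eq_zero (hx0 : ∀ k, 0 < x k) (h : deviation x z ≤ 0) : x = z := by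
  have h0 := (Finset.sum_eq_zero_iff_of_nonneg
    (fun k _ => mul_nonneg (hx0 k).le (sq_nonneg (1 - z k / x k)))).1
    (le_antisymm h (deviation_nonneg hx0))
  funext k
  have := h0 k (Finset.mem_univ k)
  have h1 : 1 - z k / x k = 0 := by
    rcases mul_eq_zero.1 this with h | h
    · exact absurd h (hx0 k).ne'
    · exact pow_eq_zero_iff (two_ne_zero) |>.1 h
  have := (hx0 k).ne'
  field_simp at h1
  linarith

theorem IsAttractionFactor.fixedPoint_unique (hΘ : IsAttractionFactor Θ) (hβ : 0 ≤ β)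
    (hε : ∀ k, 0 ≤ ε k) (hz : z ∈ stateSpace K β) (hzf : choiceProb Θ β ε z = z)
    (hx : x ∈ stateSpace K β) (hxf : choiceProb Θ β ε x = x) : x = z := by
  obtain ⟨c, hc, h⟩ := hΘ.exists_dissipation (K := K) hβ
  have hx0 : ∀ k, 0 < x k := fun k => by rw [← hxf]; exact hΘ.choiceProb_pos hβ hε hx k
  have h1 := h ε hε z hz hzf x hx.1 hx0
  have hT := hΘ.totalPotential_pos hβ hε hx
  simp only [hxf, sub_self, mul_zero, Finset.sum_const_zero] at h1
  refine eq_of_deviation_eq_zero hx0 ?_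
  have h2 : 0 < c / totalPotential Θ β ε x := div_pos hc hT
  by_contra! hpos
  have := mul_pos h2 hpos
  linarith

theorem IsAttractionFactor.fixedPoint_lt_iff (hΘ : IsAttractionFactor Θ) (hβ : 0 ≤ β)
    (hε : ∀ k, 0 ≤ ε k) (hz : z ∈ stateSpace K β) (hzf : choiceProb Θ β ε z = z) (j k : Fin K) :
    z j < z k ↔ ε j < ε k := by
  have hz0 : ∀ k, 0 < z k := fun k => by rw [← hzf]; exact hΘ.choiceProb_pos hβ hε hz k
  have hfix := (hΘ.choiceProb_eq_iff hβ hε hz).1 hzf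
  have main : ∀ j k, z j < z k → ε j < ε k := fun j k h => by
    have := hΘ.potential_sub_lt hβ hz.1 hz0 (S := totalPotential Θ β ε z)
      (fun k => by rw [← hfix k]; linarith [hε k]) h
    have h1 := hfix j
    have h2 := hfix k
    linarith
  refine ⟨main j k, fun h => ?_⟩
  rcases lt_trichotomy (z j) (z k) with h' | h' | h'
  · exact h'
  · have h1 := hfix j
    have h2 := hfix k
    have h3 : attractionPotential Θ β z j = attractionPotential Θ β z k := by
      simp only [attractionPotential, h']
      congr 1
      rcases hΘ with rfl | ⟨θ, hθ, rfl⟩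
      · simp only [cumulativeAttraction, h']
      · rfl
    rw [h3, h'] at h1
    linarith
  · exact absurd (main k j h') (by linarith)

theorem IsAttractionFactor.fixedPoint_of_equal_bias (hΘ : IsAttractionFactor Θ) (hβ : 0 ≤ β)
    (hε : ∀ k, 0 ≤ ε k) (hz : z ∈ stateSpace K β) (hzf : choiceProb Θ β ε z = z)
    (heq : ∀ j k, ε j = ε k) (k : Fin K) : z k = 1 / (K : ℝ) := by
  have h : ∀ j, z j = z k := fun j => by
    rcases lt_trichotomy (z j) (z k) with h | h | h
    · exact absurd ((hΘ.fixedPoint_lt_iff hβ hε hz hzf j k).1 h)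
        (by rw [heq j k]; exact lt_irrefl _)
    · exact h
    · exact absurd ((hΘ.fixedPoint_lt_iff hβ hε hz hzf k j).1 h)
        (by rw [heq j k]; exact lt_irrefl _)
  have hs := hz.1.2
  simp only [h, Finset.sum_const, Finset.card_univ, Fintype.card_fin, nsmul_eq_mul] at hs
  have : (K : ℝ) ≠ 0 := fun h0 => by rw [h0] at hs; simp at hs
  field_simp; linarith

/-! ### Zeros of locally monotone vector fields -/

theorem norm_sq_le_sum_sq {K : ℕ} (d : Fin K → ℝ) : ‖d‖ ^ 2 ≤ ∑ k, d k ^ 2 := by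
  have h : ‖d‖ ≤ √(∑ k, d k ^ 2) := by
    refine (pi_norm_le_iff_of_nonneg (Real.sqrt_nonneg _)).2 fun k => ?_
    refine Real.le_sqrt_of_sq_le ?_
    rw [Real.norm_eq_abs, sq_abs]
    exact Finset.single_le_sum (f := fun k => d k ^ 2) (fun j _ => sq_nonneg _) (Finset.mem_univ k)
  calc ‖d‖ ^ 2 ≤ √(∑ k, d k ^ 2) ^ 2 := by gcongr
    _ = _ := Real.sq_sqrt (Finset.sum_nonneg fun k _ => sq_nonneg _)

theorem abs_apply_le_norm {K : ℕ} (d : Fin K → ℝ) (k : Fin K) : |d k| ≤ ‖d‖ := by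
  simpa using norm_le_pi_norm d k

/-- A tangent vector field on the simplex that is strongly monotone and Lipschitz near `z`, and
small at `z`, has a zero near `z`. The zero is a minimizer of the weighted square norm of the field:
at a minimizer where the field did not vanish, a short step along the field would decrease the
norm. -/
theorem exists_zero_of_strongly_monotone {K : ℕ} {z w : Fin K → ℝ} {F : (Fin K → ℝ) → Fin K → ℝ}
    {a ρ m L W ω : ℝ} (hρ : 0 < ρ) (hm : 0 < m) (hL : 0 ≤ L) (hω : 0 ≤ ω)
    (hz : z ∈ stdSimplex ℝ (Fin K)) (hza : ∀ k, a ≤ z k) (hρa : ρ ≤ a)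
    (hw1 : ∀ k, 1 ≤ w k) (hwW : ∀ k, w k ≤ W)
    (hF0 : ∀ x ∈ stdSimplex ℝ (Fin K), ‖x - z‖ ≤ ρ → ∑ k, F x k = 0)
    (hmono : ∀ x ∈ stdSimplex ℝ (Fin K), ∀ y ∈ stdSimplex ℝ (Fin K), ‖x - z‖ ≤ ρ → ‖y - z‖ ≤ ρ →
      ∑ k, w k * (x k - y k) * (F x k - F y k) ≤ -(m * ∑ k, (x k - y k) ^ 2))
    (hlip : ∀ x ∈ stdSimplex ℝ (Fin K), ∀ y ∈ stdSimplex ℝ (Fin K), ‖x - z‖ ≤ ρ → ‖y - z‖ ≤ ρ →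
      ∀ k, |F x k - F y k| ≤ L * ‖x - y‖)
    (hsmall : ∑ k, w k * F z k ^ 2 ≤ ω ^ 2) (hωρ : 2 * W * K * ω < m * ρ) :
    ∃ x ∈ stdSimplex ℝ (Fin K), ‖x - z‖ ≤ ρ ∧ F x = 0 := by
  have hw0 : ∀ k, 0 ≤ w k := fun k => zero_le_one.trans (hw1 k)
  set B : Set (Fin K → ℝ) := stdSimplex ℝ (Fin K) ∩ Metric.closedBall z ρ with hB
  have hBmem : ∀ x, x ∈ B ↔ x ∈ stdSimplex ℝ (Fin K) ∧ ‖x - z‖ ≤ ρ := fun x => by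
    rw [hB, Set.mem_inter_iff, Metric.mem_closedBall, dist_eq_norm]
  have hzB : z ∈ B := (hBmem z).2 ⟨hz, by simpa using hρ.le⟩
  have hBc : IsCompact B := (isCompact_stdSimplex ℝ (Fin K)).inter_right Metric.isClosed_closedBall
  have hcont : ∀ k, ContinuousOn (fun x => F x k) B := fun k => by
    have : LipschitzOnWith ⟨L, hL⟩ (fun x => F x k) B := by
      refine LipschitzOnWith.of_dist_le_mul fun x hx y hy => ?_
      rw [Real.dist_eq, dist_eq_norm]
      exact hlip x ((hBmem x).1 hx).1 y ((hBmem y).1 hy).1 ((hBmem x).1 hx).2 ((hBmem y).1 hy).2 k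
    exact this.continuousOn
  obtain ⟨x, hxB, hmin⟩ := hBc.exists_isMinOn ⟨z, hzB⟩
    (continuousOn_finsetSum Finset.univ fun k _ => ((hcont k).pow 2).const_mul (w k) :
      ContinuousOn (fun x => ∑ k, w k * F x k ^ 2) B)
  obtain ⟨hx, hxρ⟩ := (hBmem x).1 hxB
  have hle : ∀ y ∈ B, ∑ k, w k * F x k ^ 2 ≤ ∑ k, w k * F y k ^ 2 := fun y hy => hmin hy
  refine ⟨x, hx, hxρ, ?_⟩
  have habs : ∀ y : Fin K → ℝ, ∑ k, w k * F y k ^ 2 ≤ ω ^ 2 → ∀ k, |F y k| ≤ ω := by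
    intro y hy k
    refine abs_le_of_sq_le_sq ?_ hω
    calc F y k ^ 2 ≤ w k * F y k ^ 2 := le_mul_of_one_le_left (sq_nonneg _) (hw1 k)
      _ ≤ ∑ k, w k * F y k ^ 2 := Finset.single_le_sum (f := fun k => w k * F y k ^ 2)
          (fun j _ => mul_nonneg (hw0 j) (sq_nonneg _)) (Finset.mem_univ k)
      _ ≤ ω ^ 2 := hy
  -- the minimizer is an interior point of the ball
  have hint : ‖x - z‖ < ρ := by
    have h1 := hmono x hx z hz hxρ (by simpa using hρ.le)
    have h2 := norm_sq_le_sum_sq (x - z)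
    have h3 : -∑ k, w k * (x k - z k) * (F x k - F z k) ≤ ∑ _k : Fin K, W * ‖x - z‖ * (2 * ω) := by
      rw [← Finset.sum_neg_distrib]
      refine Finset.sum_le_sum fun k _ => (neg_le_abs _).trans ?_
      rw [abs_mul, abs_mul, abs_of_nonneg (hw0 k)]
      have e1 := habs x ((hle z hzB).trans hsmall) k
      have e2 := habs z hsmall k
      have e3 : |F x k - F z k| ≤ 2 * ω := (abs_sub _ _).trans (by linarith)
      have e4 : |x k - z k| ≤ ‖x - z‖ := abs_apply_le_norm (x - z) k
      have := hwW k; have := hw0 k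
      have : 0 ≤ W := this.trans (hwW k)
      gcongr
    simp only [Finset.sum_const, Finset.card_univ, Fintype.card_fin, nsmul_eq_mul,
      Pi.sub_apply] at h2 h3
    have h4 : m * ‖x - z‖ ^ 2 ≤ (2 * W * K * ω) * ‖x - z‖ := by
      have := mul_le_mul_of_nonneg_left h2 hm.le
      linarith
    by_contra! hge
    have h5 : 0 < ‖x - z‖ := hρ.trans_le hge
    have h6 : m * ρ * ‖x - z‖ ≤ m * ‖x - z‖ ^ 2 := by
      rw [sq, ← mul_assoc]; gcongr
    have h7 := mul_lt_mul_of_pos_right hωρ h5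
    linarith
  by_contra hne
  set f := F x with hf
  have hfn : 0 < ‖f‖ := norm_pos_iff.2 hne
  set q := ∑ k, f k ^ 2 with hq
  have hq0 : 0 < q := (by positivity : 0 < ‖f‖ ^ 2).trans_le (norm_sq_le_sum_sq f)
  have hWK : 0 ≤ K * W * L ^ 2 := by
    rcases Nat.eq_zero_or_pos K with rfl | hK
    · simp
    · have : 0 ≤ W := (hw0 ⟨0, hK⟩).trans (hwW _)
      positivity
  -- a step along the field that stays in the ball and is short enough to decrease the norm
  obtain ⟨τ, hτ0, hτρ, hτm⟩ : ∃ τ : ℝ, 0 < τ ∧ τ * ‖f‖ ≤ ρ - ‖x - z‖ ∧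
      K * W * L ^ 2 * τ < 2 * m := by
    refine ⟨min ((ρ - ‖x - z‖) / ‖f‖) (m / (K * W * L ^ 2 + 1)),
      lt_min (div_pos (sub_pos.2 hint) hfn) (by positivity), ?_, ?_⟩
    · rw [← le_div_iff₀ hfn]; exact min_le_left _ _
    · calc K * W * L ^ 2 * min ((ρ - ‖x - z‖) / ‖f‖) (m / (K * W * L ^ 2 + 1))
          ≤ K * W * L ^ 2 * (m / (K * W * L ^ 2 + 1)) := by gcongr; exact min_le_right _ _
        _ ≤ m := by
          rw [← mul_div_assoc, div_le_iff₀ (by positivity)]; nlinarith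
        _ < 2 * m := by linarith
  set y : Fin K → ℝ := x + τ • f with hy
  have hyx : y - x = τ • f := by rw [hy]; simp
  have hyk : ∀ k, y k - x k = τ * f k := fun k => by rw [hy]; simp
  have hyz : ‖y - z‖ ≤ ρ := by
    have : y - z = (x - z) + τ • f := by rw [hy]; abel
    rw [this]
    refine (norm_add_le _ _).trans ?_
    rw [norm_smul, Real.norm_eq_abs, abs_of_pos hτ0]; linarith
  have hys : y ∈ stdSimplex ℝ (Fin K) := by
    refine ⟨fun k => ?_, ?_⟩
    · have h1 := (abs_apply_le_norm (y - z) k).trans hyz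
      have h2 := abs_le.1 h1
      simp only [Pi.sub_apply] at h2
      linarith [hza k]
    · have : ∀ k, y k = x k + τ * f k := fun k => by linarith [hyk k]
      simp only [this, Finset.sum_add_distrib, hx.2, ← Finset.mul_sum, hf, hF0 x hx hxρ]
      simp
  have h1 := hmono y hys x hx hyz hxρ
  have h2 : ∑ k, w k * f k * (F y k - f k) ≤ -(m * τ * q) := by
    have e1 : ∑ k, w k * (y k - x k) * (F y k - F x k) =
        τ * ∑ k, w k * f k * (F y k - f k) := by
      rw [Finset.mul_sum]
      refine Finset.sum_congr rfl fun k _ => ?_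
      rw [hyk k]; ring
    have e2 : ∑ k, (y k - x k) ^ 2 = τ ^ 2 * q := by
      rw [hq, Finset.mul_sum]
      refine Finset.sum_congr rfl fun k _ => ?_
      rw [hyk k]; ring
    rw [e1, e2] at h1
    refine le_of_mul_le_mul_left ?_ hτ0
    linarith
  have h3 : ∑ k, w k * (F y k - f k) ^ 2 ≤ K * W * L ^ 2 * τ ^ 2 * q := by
    calc ∑ k, w k * (F y k - f k) ^ 2 ≤ ∑ _k : Fin K, W * (L ^ 2 * τ ^ 2 * q) := by
          refine Finset.sum_le_sum fun k _ => mul_le_mul (hwW k) ?_ (sq_nonneg _)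
            ((hw0 k).trans (hwW k))
          have e := hlip y hys x hx hyz hxρ k
          rw [hyx, norm_smul, Real.norm_eq_abs, abs_of_pos hτ0] at e
          calc (F y k - f k) ^ 2 = |F y k - F x k| ^ 2 := (sq_abs _).symm
            _ ≤ (L * (τ * ‖f‖)) ^ 2 := by gcongr
            _ = L ^ 2 * τ ^ 2 * ‖f‖ ^ 2 := by ring
            _ ≤ _ := by gcongr; exact norm_sq_le_sum_sq f
      _ = _ := by simp; ring
  have h4 : ∑ k, w k * F y k ^ 2 = ∑ k, w k * f k ^ 2 +
      2 * ∑ k, w k * f k * (F y k - f k) + ∑ k, w k * (F y k - f k) ^ 2 := by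
    rw [Finset.mul_sum, ← Finset.sum_add_distrib, ← Finset.sum_add_distrib]
    refine Finset.sum_congr rfl fun k _ => ?_
    ring
  have h5 := hle y ((hBmem y).2 ⟨hys, hyz⟩)
  have h6 : K * W * L ^ 2 * τ ^ 2 * q < 2 * (m * τ * q) := by
    have := mul_lt_mul_of_pos_right hτm (mul_pos hτ0 hq0)
    linarith
  linarith

/-! ### Existence of a fixed point -/

theorem rpow_neg_lipschitz {a s t : ℝ} (hβ : 0 ≤ β) (ha : 0 < a) (hs : a ≤ s) (ht : a ≤ t) :
    |s ^ (-β) - t ^ (-β)| ≤ β * a ^ (-β - 1) * |s - t| := by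
  have h := (convex_Ici a).norm_image_sub_le_of_norm_hasDerivWithin_le (f := fun s : ℝ => s ^ (-β))
    (f' := fun s => -β * s ^ (-β - 1)) (C := β * a ^ (-β - 1)) (x := t) (y := s)
    (fun u hu => (Real.hasDerivAt_rpow_const (Or.inl (ha.trans_le hu).ne')).hasDerivWithinAt)
    (fun u hu => ?_) ht hs
  · simpa using h
  · rw [norm_mul, norm_neg, Real.norm_eq_abs, Real.norm_eq_abs, abs_of_nonneg hβ,
      abs_of_nonneg (Real.rpow_nonneg (ha.le.trans hu) _)]
    exact mul_le_mul_of_nonneg_left (Real.rpow_le_rpow_of_nonpos ha hu (by linarith)) hβ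

theorem IsAttractionFactor.exists_potential_lipschitz (hΘ : IsAttractionFactor Θ) (hβ : 0 ≤ β)
    {a : ℝ} (ha : 0 < a) : ∃ L : ℝ, 0 ≤ L ∧ ∀ x ∈ stdSimplex ℝ (Fin K),
      ∀ y ∈ stdSimplex ℝ (Fin K), (∀ k, a ≤ x k) → (∀ k, a ≤ y k) → ∀ k,
      |attractionPotential Θ β x k - attractionPotential Θ β y k| ≤ L * ‖x - y‖ := by
  obtain ⟨c, C, hc, hC, hb⟩ := hΘ.exists_bounds
  obtain ⟨L, hL, hlip⟩ := hΘ.exists_lipschitz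
  refine ⟨L * a ^ (-β) + C * (β * a ^ (-β - 1)), by positivity, fun x hx y hy hxa hya k => ?_⟩
  have h1 := rpow_neg_lipschitz hβ ha (hxa k) (hya k)
  have h2 := hlip x hx y hy k
  have h3 : |x k - y k| ≤ ‖x - y‖ := abs_apply_le_norm (x - y) k
  have h4 : x k ^ (-β) ≤ a ^ (-β) := Real.rpow_le_rpow_of_nonpos ha (hxa k) (by linarith)
  have h5 : 0 ≤ x k ^ (-β) := Real.rpow_nonneg (hx.1 k) _
  have e : attractionPotential Θ β x k - attractionPotential Θ β y k =
      (Θ x k - Θ y k) * x k ^ (-β) + Θ y k * (x k ^ (-β) - y k ^ (-β)) := by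
    simp only [attractionPotential]; ring
  rw [e]
  refine (abs_add_le _ _).trans ?_
  rw [abs_mul, abs_mul, abs_of_nonneg h5, abs_of_nonneg (hΘ.nonneg hy k)]
  have h6 : |Θ x k - Θ y k| * x k ^ (-β) ≤ L * ‖x - y‖ * a ^ (-β) := by gcongr
  have h7 : Θ y k * |x k ^ (-β) - y k ^ (-β)| ≤ C * (β * a ^ (-β - 1) * ‖x - y‖) := by
    have := (hb y hy k).2
    have := h1.trans (mul_le_mul_of_nonneg_left h3 (by positivity))
    gcongr
  linarith

/-- The mean field multiplied by the positive total potential, for the bias `t ε`. -/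
def scaledField (Θ : (Fin K → ℝ) → Fin K → ℝ) (β : ℝ) (ε : Fin K → ℝ) (t : ℝ) (x : Fin K → ℝ)
    (k : Fin K) : ℝ :=
  attractionPotential Θ β x k + t * ε k - totalPotential Θ β (fun j => t * ε j) x * x k

theorem sum_scaledField (hx : x ∈ stdSimplex ℝ (Fin K)) (t : ℝ) :
    ∑ k, scaledField Θ β ε t x k = 0 := by
  simp only [scaledField, Finset.sum_sub_distrib, ← Finset.mul_sum, hx.2, mul_one]
  exact sub_self _

theorem totalPotential_smul (t : ℝ) : totalPotential Θ β (fun j => t * ε j) x =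
    ∑ j, attractionPotential Θ β x j + t * ∑ j, ε j := by
  rw [totalPotential, Finset.sum_add_distrib, Finset.mul_sum]

theorem IsAttractionFactor.fixedPoint_iff_scaledField (hΘ : IsAttractionFactor Θ) (hβ : 0 ≤ β)
    (hε : ∀ k, 0 ≤ ε k) {t : ℝ} (ht : 0 ≤ t) (hx : x ∈ stateSpace K β) :
    choiceProb Θ β (fun j => t * ε j) x = x ↔ scaledField Θ β ε t x = 0 := by
  rw [hΘ.choiceProb_eq_iff hβ (fun k => mul_nonneg ht (hε k)) hx, funext_iff]
  exact forall_congr' fun k => by rw [scaledField, Pi.zero_apply, sub_eq_zero]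

/-- All fixed points on the path of biases `t ε` lie in a common compact part of the open
simplex. -/
theorem IsAttractionFactor.fixedPoint_ge (hΘ : IsAttractionFactor Θ) (hβ : 0 ≤ β)
    (hε : ∀ k, 0 ≤ ε k) : ∃ a : ℝ, 0 < a ∧ ∀ t ∈ Set.Icc (0 : ℝ) 1, ∀ x ∈ stateSpace K β,
      choiceProb Θ β (fun j => t * ε j) x = x → ∀ k, a ≤ x k := by
  have hE : 0 ≤ ∑ k, ε k := Finset.sum_nonneg fun k _ => hε k
  obtain ⟨a, ha, h⟩ := hΘ.exists_le_choiceProb (K := K) hβ hE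
  refine ⟨a, ha, fun t ht x hx hfix k => ?_⟩
  obtain ⟨i, -, hi⟩ := Finset.univ.exists_min_image x ⟨k, Finset.mem_univ k⟩
  have := h _ (fun k => mul_nonneg ht.1 (hε k))
    (by rw [← Finset.mul_sum]; exact mul_le_of_le_one_left hE ht.2) x hx i
    fun k => hi k (Finset.mem_univ k)
  rw [hfix] at this
  exact this.trans (hi k (Finset.mem_univ k))

/-- Lipschitz bound for the scaled mean field away from the boundary of the simplex. -/
theorem IsAttractionFactor.exists_scaledField_lipschitz (hΘ : IsAttractionFactor Θ) (hβ : 0 ≤ β)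
    (hε : ∀ k, 0 ≤ ε k) {a : ℝ} (ha : 0 < a) : ∃ L : ℝ, 0 ≤ L ∧ ∀ t ∈ Set.Icc (0 : ℝ) 1,
      ∀ x ∈ stdSimplex ℝ (Fin K), ∀ y ∈ stdSimplex ℝ (Fin K), (∀ k, a ≤ x k) → (∀ k, a ≤ y k) →
      ∀ k, |scaledField Θ β ε t x k - scaledField Θ β ε t y k| ≤ L * ‖x - y‖ := by
  obtain ⟨L, hL, hlip⟩ := hΘ.exists_potential_lipschitz (K := K) hβ ha
  obtain ⟨C, hC, hT⟩ := hΘ.exists_totalPotential_le (K := K) (ε := ε) hβ ha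
  have hE : 0 ≤ ∑ k, ε k := Finset.sum_nonneg fun k _ => hε k
  refine ⟨L + (K * L + C), by positivity, fun t ht x hx y hy hxa hya k => ?_⟩
  have h1 := hlip x hx y hy hxa hya
  have h2 : |x k - y k| ≤ ‖x - y‖ := abs_apply_le_norm (x - y) k
  have h3 : |totalPotential Θ β (fun j => t * ε j) x - totalPotential Θ β (fun j => t * ε j) y| ≤
      K * L * ‖x - y‖ := by
    rw [totalPotential_smul, totalPotential_smul, add_sub_add_right_eq_sub,
      ← Finset.sum_sub_distrib]
    refine (Finset.abs_sum_le_sum_abs _ _).trans ((Finset.sum_le_sum fun j _ => h1 j).trans ?_)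
    simp [mul_assoc]
  have h4 : |totalPotential Θ β (fun j => t * ε j) y| ≤ C := by
    have e1 := hT y hy hya
    have e2 : 0 ≤ ∑ j, attractionPotential Θ β y j := Finset.sum_nonneg fun j _ =>
      mul_nonneg (hΘ.nonneg hy j) (Real.rpow_nonneg (hy.1 j) _)
    rw [totalPotential_smul]
    rw [totalPotential, Finset.sum_add_distrib] at e1
    have e3 := mul_le_of_le_one_left hE ht.2
    have e4 := mul_nonneg ht.1 hE
    rw [abs_of_nonneg (by linarith)]; linarith
  have e : scaledField Θ β ε t x k - scaledField Θ β ε t y k =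
      (attractionPotential Θ β x k - attractionPotential Θ β y k) -
      ((totalPotential Θ β (fun j => t * ε j) x - totalPotential Θ β (fun j => t * ε j) y) * x k +
        totalPotential Θ β (fun j => t * ε j) y * (x k - y k)) := by
    simp only [scaledField]; ring
  rw [e]
  refine (abs_sub _ _).trans ?_
  have h5 := (abs_add_le ((totalPotential Θ β (fun j => t * ε j) x -
    totalPotential Θ β (fun j => t * ε j) y) * x k)
    (totalPotential Θ β (fun j => t * ε j) y * (x k - y k)))
  rw [abs_mul, abs_mul, abs_of_nonneg (hx.1 k)] at h5
  have h6 : |totalPotential Θ β (fun j => t * ε j) x - totalPotential Θ β (fun j => t * ε j) y| *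
      x k ≤ K * L * ‖x - y‖ * 1 :=
    mul_le_mul h3 (le_one_of_mem_stdSimplex hx k) (hx.1 k) (by positivity)
  have h7 : |totalPotential Θ β (fun j => t * ε j) y| * |x k - y k| ≤ C * ‖x - y‖ :=
    mul_le_mul h4 h2 (abs_nonneg _) hC.le
  linarith [h1 k]

/-- Near a fixed point `z` for the bias `t₀ ε` the scaled mean field is strongly monotone with
respect to the inner product with weights `1 / z_k`, uniformly in biases `t ε` with `t` near
`t₀`. -/
theorem IsAttractionFactor.exists_local_monotonicity (hΘ : IsAttractionFactor Θ) (hβ : 0 ≤ β)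
    (hε : ∀ k, 0 ≤ ε k) {t₀ : ℝ} (ht₀ : t₀ ∈ Set.Icc (0 : ℝ) 1) (hz : z ∈ stateSpace K β)
    (hfix : choiceProb Θ β (fun j => t₀ * ε j) z = z) {a : ℝ} (ha : 0 < a) (hza : ∀ k, a ≤ z k) :
    ∃ m ρ r : ℝ, 0 < m ∧ 0 < ρ ∧ 0 < r ∧ ρ ≤ a / 2 ∧ ∀ t ∈ Set.Icc (0 : ℝ) 1, |t - t₀| ≤ r →
      ∀ x ∈ stdSimplex ℝ (Fin K), ∀ y ∈ stdSimplex ℝ (Fin K), ‖x - z‖ ≤ ρ → ‖y - z‖ ≤ ρ →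
      ∑ k, 1 / z k * (x k - y k) * (scaledField Θ β ε t x k - scaledField Θ β ε t y k) ≤
        -(m * ∑ k, (x k - y k) ^ 2) := by
  obtain ⟨c, hc, hmono⟩ := hΘ.exists_monotonicity (K := K) hβ
  obtain ⟨LA, hLA, hlipA⟩ := hΘ.exists_potential_lipschitz (K := K) hβ (half_pos ha)
  obtain ⟨LF, hLF, hlipF⟩ := hΘ.exists_scaledField_lipschitz (K := K) hβ hε (half_pos ha)
  have hE : 0 ≤ ∑ k, ε k := Finset.sum_nonneg fun k _ => hε k
  have hε₀ : ∀ k, 0 ≤ t₀ * ε k := fun k => mul_nonneg ht₀.1 (hε k)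
  set T₀ := totalPotential Θ β (fun j => t₀ * ε j) z with hT₀
  have hT₀pos : 0 < T₀ := hΘ.totalPotential_pos hβ hε₀ hz
  have hfix' := (hΘ.choiceProb_eq_iff hβ hε₀ hz).1 hfix
  have hAz : ∀ k, attractionPotential Θ β z k ≤ T₀ * z k := fun k => by
    rw [hT₀, ← hfix' k]; linarith [hε₀ k]
  -- the radius makes the errors below at most a fixed fraction of the margin `c`
  obtain ⟨ρ, hρ, hρa, hρ1, hρ2, hρ3⟩ : ∃ ρ : ℝ, 0 < ρ ∧ ρ ≤ a / 2 ∧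
      (LA + (T₀ + c / 4)) * ρ ≤ c / 4 * a ∧ K * LA * ρ ≤ c / 8 ∧
      2 / a ^ 2 * LF * K * ρ ≤ c / 4 := by
    refine ⟨min (a / 2) (min (c / 4 * a / (LA + (T₀ + c / 4)))
      (min (c / 8 / (K * LA + 1)) (c / 4 / (2 / a ^ 2 * LF * K + 1)))), ?_, min_le_left _ _,
      ?_, ?_, ?_⟩
    · refine lt_min (half_pos ha) (lt_min (by positivity) (lt_min (by positivity) (by positivity)))
    · have h : min (a / 2) (min (c / 4 * a / (LA + (T₀ + c / 4)))
        (min (c / 8 / (K * LA + 1)) (c / 4 / (2 / a ^ 2 * LF * K + 1)))) ≤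
        c / 4 * a / (LA + (T₀ + c / 4)) := (min_le_right _ _).trans (min_le_left _ _)
      rw [mul_comm]; rwa [le_div_iff₀ (by positivity)] at h
    · have h : min (a / 2) (min (c / 4 * a / (LA + (T₀ + c / 4)))
        (min (c / 8 / (K * LA + 1)) (c / 4 / (2 / a ^ 2 * LF * K + 1)))) ≤
        c / 8 / (K * LA + 1) :=
          (min_le_right _ _).trans ((min_le_right _ _).trans (min_le_left _ _))
      have h0 : 0 ≤ min (a / 2) (min (c / 4 * a / (LA + (T₀ + c / 4)))
        (min (c / 8 / (K * LA + 1)) (c / 4 / (2 / a ^ 2 * LF * K + 1)))) := by positivity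
      rw [le_div_iff₀ (by positivity)] at h
      linarith
    · have h : min (a / 2) (min (c / 4 * a / (LA + (T₀ + c / 4)))
        (min (c / 8 / (K * LA + 1)) (c / 4 / (2 / a ^ 2 * LF * K + 1)))) ≤
        c / 4 / (2 / a ^ 2 * LF * K + 1) :=
          (min_le_right _ _).trans ((min_le_right _ _).trans (min_le_right _ _))
      have h0 : 0 ≤ min (a / 2) (min (c / 4 * a / (LA + (T₀ + c / 4)))
        (min (c / 8 / (K * LA + 1)) (c / 4 / (2 / a ^ 2 * LF * K + 1)))) := by positivity
      rw [le_div_iff₀ (by positivity)] at h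
      linarith
  refine ⟨c / 4, ρ, c / 8 / (∑ k, ε k + 1), by positivity, hρ, by positivity, hρa, ?_⟩
  intro t ht htr x hx y hy hxρ hyρ
  have hnear : ∀ u : Fin K → ℝ, ‖u - z‖ ≤ ρ → ∀ k, |u k - z k| ≤ ρ := fun u hu k =>
    (abs_apply_le_norm (u - z) k).trans hu
  have hlow : ∀ u : Fin K → ℝ, ‖u - z‖ ≤ ρ → ∀ k, a / 2 ≤ u k := fun u hu k => by
    have := (abs_le.1 (hnear u hu k)).1
    linarith [hza k]
  have hz2 : ∀ k, a / 2 ≤ z k := fun k => by linarith [hza k]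
  have hx0 : ∀ k, 0 < x k := fun k => (half_pos ha).trans_le (hlow x hxρ k)
  have hy0 : ∀ k, 0 < y k := fun k => (half_pos ha).trans_le (hlow y hyρ k)
  have hW0 := deviation_nonneg (z := y) hx0
  have hAy : ∀ k, |attractionPotential Θ β y k - attractionPotential Θ β z k| ≤ LA * ρ := fun k =>
    (hlipA y hy z hz.1 (hlow y hyρ) hz2 k).trans (by gcongr)
  -- the level `T₀ + c / 4` dominates the payoffs at `y`
  have hS : ∀ k, attractionPotential Θ β y k ≤ (T₀ + c / 4) * y k := fun k => by
    have h1 := (abs_le.1 (hAy k)).2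
    have h2 := (abs_le.1 (hnear y hyρ k)).1
    have h3 : (T₀ + c / 4) * (z k - ρ) ≤ (T₀ + c / 4) * y k :=
      mul_le_mul_of_nonneg_left (by linarith) (by positivity)
    have h4 : c / 4 * a ≤ c / 4 * z k := mul_le_mul_of_nonneg_left (hza k) (by positivity)
    linarith [hAz k]
  have hTy : T₀ - c / 4 ≤ totalPotential Θ β (fun j => t * ε j) y := by
    rw [hT₀, totalPotential_smul, totalPotential_smul]
    have h1 : |∑ j, attractionPotential Θ β y j - ∑ j, attractionPotential Θ β z j| ≤ c / 8 := by
      rw [← Finset.sum_sub_distrib]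
      refine (Finset.abs_sum_le_sum_abs _ _).trans ((Finset.sum_le_sum fun j _ => hAy j).trans ?_)
      simpa [mul_assoc] using hρ2
    have h2 : |t - t₀| * ∑ k, ε k ≤ c / 8 := by
      rw [le_div_iff₀ (by positivity)] at htr
      have := abs_nonneg (t - t₀)
      linarith
    have h3 := (abs_le.1 h1).1
    have h4 : -(|t - t₀| * ∑ k, ε k) ≤ (t - t₀) * ∑ k, ε k := by
      rw [← neg_mul]; exact mul_le_mul_of_nonneg_right (neg_abs_le _) hE
    linarith
  have h1 := hmono (T₀ + c / 4) x y hx hy hx0 hy0 hS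
  have h2 : ∑ k, (1 - y k / x k) * (scaledField Θ β ε t x k - scaledField Θ β ε t y k) ≤
      -(c / 2) * deviation x y := by
    have e : ∑ k, (1 - y k / x k) * (scaledField Θ β ε t x k - scaledField Θ β ε t y k) =
        ∑ k, (1 - y k / x k) * (attractionPotential Θ β x k - attractionPotential Θ β y k) -
        totalPotential Θ β (fun j => t * ε j) x * ∑ k, (1 - y k / x k) * x k +
        totalPotential Θ β (fun j => t * ε j) y * ∑ k, (1 - y k / x k) * y k := by
      rw [Finset.mul_sum, Finset.mul_sum, ← Finset.sum_sub_distrib, ← Finset.sum_add_distrib]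
      refine Finset.sum_congr rfl fun k _ => ?_
      simp only [scaledField]; ring
    rw [e, sum_one_sub_div_mul_self hx hy hx0, sum_one_sub_div_mul hx hy hx0]
    have := mul_le_mul_of_nonneg_right hTy hW0
    linarith
  have h3 : ∑ k, (x k - y k) ^ 2 ≤ deviation x y := by
    refine Finset.sum_le_sum fun k _ => ?_
    have e : x k * (1 - y k / x k) ^ 2 = (x k - y k) ^ 2 / x k := by
      have := (hx0 k).ne'
      field_simp
    rw [e, le_div_iff₀ (hx0 k)]
    exact mul_le_of_le_one_right (sq_nonneg _) (le_one_of_mem_stdSimplex hx k)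
  -- exchanging the weights `1 / x_k` for `1 / z_k` costs a small multiple of the square distance
  have h4 : ∑ k, 1 / z k * (x k - y k) * (scaledField Θ β ε t x k - scaledField Θ β ε t y k) ≤
      ∑ k, (1 - y k / x k) * (scaledField Θ β ε t x k - scaledField Θ β ε t y k) +
        c / 4 * ∑ k, (x k - y k) ^ 2 := by
    have e : ∀ k ∈ Finset.univ,
        1 / z k * (x k - y k) * (scaledField Θ β ε t x k - scaledField Θ β ε t y k) ≤
        (1 - y k / x k) * (scaledField Θ β ε t x k - scaledField Θ β ε t y k) +
          2 / a ^ 2 * ρ * LF * ‖x - y‖ ^ 2 := by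
      intro k _
      have e1 : 1 / z k * (x k - y k) * (scaledField Θ β ε t x k - scaledField Θ β ε t y k) =
          (1 - y k / x k) * (scaledField Θ β ε t x k - scaledField Θ β ε t y k) +
          (x k - z k) / (z k * x k) * (x k - y k) *
            (scaledField Θ β ε t x k - scaledField Θ β ε t y k) := by
        have := (hx0 k).ne'
        have : z k ≠ 0 := (ha.trans_le (hza k)).ne'
        field_simp; ring
      rw [e1]
      refine add_le_add_right ((le_abs_self _).trans ?_) _
      rw [abs_mul, abs_mul]
      have e2 : |(x k - z k) / (z k * x k)| ≤ 2 / a ^ 2 * ρ := by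
        have hzk : 0 < z k := ha.trans_le (hza k)
        rw [abs_div, abs_of_pos (mul_pos hzk (hx0 k)), div_le_iff₀ (mul_pos hzk (hx0 k))]
        have e3 : a * (a / 2) ≤ z k * x k :=
          mul_le_mul (hza k) (hlow x hxρ k) (by positivity) hzk.le
        calc |x k - z k| ≤ ρ := hnear x hxρ k
          _ = 2 / a ^ 2 * ρ * (a * (a / 2)) := by field_simp
          _ ≤ _ := by gcongr
      have e4 : |x k - y k| ≤ ‖x - y‖ := abs_apply_le_norm (x - y) k
      have e5 := hlipF t ht x hx y hy (hlow x hxρ) (hlow y hyρ) k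
      calc _ ≤ 2 / a ^ 2 * ρ * ‖x - y‖ * (LF * ‖x - y‖) := by gcongr
        _ = _ := by ring
    refine (Finset.sum_le_sum e).trans ?_
    rw [Finset.sum_add_distrib]
    refine add_le_add_right ?_ _
    have hn := norm_sq_le_sum_sq (x - y)
    simp only [Pi.sub_apply] at hn
    simp only [Finset.sum_const, Finset.card_univ, Fintype.card_fin, nsmul_eq_mul]
    calc (K : ℝ) * (2 / a ^ 2 * ρ * LF * ‖x - y‖ ^ 2) = 2 / a ^ 2 * LF * K * ρ * ‖x - y‖ ^ 2 := by
          ring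
      _ ≤ c / 4 * ∑ k, (x k - y k) ^ 2 := by gcongr
  have h5 := mul_le_mul_of_nonneg_left h3 (half_pos hc).le
  linarith

/-- Fixed points persist under small changes of the parameter `t` in the bias `t ε`. -/
theorem IsAttractionFactor.fixedPoint_persists (hΘ : IsAttractionFactor Θ) (hβ : 0 ≤ β)
    (hε : ∀ k, 0 ≤ ε k) {t₀ : ℝ} (ht₀ : t₀ ∈ Set.Icc (0 : ℝ) 1) (hz : z ∈ stateSpace K β)
    (hfix : choiceProb Θ β (fun j => t₀ * ε j) z = z) :
    ∃ r : ℝ, 0 < r ∧ ∀ t ∈ Set.Icc (0 : ℝ) 1, |t - t₀| ≤ r →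
      ∃ x ∈ stateSpace K β, choiceProb Θ β (fun j => t * ε j) x = x := by
  obtain ⟨a, ha, hge⟩ := hΘ.fixedPoint_ge (K := K) hβ hε
  have hza := hge t₀ ht₀ z hz hfix
  have hz0 : ∀ k, 0 < z k := fun k => ha.trans_le (hza k)
  obtain ⟨m, ρ, r, hm, hρ, hr, hρa, hmono⟩ :=
    hΘ.exists_local_monotonicity hβ hε ht₀ hz hfix ha hza
  obtain ⟨L, hL, hlip⟩ := hΘ.exists_scaledField_lipschitz (K := K) hβ hε (half_pos ha)
  have hE : 0 ≤ ∑ k, ε k := Finset.sum_nonneg fun k _ => hε k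
  set E := ∑ k, ε k with hEdef
  set κ := √(K * (1 / a)) * E with hκ
  have hκ0 : 0 ≤ κ := by positivity
  refine ⟨min r (m * ρ / (2 * (1 / a) * K * κ + 1) / 2), lt_min hr (by positivity), ?_⟩
  intro t ht htr
  have hlow : ∀ u : Fin K → ℝ, ‖u - z‖ ≤ ρ → ∀ k, a / 2 ≤ u k := fun u hu k => by
    have := (abs_le.1 ((abs_apply_le_norm (u - z) k).trans hu)).1
    simp only [Pi.sub_apply] at this
    linarith [hza k]
  have hsmall : ∑ k, 1 / z k * scaledField Θ β ε t z k ^ 2 ≤ (κ * |t - t₀|) ^ 2 := by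
    have h0 := (hΘ.fixedPoint_iff_scaledField hβ hε ht₀.1 hz).1 hfix
    have h1 : ∀ k, scaledField Θ β ε t z k = (t - t₀) * (ε k - E * z k) := fun k => by
      have := congrFun h0 k
      simp only [scaledField, totalPotential_smul, Pi.zero_apply] at this ⊢
      linear_combination this
    have h2 : ∀ k, (ε k - E * z k) ^ 2 ≤ E ^ 2 := fun k => by
      have e1 : ε k ≤ E := Finset.single_le_sum (fun j _ => hε j) (Finset.mem_univ k)
      have e2 : E * z k ≤ E := mul_le_of_le_one_right hE (le_one_of_mem_stdSimplex hz.1 k)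
      have e3 := mul_nonneg hE (hz0 k).le
      exact sq_le_sq' (by linarith [hε k]) (by linarith)
    calc ∑ k, 1 / z k * scaledField Θ β ε t z k ^ 2
        ≤ ∑ _k : Fin K, 1 / a * (|t - t₀| ^ 2 * E ^ 2) := by
          refine Finset.sum_le_sum fun k _ => ?_
          rw [h1 k, mul_pow, sq_abs]
          have := one_div_le_one_div_of_le ha (hza k)
          have := h2 k
          gcongr
      _ = (κ * |t - t₀|) ^ 2 := by
          rw [hκ, mul_pow, mul_pow, Real.sq_sqrt (by positivity)]
          simp; ring
  have hω : 2 * (1 / a) * K * (κ * |t - t₀|) < m * ρ := by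
    have h1 := htr.trans (min_le_right _ _)
    have h2 : 0 < 2 * (1 / a) * K * κ + 1 := by positivity
    have h3 := abs_nonneg (t - t₀)
    calc 2 * (1 / a) * K * (κ * |t - t₀|) ≤ (2 * (1 / a) * K * κ + 1) * |t - t₀| := by linarith
      _ ≤ (2 * (1 / a) * K * κ + 1) * (m * ρ / (2 * (1 / a) * K * κ + 1) / 2) := by gcongr
      _ = m * ρ / 2 := by field_simp
      _ < m * ρ := by have := mul_pos hm hρ; linarith
  obtain ⟨x, hx, hxρ, hF⟩ := exists_zero_of_strongly_monotone (w := fun k => 1 / z k)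
    (F := scaledField Θ β ε t) (ω := κ * |t - t₀|) (W := 1 / a) hρ hm hL (by positivity)
    hz.1 hza (by linarith) (fun k => (one_le_div (hz0 k)).2 (le_one_of_mem_stdSimplex hz.1 k))
    (fun k => one_div_le_one_div_of_le ha (hza k)) (fun x hx _ => sum_scaledField hx t)
    (hmono t ht (htr.trans (min_le_left _ _)))
    (fun x hx y hy hxρ hyρ => hlip t ht x hx y hy (hlow x hxρ) (hlow y hyρ)) hsmall hω
  have hx0 : x ∈ stateSpace K β := ⟨hx, fun _ k => (half_pos ha).trans_le (hlow x hxρ k)⟩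
  exact ⟨x, hx0, (hΘ.fixedPoint_iff_scaledField hβ hε ht.1 hx0).2 hF⟩

/-- Existence of a fixed point by continuation: the parameters `t` for which the bias `t ε` admits a
fixed point form a relatively open and closed subset of `[0, 1]` containing `0`. -/
theorem IsAttractionFactor.exists_fixedPoint (hK : 0 < K) (hΘ : IsAttractionFactor Θ) (hβ : 0 ≤ β)
    (hε : ∀ k, 0 ≤ ε k) : ∃ z ∈ stateSpace K β, choiceProb Θ β ε z = z := by
  set J : Set ℝ := {t | ∃ z ∈ stateSpace K β, choiceProb Θ β (fun j => t * ε j) z = z} with hJ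
  suffices h : Set.Icc (0 : ℝ) 1 ⊆ J by
    obtain ⟨z, hz, hfix⟩ := h ⟨zero_le_one, le_rfl⟩
    exact ⟨z, hz, by simpa using hfix⟩
  obtain ⟨a, ha, hge⟩ := hΘ.fixedPoint_ge (K := K) hβ hε
  refine IsClosed.Icc_subset_of_forall_mem_nhdsWithin ?_ ?_ ?_
  · -- closedness, by compactness of the set of pairs of a parameter and a fixed point
    obtain ⟨L, hL, hlip⟩ := hΘ.exists_potential_lipschitz (K := K) hβ ha
    set C : Set (Fin K → ℝ) := {x | x ∈ stdSimplex ℝ (Fin K) ∧ ∀ k, a ≤ x k} with hC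
    have hCc : IsCompact C := by
      refine (isCompact_stdSimplex ℝ (Fin K)).inter_right ?_
      exact isClosed_Ici (a := fun _ : Fin K => a)
    have hcont : ∀ k, ContinuousOn (fun x => attractionPotential Θ β x k) C := fun k => by
      have : LipschitzOnWith ⟨L, hL⟩ (fun x => attractionPotential Θ β x k) C := by
        refine LipschitzOnWith.of_dist_le_mul fun x hx y hy => ?_
        rw [Real.dist_eq, dist_eq_norm]
        exact hlip x hx.1 y hy.1 hx.2 hy.2 k
      exact this.continuousOn
    set G : ℝ × (Fin K → ℝ) → Fin K → ℝ := fun p => scaledField Θ β ε p.1 p.2 with hG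
    have hGc : ContinuousOn G (Set.Icc 0 1 ×ˢ C) := by
      have hA : ∀ k, ContinuousOn (fun p : ℝ × (Fin K → ℝ) => attractionPotential Θ β p.2 k)
          (Set.Icc 0 1 ×ˢ C) := fun k =>
        (hcont k).comp continuousOn_snd fun p hp => hp.2
      refine continuousOn_pi.2 fun k => ?_
      simp only [hG, scaledField, totalPotential_smul]
      have h1 := continuousOn_finsetSum Finset.univ fun j _ => hA j
      have h2 : Continuous fun p : ℝ × (Fin K → ℝ) => p.2 k :=
        (continuous_apply k).comp continuous_snd
      exact ((hA k).add (continuous_fst.mul continuous_const).continuousOn).sub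
        ((h1.add (continuous_fst.mul continuous_const).continuousOn).mul h2.continuousOn)
    have hZ : IsCompact ((Set.Icc 0 1 ×ˢ C) ∩ G ⁻¹' {0}) := by
      have hc : IsCompact ((Set.Icc (0 : ℝ) 1) ×ˢ C) := isCompact_Icc.prod hCc
      exact hc.of_isClosed_subset
        (hGc.preimage_isClosed_of_isClosed hc.isClosed isClosed_singleton) Set.inter_subset_left
    have himage : J ∩ Set.Icc 0 1 = Prod.fst '' ((Set.Icc 0 1 ×ˢ C) ∩ G ⁻¹' {0}) := by
      ext t
      constructor
      · rintro ⟨⟨z, hz, hfix⟩, ht⟩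
        exact ⟨(t, z), ⟨⟨ht, hz.1, hge t ht z hz hfix⟩,
          (hΘ.fixedPoint_iff_scaledField hβ hε ht.1 hz).1 hfix⟩, rfl⟩
      · rintro ⟨⟨t, z⟩, ⟨⟨ht, hz⟩, h0⟩, rfl⟩
        have hzs : z ∈ stateSpace K β := ⟨hz.1, fun _ k => ha.trans_le (hz.2 k)⟩
        exact ⟨⟨z, hzs, (hΘ.fixedPoint_iff_scaledField hβ hε ht.1 hzs).2 h0⟩, ht⟩
    rw [himage]
    exact (hZ.image continuous_fst).isClosed
  · -- without bias the uniform distribution is fixed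
    have hKpos : (0 : ℝ) < K := Nat.cast_pos.2 hK
    have hmem : (fun _ => 1 / (K : ℝ)) ∈ stateSpace K β :=
      ⟨⟨fun _ => by positivity, by simp [hKpos.ne']⟩, fun _ _ => by positivity⟩
    refine ⟨fun _ => 1 / (K : ℝ), hmem, ?_⟩
    rw [hΘ.choiceProb_eq_iff hβ (by simp) hmem]
    intro k
    have : ∀ j, attractionPotential Θ β (fun _ => 1 / (K : ℝ)) j =
        attractionPotential Θ β (fun _ => 1 / (K : ℝ)) k := fun j => by
      simp only [attractionPotential, hΘ.const_apply _ j k]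
    simp only [totalPotential, this]
    simp
    field_simp
  · -- openness to the right
    rintro t ⟨⟨z, hz, hfix⟩, ht⟩
    obtain ⟨r, hr, h⟩ := hΘ.fixedPoint_persists hβ hε ⟨ht.1, ht.2.le⟩ hz hfix
    have h1 : Set.Ioo t (min (t + r) 1) ∈ 𝓝[>] t :=
      Ioo_mem_nhdsGT (lt_min (by linarith) ht.2)
    filter_upwards [h1] with s hs
    have h2 := hs.2.le.trans (min_le_left _ _)
    have h3 := hs.2.le.trans (min_le_right _ _)
    exact h s ⟨ht.1.trans hs.1.le, h3⟩ (by rw [abs_of_pos (sub_pos.2 hs.1)]; linarith)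

/-! ### Repulsion from the boundary of the simplex -/

/-- The squared amount by which the coordinates of `x` fall below the level `a`. -/
def shortfall (a : ℝ) (x : Fin K → ℝ) : ℝ := ∑ k, max (a - x k) 0 ^ 2

theorem shortfall_nonneg (a : ℝ) (x : Fin K → ℝ) : 0 ≤ shortfall a x :=
  Finset.sum_nonneg fun _ _ => sq_nonneg _

theorem half_le_of_shortfall_le {a : ℝ} (ha : 0 < a) (h : shortfall a x ≤ (a / 2) ^ 2)
    (k : Fin K) : a / 2 ≤ x k := by
  have h1 : max (a - x k) 0 ^ 2 ≤ shortfall a x :=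
    Finset.single_le_sum (f := fun k => max (a - x k) 0 ^ 2) (fun _ _ => sq_nonneg _)
      (Finset.mem_univ k)
  have h2 := (le_abs_self _).trans (abs_le_of_sq_le_sq (h1.trans h) (by positivity))
  linarith [le_max_left (a - x k) 0]

theorem le_of_shortfall_nonpos {a : ℝ} (h : shortfall a x ≤ 0) (k : Fin K) : a ≤ x k := by
  have h1 : max (a - x k) 0 ^ 2 ≤ shortfall a x :=
    Finset.single_le_sum (f := fun k => max (a - x k) 0 ^ 2) (fun _ _ => sq_nonneg _)
      (Finset.mem_univ k)
  have h2 : max (a - x k) 0 = 0 := pow_eq_zero_iff two_ne_zero |>.1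
    (le_antisymm (h1.trans h) (sq_nonneg _))
  linarith [le_max_left (a - x k) 0]

theorem shortfall_eq_zero {a : ℝ} (h : ∀ k, a ≤ x k) : shortfall a x = 0 :=
  Finset.sum_eq_zero fun k _ => by rw [max_eq_right (by linarith [h k])]; simp

/-- The smallest group is chosen with a probability that is bounded below, so that the mean field
points away from the boundary wherever some coordinate is small. -/
theorem IsAttractionFactor.exists_repulsion (hK : 0 < K) (hΘ : IsAttractionFactor Θ) (hβ : 0 ≤ β)
    (hε : ∀ k, 0 ≤ ε k) : ∃ a : ℝ, 0 < a ∧ ∀ b, 0 < b → b ≤ a → ∀ x ∈ stateSpace K β,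
      shortfall b x ≤ ∑ k, max (b - x k) 0 * (choiceProb Θ β ε x k - x k) := by
  obtain ⟨c, hc, h⟩ := hΘ.exists_le_choiceProb (K := K) hβ (E := ∑ k, ε k)
    (Finset.sum_nonneg fun k _ => hε k)
  have hKpos : (0 : ℝ) < K := Nat.cast_pos.2 hK
  refine ⟨c / (2 * K), by positivity, fun b hb hba x hx => ?_⟩
  have : Nonempty (Fin K) := ⟨⟨0, hK⟩⟩
  obtain ⟨i, hi⟩ := Finite.exists_min x
  set s := max (b - x i) 0 with hs
  have hs0 : 0 ≤ s := le_max_right _ _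
  have hsb : s ≤ b := max_le (by linarith [hx.1.1 i]) hb.le
  have hms : ∀ k, max (b - x k) 0 ≤ s := fun k => max_le_max (by linarith [hi k]) le_rfl
  -- the smallest group alone contributes at least `s c`; the loss is at most `K s b ≤ s c / 2`
  have h1 : s * c ≤ ∑ k, max (b - x k) 0 * choiceProb Θ β ε x k :=
    (mul_le_mul_of_nonneg_left (h ε hε le_rfl x hx i hi) hs0).trans
      (Finset.single_le_sum (f := fun k => max (b - x k) 0 * choiceProb Θ β ε x k)
        (fun k _ => mul_nonneg (le_max_right _ _) (hΘ.choiceProb_pos hβ hε hx k).le)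
        (Finset.mem_univ i))
  have h2 : ∑ k, max (b - x k) 0 * x k + shortfall b x ≤ ∑ _k : Fin K, s * b := by
    rw [shortfall, ← Finset.sum_add_distrib]
    refine Finset.sum_le_sum fun k _ => ?_
    rcases le_total (b - x k) 0 with hk | hk
    · rw [max_eq_right hk]; simpa using mul_nonneg hs0 hb.le
    · have := hms k
      rw [max_eq_left hk] at this ⊢
      nlinarith
  have h3 : ∑ _k : Fin K, s * b ≤ s * c / 2 := by
    simp only [Finset.sum_const, Finset.card_univ, Fintype.card_fin, nsmul_eq_mul]
    rw [le_div_iff₀ (by positivity)] at hba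
    nlinarith
  simp only [mul_sub, Finset.sum_sub_distrib]
  have := mul_nonneg hs0 hc.le
  linarith

theorem max_zero_sq_add_le (s h : ℝ) :
    max (s + h) 0 ^ 2 ≤ max s 0 ^ 2 + 2 * max s 0 * h + h ^ 2 := by
  rcases le_total s 0 with hs | hs <;> rcases le_total (s + h) 0 with hh | hh <;>
    simp only [max_eq_left, max_eq_right, hs, hh] <;> nlinarith [sq_nonneg (s + h)]

theorem le_max_zero_sq_add (s h : ℝ) : max s 0 ^ 2 + 2 * max s 0 * h ≤ max (s + h) 0 ^ 2 := by
  rcases le_total s 0 with hs | hs <;> rcases le_total (s + h) 0 with hh | hh <;>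
    simp only [max_eq_left, max_eq_right, hs, hh] <;> nlinarith [sq_nonneg (s + h), sq_nonneg h]

theorem hasDerivAt_max_zero_sq (s : ℝ) :
    HasDerivAt (fun s : ℝ => max s 0 ^ 2) (2 * max s 0) s := by
  rw [hasDerivAt_iff_isLittleO_nhds_zero]
  refine Asymptotics.IsBigO.trans_isLittleO (g := fun h : ℝ => h ^ 2) ?_ ?_
  · refine Asymptotics.IsBigO.of_bound 1 (Eventually.of_forall fun h => ?_)
    rw [Real.norm_eq_abs, Real.norm_of_nonneg (sq_nonneg h), smul_eq_mul, abs_le]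
    constructor <;> nlinarith [max_zero_sq_add_le s h, le_max_zero_sq_add s h, sq_nonneg h]
  · exact Asymptotics.isLittleO_pow_id one_lt_two

/-! ### The relative entropy -/

/-- The relative entropy `∑_k z_k log (z_k / x_k)` of `z` with respect to `x`. -/
def relEntropy (z x : Fin K → ℝ) : ℝ := ∑ k, z k * Real.log (z k / x k)

theorem relEntropy_self : relEntropy z z = 0 := by
  refine Finset.sum_eq_zero fun k _ => ?_
  rcases eq_or_ne (z k) 0 with h | h <;> simp [h]

theorem relEntropy_le_deviation (hx : x ∈ stdSimplex ℝ (Fin K)) (hz : z ∈ stdSimplex ℝ (Fin K))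
    (hx0 : ∀ k, 0 < x k) (hz0 : ∀ k, 0 < z k) : relEntropy z x ≤ deviation x z := by
  have h := sum_one_sub_div_mul hx hz hx0
  have h1 : relEntropy z x ≤ ∑ k, -((1 - z k / x k) * z k) := by
    refine Finset.sum_le_sum fun k _ => ?_
    have := Real.log_le_sub_one_of_pos (div_pos (hz0 k) (hx0 k))
    nlinarith [hz0 k]
  rw [Finset.sum_neg_distrib, h, neg_neg] at h1
  exact h1

/-- A form of Pinsker's inequality, obtained by comparison with the Hellinger distance. -/
theorem sum_sq_sub_le_relEntropy (hx : x ∈ stdSimplex ℝ (Fin K)) (hz : z ∈ stdSimplex ℝ (Fin K))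
    (hx0 : ∀ k, 0 < x k) (hz0 : ∀ k, 0 < z k) :
    ∑ k, (x k - z k) ^ 2 ≤ 4 * relEntropy z x := by
  have h1 : ∀ k, (x k - z k) ^ 2 / 4 ≤ z k * Real.log (z k / x k) + x k - z k := fun k => by
    have hx1 := hx0 k
    have hz1 := hz0 k
    have hxle : √(x k) ≤ 1 := Real.sqrt_le_one.2 (le_one_of_mem_stdSimplex hx k)
    have hzle : √(z k) ≤ 1 := Real.sqrt_le_one.2 (le_one_of_mem_stdSimplex hz k)
    have hsx := Real.sqrt_pos.2 hx1
    have hsz := Real.sqrt_pos.2 hz1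
    have ex := Real.sq_sqrt hx1.le
    have ez := Real.sq_sqrt hz1.le
    set u := √(x k)
    set v := √(z k)
    have h2 := Real.log_le_sub_one_of_pos (div_pos hsx hsz)
    have h3 : Real.log (z k / x k) = -(2 * Real.log (u / v)) := by
      rw [← ex, ← ez, ← div_pow, Real.log_pow, ← inv_div, Real.log_inv]
      push_cast
      ring
    rw [h3, ← ex, ← ez]
    have h4 : v ^ 2 * (u / v - 1) = u * v - v ^ 2 := by field_simp
    have h5 : v ^ 2 * Real.log (u / v) ≤ u * v - v ^ 2 := by
      rw [← h4]; exact mul_le_mul_of_nonneg_left h2 (sq_nonneg v)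
    have h6 : (u + v) ^ 2 ≤ 4 := by nlinarith
    have h7 := mul_le_mul_of_nonneg_left h6 (sq_nonneg (u - v))
    nlinarith
  have h2 := Finset.sum_le_sum fun k (_ : k ∈ Finset.univ) => h1 k
  rw [← Finset.sum_div, Finset.sum_sub_distrib, Finset.sum_add_distrib, hx.2, hz.2] at h2
  unfold relEntropy
  linarith

theorem relEntropy_nonneg (hx : x ∈ stdSimplex ℝ (Fin K)) (hz : z ∈ stdSimplex ℝ (Fin K))
    (hx0 : ∀ k, 0 < x k) (hz0 : ∀ k, 0 < z k) : 0 ≤ relEntropy z x := by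
  have h1 := sum_sq_sub_le_relEntropy hx hz hx0 hz0
  have h2 := Finset.sum_nonneg fun k (_ : k ∈ Finset.univ) => sq_nonneg (x k - z k)
  linarith

theorem tendsto_of_relEntropy {ι : Type*} {l : Filter ι} {y : ι → Fin K → ℝ}
    (hz : z ∈ stdSimplex ℝ (Fin K)) (hz0 : ∀ k, 0 < z k)
    (hy : ∀ᶠ i in l, y i ∈ stdSimplex ℝ (Fin K) ∧ ∀ k, 0 < y i k)
    (h : Tendsto (fun i => relEntropy z (y i)) l (𝓝 0)) : Tendsto y l (𝓝 z) := by
  have h1 : Tendsto (fun i => ‖y i - z‖ ^ 2) l (𝓝 0) := by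
    refine squeeze_zero' (Eventually.of_forall fun _ => sq_nonneg _) ?_
      (by simpa using h.const_mul 4)
    filter_upwards [hy] with i hi
    exact (norm_sq_le_sum_sq _).trans (sum_sq_sub_le_relEntropy hi.1 hz hi.2 hz0)
  rw [tendsto_iff_norm_sub_tendsto_zero]
  simpa using h1.sqrt

/-- Away from the boundary the relative entropy of a fixed point decreases at a rate proportional
to itself along the mean field. -/
theorem IsAttractionFactor.exists_relEntropy_decay (hΘ : IsAttractionFactor Θ) (hβ : 0 ≤ β)
    (hε : ∀ k, 0 ≤ ε k) (hz : z ∈ stateSpace K β) (hzf : choiceProb Θ β ε z = z) {a : ℝ}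
    (ha : 0 < a) : ∃ κ : ℝ, 0 < κ ∧ ∀ x ∈ stdSimplex ℝ (Fin K), (∀ k, a ≤ x k) →
      ∑ k, (1 - z k / x k) * (choiceProb Θ β ε x k - x k) ≤ -(κ * relEntropy z x) := by
  obtain ⟨c, hc, h⟩ := hΘ.exists_dissipation (K := K) hβ
  obtain ⟨C, hC, hT⟩ := hΘ.exists_totalPotential_le (ε := ε) hβ ha
  have hz0 : ∀ k, 0 < z k := fun k => by rw [← hzf]; exact hΘ.choiceProb_pos hβ hε hz k
  refine ⟨c / C, by positivity, fun x hx hxa => ?_⟩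
  have hx0 : ∀ k, 0 < x k := fun k => ha.trans_le (hxa k)
  refine (h ε hε z hz hzf x hx hx0).trans (neg_le_neg ?_)
  have h1 := hT x hx hxa
  have h2 := hΘ.totalPotential_pos hβ hε (x := x) ⟨hx, fun _ => hx0⟩
  have h3 := relEntropy_le_deviation hx hz.1 hx0 hz0
  have h4 := relEntropy_nonneg hx hz.1 hx0 hz0
  gcongr

/-! ### The mean dynamics -/

/-- Grönwall's inequality for exponential decay from time `T` on. -/
theorem exp_decay_of_deriv_le {f f' : ℝ → ℝ} {κ T : ℝ} (hT : 0 ≤ T)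
    (hf : ∀ t, T ≤ t → HasDerivWithinAt f (f' t) (Set.Ici 0) t)
    (hle : ∀ t, T ≤ t → f' t ≤ -(κ * f t)) {t : ℝ} (ht : T ≤ t) :
    f t ≤ f T * Real.exp (-(κ * (t - T))) := by
  have hd : ∀ s, T ≤ s → HasDerivWithinAt (fun s => f s * Real.exp (κ * s))
      (f' s * Real.exp (κ * s) + f s * (Real.exp (κ * s) * κ)) (Set.Ici 0) s := fun s hs => by
    refine (hf s hs).mul ?_
    simpa using (((hasDerivAt_id s).const_mul κ).exp).hasDerivWithinAt
  have hsub : Set.Ici T ⊆ Set.Ici (0 : ℝ) := Set.Ici_subset_Ici.2 hT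
  have hanti : AntitoneOn (fun s => f s * Real.exp (κ * s)) (Set.Ici T) := by
    refine antitoneOn_of_hasDerivWithinAt_nonpos (convex_Ici T)
      (fun s hs => ((hd s hs).continuousWithinAt).mono hsub)
      (fun s hs => (hd s (interior_subset hs)).mono (interior_subset.trans hsub)) fun s hs => ?_
    have := hle s (interior_subset hs)
    nlinarith [Real.exp_pos (κ * s)]
  have h := hanti Set.self_mem_Ici ht ht
  have e : Real.exp (-(κ * (t - T))) = Real.exp (κ * T) * Real.exp (-(κ * t)) := by
    rw [← Real.exp_add]; ring_nf
  rw [e, ← mul_assoc]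
  calc f t = f t * Real.exp (κ * t) * Real.exp (-(κ * t)) := by
        rw [mul_assoc, ← Real.exp_add]; simp
    _ ≤ _ := mul_le_mul_of_nonneg_right h (Real.exp_pos _).le

theorem IsTrajectory.hasDerivWithinAt_apply {x : ℝ → Fin K → ℝ} (h : IsTrajectory Θ β ε x) {t : ℝ}
    (ht : 0 ≤ t) (k : Fin K) : HasDerivWithinAt (fun t => x t k)
      (choiceProb Θ β ε (x t) k - x t k) (Set.Ici 0) t :=
  hasDerivWithinAt_pi.1 (h t ht).2 k

theorem IsTrajectory.hasDerivWithinAt_shortfall {x : ℝ → Fin K → ℝ} (h : IsTrajectory Θ β ε x)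
    (b : ℝ) {t : ℝ} (ht : 0 ≤ t) : HasDerivWithinAt (fun t => shortfall b (x t))
      (∑ k, 2 * max (b - x t k) 0 * -(choiceProb Θ β ε (x t) k - x t k)) (Set.Ici 0) t :=
  HasDerivWithinAt.fun_sum fun k _ =>
    HasDerivAt.comp_hasDerivWithinAt (h₂ := fun s : ℝ => max s 0 ^ 2) t
      (hasDerivAt_max_zero_sq (b - x t k))
      ((h.hasDerivWithinAt_apply ht k).const_sub b)

theorem IsTrajectory.hasDerivWithinAt_relEntropy (hΘ : IsAttractionFactor Θ) (hβ : 0 ≤ β)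
    (hε : ∀ k, 0 ≤ ε k) {x : ℝ → Fin K → ℝ}
    (h : IsTrajectory Θ β ε x) (hz0 : ∀ k, 0 < z k) {t : ℝ} (ht : 0 ≤ t) (hx0 : ∀ k, 0 < x t k) :
    HasDerivWithinAt (fun t => relEntropy z (x t))
      (∑ k, (1 - z k / x t k) * (choiceProb Θ β ε (x t) k - x t k)) (Set.Ici 0) t := by
  have h1 : ∑ k, (1 - z k / x t k) * (choiceProb Θ β ε (x t) k - x t k) =
      ∑ k, z k * -((choiceProb Θ β ε (x t) k - x t k) / x t k) := by
    have e1 : ∑ k, (choiceProb Θ β ε (x t) k - x t k) = 0 := by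
      rw [Finset.sum_sub_distrib, hΘ.sum_choiceProb hβ hε (h t ht).1, (h t ht).1.1.2, sub_self]
    rw [← sub_eq_zero, ← e1, ← Finset.sum_sub_distrib]
    refine Finset.sum_congr rfl fun k _ => ?_
    ring
  rw [h1]
  refine HasDerivWithinAt.fun_sum fun k _ => ?_
  have h2 : (fun t => z k * Real.log (z k / x t k)) =ᶠ[𝓝[Set.Ici 0] t]
      fun t => z k * (Real.log (z k) - Real.log (x t k)) := by
    have hc := (h.hasDerivWithinAt_apply ht k).continuousWithinAt
    filter_upwards [hc.eventually (lt_mem_nhds (hx0 k))] with s hs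
    rw [Real.log_div (hz0 k).ne' hs.ne']
  refine HasDerivWithinAt.congr_of_eventuallyEq ?_ h2 (by
    rw [Real.log_div (hz0 k).ne' (hx0 k).ne'])
  exact (((h.hasDerivWithinAt_apply ht k).log (hx0 k).ne').const_sub _).const_mul _

/-- The shortfall below a small level decays exponentially, so every trajectory enters a compact
part of the open simplex, and a trajectory that starts near `z` never leaves it; there the relative
entropy decays exponentially. -/
theorem IsAttractionFactor.isGloballyAsymptoticallyStable (hK : 0 < K) (hΘ : IsAttractionFactor Θ)
    (hβ : 0 ≤ β) (hε : ∀ k, 0 ≤ ε k) (hz : z ∈ stateSpace K β) (hzf : choiceProb Θ β ε z = z) :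
    IsGloballyAsymptoticallyStable Θ β ε z := by
  obtain ⟨a, ha, hrep⟩ := hΘ.exists_repulsion hK hβ hε
  have hz0 : ∀ k, 0 < z k := fun k => by rw [← hzf]; exact hΘ.choiceProb_pos hβ hε hz k
  have hshort : ∀ b, 0 < b → b ≤ a → ∀ x : ℝ → Fin K → ℝ, IsTrajectory Θ β ε x → ∀ t, 0 ≤ t →
      shortfall b (x t) ≤ shortfall b (x 0) * Real.exp (-(2 * (t - 0))) := by
    intro b hb hba x hx t ht
    refine exp_decay_of_deriv_le (f := fun t => shortfall b (x t)) le_rfl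
      (fun s hs => hx.hasDerivWithinAt_shortfall b hs) (fun s hs => ?_) ht
    have h1 := hrep b hb hba (x s) (hx s hs).1
    have h2 : ∑ k, 2 * max (b - x s k) 0 * -(choiceProb Θ β ε (x s) k - x s k) =
        -(2 * ∑ k, max (b - x s k) 0 * (choiceProb Θ β ε (x s) k - x s k)) := by
      rw [Finset.mul_sum, ← Finset.sum_neg_distrib]
      exact Finset.sum_congr rfl fun k _ => by ring
    rw [h2]
    linarith
  have hentropy : ∀ b, 0 < b → ∃ κ : ℝ, 0 < κ ∧ ∀ x : ℝ → Fin K → ℝ, IsTrajectory Θ β ε x →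
      ∀ T, 0 ≤ T → (∀ t, T ≤ t → ∀ k, b ≤ x t k) → ∀ t, T ≤ t →
        relEntropy z (x t) ≤ relEntropy z (x T) * Real.exp (-(κ * (t - T))) := by
    intro b hb
    obtain ⟨κ, hκ, h⟩ := hΘ.exists_relEntropy_decay hβ hε hz hzf hb
    refine ⟨κ, hκ, fun x hx T hT hxb t ht => ?_⟩
    exact exp_decay_of_deriv_le (f := fun t => relEntropy z (x t)) hT
      (fun s hs => hx.hasDerivWithinAt_relEntropy hΘ hβ hε hz0 (hT.trans hs)
        fun k => hb.trans_le (hxb s hs k))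
      (fun s hs => h (x s) (hx s (hT.trans hs)).1.1 (hxb s hs)) ht
  have hexp : ∀ κ : ℝ, 0 < κ → ∀ A T : ℝ,
      Tendsto (fun t => A * Real.exp (-(κ * (t - T)))) atTop (𝓝 0) := by
    intro κ hκ A T
    have h1 : Tendsto (fun t : ℝ => κ * (t - T)) atTop atTop :=
      (tendsto_atTop_add_const_right _ (-T) tendsto_id).const_mul_atTop hκ
    simpa using (Real.tendsto_exp_neg_atTop_nhds_zero.comp h1).const_mul A
  constructor
  · intro δ hδ
    have : Nonempty (Fin K) := ⟨⟨0, hK⟩⟩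
    obtain ⟨i, hi⟩ := Finite.exists_min z
    -- below the level `b` a trajectory that starts near `z` has no shortfall, and acquires none
    set b := min a (z i / 2) with hb
    have hb0 : 0 < b := lt_min ha (half_pos (hz0 i))
    obtain ⟨κ, hκ, hdec⟩ := hentropy b hb0
    have hcont : ContinuousAt (relEntropy z) z := by
      unfold relEntropy
      refine tendsto_finsetSum _ fun k _ => ?_
      have hk : ContinuousAt (fun x : Fin K → ℝ => x k) z := continuousAt_apply k z
      exact (((continuousAt_const.div hk (hz0 k).ne').log
        (div_pos (hz0 k) (hz0 k)).ne').const_mul (z k))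
    have hev : ∀ᶠ x in 𝓝 z, relEntropy z x < δ ^ 2 / 4 :=
      hcont.eventually (gt_mem_nhds (by rw [relEntropy_self]; positivity))
    obtain ⟨γ, hγ, hγV⟩ := Metric.eventually_nhds_iff.1 hev
    refine ⟨min γ b, lt_min hγ hb0, fun x hx hd t ht => ?_⟩
    have h0 : ∀ k, b ≤ x 0 k := fun k => by
      have h1 : |x 0 k - z k| ≤ ‖x 0 - z‖ := abs_apply_le_norm (x 0 - z) k
      rw [← dist_eq_norm] at h1
      have h2 := (abs_le.1 (h1.trans (hd.le.trans (min_le_right _ _)))).1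
      have h3 : b ≤ z i / 2 := min_le_right _ _
      linarith [hi k]
    have hlow : ∀ s, 0 ≤ s → ∀ k, b ≤ x s k := fun s hs => le_of_shortfall_nonpos (by
      simpa [shortfall_eq_zero h0] using hshort b hb0 (min_le_left _ _) x hx s hs)
    have hpos : ∀ s, 0 ≤ s → ∀ k, 0 < x s k := fun s hs k => hb0.trans_le (hlow s hs k)
    have h1 := hdec x hx 0 le_rfl hlow t ht
    have h2 : relEntropy z (x 0) * Real.exp (-(κ * (t - 0))) ≤ relEntropy z (x 0) := by
      refine mul_le_of_le_one_right
        (relEntropy_nonneg (hx 0 le_rfl).1.1 hz.1 (hpos 0 le_rfl) hz0) (Real.exp_le_one_iff.2 ?_)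
      have : 0 ≤ κ * (t - 0) := mul_nonneg hκ.le (by linarith)
      linarith
    have h3 := hγV (hd.trans_le (min_le_left _ _))
    have h4 := sum_sq_sub_le_relEntropy (hx t ht).1.1 hz.1 (hpos t ht) hz0
    have h5 := norm_sq_le_sum_sq (x t - z)
    simp only [Pi.sub_apply] at h5
    rw [dist_eq_norm]
    exact lt_of_pow_lt_pow_left₀ 2 hδ.le (by linarith)
  · intro x hx
    have h1 : Tendsto (fun t => shortfall a (x 0) * Real.exp (-(2 * (t - 0)))) atTop (𝓝 0) :=
      hexp 2 two_pos _ _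
    have h2 : ∀ᶠ t in atTop, ∀ k, a / 2 ≤ x t k := by
      filter_upwards [h1.eventually (ge_mem_nhds (show (0 : ℝ) < (a / 2) ^ 2 by positivity)),
        eventually_ge_atTop 0] with t ht ht0
      exact half_le_of_shortfall_le ha ((hshort a ha le_rfl x hx t ht0).trans ht)
    obtain ⟨T, hT⟩ := eventually_atTop.1 (h2.and (eventually_ge_atTop (0 : ℝ)))
    have hT0 : 0 ≤ T := (hT T le_rfl).2
    obtain ⟨κ, hκ, hdec⟩ := hentropy (a / 2) (half_pos ha)
    have hpos : ∀ t, T ≤ t → ∀ k, 0 < x t k := fun t ht k =>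
      (half_pos ha).trans_le ((hT t ht).1 k)
    refine tendsto_of_relEntropy hz.1 hz0 ?_ (squeeze_zero' ?_ ?_
      (hexp κ hκ (relEntropy z (x T)) T))
    · filter_upwards [eventually_ge_atTop T] with t ht
      exact ⟨(hx t (hT0.trans ht)).1.1, hpos t ht⟩
    · filter_upwards [eventually_ge_atTop T] with t ht
      exact relEntropy_nonneg (hx t (hT0.trans ht)).1.1 hz.1 (hpos t ht) hz0
    · filter_upwards [eventually_ge_atTop T] with t ht
      exact hdec x hx T hT0 (fun s hs => (hT s hs).1) t ht

/-! ### Convergence of stochastic approximation -/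

/-- A series of bounded martingale differences converges almost surely if the squares of the bounds
are summable. -/
theorem ae_exists_tendsto_sum_of_condExp_eq_zero {Ω : Type*} {mΩ : MeasurableSpace Ω}
    {μ : Measure Ω} [IsProbabilityMeasure μ] {ℱ : Filtration ℕ mΩ} {D : ℕ → Ω → ℝ} {c : ℕ → ℝ}
    (hD : ∀ t, StronglyMeasurable[ℱ (t + 1)] (D t)) (hb : ∀ t ω, |D t ω| ≤ c t)
    (hc : Summable fun t => c t ^ 2) (h0 : ∀ t, μ[D t | ℱ t] =ᵐ[μ] 0) :
    ∀ᵐ ω ∂μ, ∃ l, Tendsto (fun t => ∑ s ∈ Finset.range t, D s ω) atTop (𝓝 l) := by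
  set M : ℕ → Ω → ℝ := fun t ω => ∑ s ∈ Finset.range t, D s ω with hM
  have hMsucc : ∀ t ω, M (t + 1) ω = M t ω + D t ω := fun t ω => Finset.sum_range_succ _ _
  have hadp : StronglyAdapted ℱ M := fun t =>
    Finset.stronglyMeasurable_fun_sum _ fun s hs =>
      (hD s).mono (ℱ.mono (Finset.mem_range.1 hs))
  have hMb : ∀ t ω, ‖M t ω‖ ≤ ∑ s ∈ Finset.range t, c s := fun t ω =>
    (Finset.abs_sum_le_sum_abs _ _).trans (Finset.sum_le_sum fun s _ => hb s ω)
  have hDi : ∀ t, Integrable (D t) μ := fun t =>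
    Integrable.of_bound ((hD t).mono (ℱ.le _)).aestronglyMeasurable (c t)
      (ae_of_all _ fun ω => hb t ω)
  have hMi : ∀ t, Integrable (M t) μ := fun t =>
    Integrable.of_bound ((hadp t).mono (ℱ.le _)).aestronglyMeasurable _ (ae_of_all _ (hMb t))
  have hmart : Martingale M ℱ μ := by
    refine martingale_of_condExp_sub_eq_zero_nat hadp hMi fun t => ?_
    have : M (t + 1) - M t = D t := by
      funext ω; rw [Pi.sub_apply, hMsucc]; ring
    rw [this]; exact h0 t
  have hMDi : ∀ t, Integrable (fun ω => M t ω * D t ω) μ := fun t =>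
    (hDi t).bdd_mul ((hadp t).mono (ℱ.le _)).aestronglyMeasurable (ae_of_all _ (hMb t))
  -- the increments are orthogonal to the past, so the second moments add up
  have horth : ∀ t, ∫ ω, M t ω * D t ω ∂μ = 0 := fun t => by
    have h1 := condExp_stronglyMeasurable_mul_of_bound (ℱ.le t) (hadp t) (hDi t) _
      (ae_of_all μ (hMb t))
    rw [← integral_condExp (ℱ.le t) (f := fun ω => M t ω * D t ω)]
    refine integral_eq_zero_of_ae ?_
    filter_upwards [h1, h0 t] with ω h2 h3
    have h4 : (μ[fun ω => M t ω * D t ω | ℱ t]) ω = (M t * μ[D t | ℱ t]) ω := h2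
    rw [h4, Pi.mul_apply, h3]
    simp
  have hsqi : ∀ t, Integrable (fun ω => M t ω ^ 2) μ := fun t => by
    refine Integrable.of_bound (((hadp t).mono (ℱ.le _)).pow 2).aestronglyMeasurable
      ((∑ s ∈ Finset.range t, c s) ^ 2) (ae_of_all _ fun ω => ?_)
    rw [norm_pow]
    exact pow_le_pow_left₀ (norm_nonneg _) (hMb t ω) 2
  have hDsqi : ∀ t, Integrable (fun ω => D t ω ^ 2) μ := fun t => by
    refine Integrable.of_bound (((hD t).mono (ℱ.le _)).pow 2).aestronglyMeasurable
      (c t ^ 2) (ae_of_all _ fun ω => ?_)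
    rw [norm_pow]
    exact pow_le_pow_left₀ (norm_nonneg _) (hb t ω) 2
  have hsq : ∀ t, ∫ ω, M t ω ^ 2 ∂μ ≤ ∑ s ∈ Finset.range t, c s ^ 2 := by
    intro t
    induction t with
    | zero => simp [hM]
    | succ t ih =>
      have e1 : ∀ ω, M (t + 1) ω ^ 2 = M t ω ^ 2 + 2 * (M t ω * D t ω) + D t ω ^ 2 := fun ω => by
        rw [hMsucc]; ring
      have e2 : ∫ ω, D t ω ^ 2 ∂μ ≤ c t ^ 2 := by
        refine (integral_mono (hDsqi t) (integrable_const (c t ^ 2)) fun ω => ?_).trans (by simp)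
        rw [← sq_abs]
        exact pow_le_pow_left₀ (abs_nonneg _) (hb t ω) 2
      have e3 : Integrable (fun ω => M t ω ^ 2 + 2 * (M t ω * D t ω)) μ :=
        (hsqi t).add ((hMDi t).const_mul 2)
      simp only [e1]
      rw [integral_add e3 (hDsqi t), integral_add (hsqi t) ((hMDi t).const_mul 2),
        integral_const_mul, horth, Finset.sum_range_succ]
      linarith
  refine hmart.submartingale.exists_ae_tendsto_of_bdd
    (R := Real.toNNReal (1 + ∑' s, c s ^ 2)) fun t => ?_
  have hbound : ∫ ω, ‖M t ω‖ ∂μ ≤ 1 + ∑' s, c s ^ 2 := by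
    have h1 : ∫ ω, ‖M t ω‖ ∂μ ≤ ∫ ω, (1 + M t ω ^ 2) ∂μ := by
      refine integral_mono (hMi t).norm ((integrable_const _).add (hsqi t)) fun ω => ?_
      rw [Real.norm_eq_abs]
      nlinarith [sq_abs (M t ω), sq_nonneg (|M t ω| - 1)]
    rw [integral_add (integrable_const _) (hsqi t)] at h1
    have h2 := (hsq t).trans (hc.sum_le_tsum _ fun s _ => sq_nonneg _)
    rw [integral_const, probReal_univ, one_smul] at h1
    linarith
  rw [eLpNorm_one_eq_lintegral_enorm, ← ofReal_integral_norm_eq_lintegral_enorm (hMi t)]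
  exact ENNReal.ofReal_le_ofReal hbound

/-- A deterministic Robbins–Monro lemma: a nonnegative sequence that decreases at the rate `κ γ_t`
up to the increments of a convergent sequence tends to zero if the steps `γ_t` are not summable. -/
theorem tendsto_zero_of_perturbed_decay {u γ R : ℕ → ℝ} {κ l : ℝ} (hκ : 0 < κ)
    (hγ : ∀ t, 0 ≤ γ t) (hγ0 : Tendsto γ atTop (𝓝 0))
    (hγs : Tendsto (fun t => ∑ s ∈ Finset.range t, γ s) atTop atTop)
    (hu : ∀ᶠ t in atTop, 0 ≤ u t) (hR : Tendsto R atTop (𝓝 l))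
    (hstep : ∀ᶠ t in atTop, u (t + 1) ≤ u t - κ * γ t * u t + (R (t + 1) - R t)) :
    Tendsto u atTop (𝓝 0) := by
  have hclaim : ∀ η > 0, ∀ᶠ t in atTop, u t ≤ 3 * η := by
    intro η hη
    have h1 : ∀ᶠ t in atTop, |l - R t| ≤ η := by
      filter_upwards [Metric.tendsto_nhds.1 hR η hη] with t ht
      rw [abs_sub_comm, ← Real.dist_eq]; exact ht.le
    have h2 : ∀ᶠ t in atTop, κ * γ t ≤ 1 := by
      have : Tendsto (fun t => κ * γ t) atTop (𝓝 0) := by simpa using hγ0.const_mul κ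
      exact this.eventually (ge_mem_nhds one_pos)
    obtain ⟨T, hT⟩ := eventually_atTop.1 ((h1.and h2).and hstep)
    -- the positive part of `u_t + (l - R_t) - η` contracts by the factors `1 - κ γ_t`
    set W : ℕ → ℝ := fun t => max (u t + (l - R t) - η) 0 with hW
    have hWs : ∀ t, T ≤ t → W (t + 1) ≤ Real.exp (-(κ * γ t)) * W t := by
      intro t ht
      obtain ⟨⟨h1, h2⟩, h3⟩ := hT t ht
      have h4 : 1 - κ * γ t ≤ Real.exp (-(κ * γ t)) := by
        have := Real.add_one_le_exp (-(κ * γ t)); linarith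
      have h5 : 0 ≤ W t := le_max_right _ _
      refine max_le ?_ (mul_nonneg (Real.exp_pos _).le h5)
      have h6 : u (t + 1) + (l - R (t + 1)) - η ≤ (1 - κ * γ t) * (u t + (l - R t) - η) := by
        have h7 := mul_le_mul_of_nonneg_left (abs_le.1 h1).2 (mul_nonneg hκ.le (hγ t))
        nlinarith
      refine h6.trans ?_
      calc _ ≤ (1 - κ * γ t) * W t :=
            mul_le_mul_of_nonneg_left (le_max_left _ _) (by linarith)
        _ ≤ _ := mul_le_mul_of_nonneg_right h4 h5
    have hWexp : ∀ t, T ≤ t → W t ≤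
        W T * Real.exp (κ * ∑ s ∈ Finset.range T, γ s) *
          Real.exp (-(κ * ∑ s ∈ Finset.range t, γ s)) := by
      intro t ht
      induction t, ht using Nat.le_induction with
      | base => rw [mul_assoc, ← Real.exp_add]; simp
      | succ t ht ih =>
        refine (hWs t ht).trans ((mul_le_mul_of_nonneg_left ih (Real.exp_pos _).le).trans_eq ?_)
        rw [Finset.sum_range_succ, mul_add, neg_add, Real.exp_add]
        ring
    have hlim : Tendsto (fun t => W T * Real.exp (κ * ∑ s ∈ Finset.range T, γ s) *
          Real.exp (-(κ * ∑ s ∈ Finset.range t, γ s))) atTop (𝓝 0) := by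
      simpa using (Real.tendsto_exp_neg_atTop_nhds_zero.comp
        (hγs.const_mul_atTop hκ)).const_mul (W T * Real.exp (κ * ∑ s ∈ Finset.range T, γ s))
    filter_upwards [hlim.eventually (ge_mem_nhds hη), eventually_ge_atTop T] with t ht htT
    have h3 := (hWexp t htT).trans ht
    have h4 : u t + (l - R t) - η ≤ W t := le_max_left _ _
    have h5 := (abs_le.1 (hT t htT).1.1).1
    linarith
  rw [Metric.tendsto_nhds]
  intro η hη
  filter_upwards [hclaim (η / 4) (by positivity), hu] with t ht h0
  rw [Real.dist_eq, sub_zero, abs_of_nonneg h0]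
  linarith

/-! ### The process of group sizes -/

/-- The weight of the entrant at time `t` among all individuals present after the entry, when the
initial sizes are `n₀`. -/
def stepSize (n₀ : Fin K → ℕ) (t : ℕ) : ℝ := 1 / (((∑ k, n₀ k : ℕ) : ℝ) + t + 1)

theorem stepSize_pos (n₀ : Fin K → ℕ) (t : ℕ) : 0 < stepSize n₀ t := by
  unfold stepSize; positivity

theorem stepSize_eq (n₀ : Fin K → ℕ) (t : ℕ) :
    stepSize n₀ t = 1 / (((t + ∑ k, n₀ k : ℕ) : ℝ) + 1) := by
  unfold stepSize; push_cast; ring_nf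

theorem tendsto_stepSize (n₀ : Fin K → ℕ) : Tendsto (stepSize n₀) atTop (𝓝 0) := by
  have h := (tendsto_add_atTop_iff_nat (∑ k, n₀ k)).2
    (tendsto_one_div_add_atTop_nhds_zero_nat (𝕜 := ℝ))
  exact h.congr fun t => (stepSize_eq n₀ t).symm

theorem summable_stepSize_sq (n₀ : Fin K → ℕ) : Summable fun t => stepSize n₀ t ^ 2 := by
  have h := (summable_nat_add_iff (∑ k, n₀ k + 1)).2
    (Real.summable_one_div_nat_pow.2 one_lt_two)
  refine h.congr fun t => ?_
  rw [stepSize_eq, div_pow]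
  push_cast
  ring_nf

theorem tendsto_sum_stepSize (n₀ : Fin K → ℕ) :
    Tendsto (fun t => ∑ s ∈ Finset.range t, stepSize n₀ s) atTop atTop := by
  have h : ¬ Summable (stepSize n₀) := fun hs => by
    refine Real.not_summable_one_div_natCast
      ((summable_nat_add_iff (∑ k, n₀ k + 1)).1 (hs.congr fun t => ?_))
    rw [stepSize_eq]
    push_cast
    ring_nf
  exact (not_summable_iff_tendsto_nat_atTop_of_nonneg fun t => (stepSize_pos n₀ t).le).1 h

variable {n₀ : Fin K → ℕ} {Ω : Type*} [mΩ : MeasurableSpace Ω] {μ : Measure Ω}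
  {ℱ : Filtration ℕ mΩ} {X : ℕ → Ω → Fin K} {n : ℕ → Ω → Fin K → ℕ}

theorem IsGroupProcess.sum_eq (h : IsGroupProcess Θ β ε n₀ μ ℱ X n) (t : ℕ) (ω : Ω) :
    ∑ k, n t ω k = ∑ k, n₀ k + t := by
  induction t with
  | zero => simp [h.init ω]
  | succ t ih => simp only [h.step, Finset.sum_add_distrib, ih]; simp; ring

theorem IsGroupProcess.initial_le (h : IsGroupProcess Θ β ε n₀ μ ℱ X n) (t : ℕ) (ω : Ω)
    (k : Fin K) : n₀ k ≤ n t ω k := by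
  induction t with
  | zero => rw [h.init ω]
  | succ t ih => rw [h.step]; exact ih.trans (Nat.le_add_right _ _)

theorem IsGroupProcess.proportion_succ (h : IsGroupProcess Θ β ε n₀ μ ℱ X n)
    (hn₀ : 0 < ∑ k, n₀ k) (t : ℕ) (ω : Ω) (k : Fin K) :
    proportion (n (t + 1) ω) k = proportion (n t ω) k +
      stepSize n₀ t * ((if X t ω = k then 1 else 0) - proportion (n t ω) k) := by
  have hN : (0 : ℝ) < ((∑ k, n₀ k : ℕ) : ℝ) := Nat.cast_pos.2 hn₀
  have h1 : ((∑ k, n₀ k : ℕ) : ℝ) + t ≠ 0 := by positivity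
  have h2 : ((∑ k, n₀ k : ℕ) : ℝ) + t + 1 ≠ 0 := by positivity
  have h3 : ((∑ k, n₀ k : ℕ) : ℝ) + (t + 1) ≠ 0 := by positivity
  unfold proportion stepSize
  rw [h.sum_eq, h.sum_eq, h.step]
  rw [Nat.cast_add, Nat.cast_add, Nat.cast_add, Nat.cast_add, Nat.cast_one, Nat.cast_ite,
    Nat.cast_one, Nat.cast_zero]
  generalize ((∑ k, n₀ k : ℕ) : ℝ) = N at *
  field_simp
  ring

theorem IsGroupProcess.proportion_mem (h : IsGroupProcess Θ β ε n₀ μ ℱ X n)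
    (hn₀ : 0 < ∑ k, n₀ k) (hpos : β ≠ 0 → ∀ k, 0 < n₀ k) (t : ℕ) (ω : Ω) :
    proportion (n t ω) ∈ stateSpace K β := by
  have hN : (0 : ℝ) < ((∑ j, n t ω j : ℕ) : ℝ) := by
    rw [h.sum_eq]; exact Nat.cast_pos.2 (by omega)
  refine ⟨⟨fun k => by unfold proportion; positivity, ?_⟩, fun hβ k => ?_⟩
  · simp only [proportion, ← Finset.sum_div]
    rw [← Nat.cast_sum, div_self hN.ne']
  · have : (0 : ℝ) < n t ω k := Nat.cast_pos.2 ((hpos hβ k).trans_le (h.initial_le t ω k))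
    unfold proportion; positivity

theorem IsGroupProcess.measurable_size (h : IsGroupProcess Θ β ε n₀ μ ℱ X n) (t : ℕ) :
    Measurable[ℱ t] (n t) := by
  induction t with
  | zero =>
    have : n 0 = fun _ => n₀ := funext h.init
    rw [this]; exact measurable_const
  | succ t ih =>
    have e : n (t + 1) =
        (fun p : (Fin K → ℕ) × Fin K => fun k => p.1 k + if p.2 = k then 1 else 0) ∘
          fun ω => (n t ω, X t ω) := by
      funext ω k; exact h.step t ω k
    rw [e]
    exact (measurable_of_countable _).comp
      ((ih.mono (ℱ.mono t.le_succ) le_rfl).prodMk (h.adapted t))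

/-- The accumulated deviation of the entrants' choices from their conditional probabilities
converges, also with bounded weights that depend on the current proportions. -/
theorem IsGroupProcess.ae_exists_tendsto_noise [IsProbabilityMeasure μ]
    (h : IsGroupProcess Θ β ε n₀ μ ℱ X n) (hΘ : IsAttractionFactor Θ) (hβ : 0 ≤ β)
    (hε : ∀ k, 0 ≤ ε k) (hn₀ : 0 < ∑ k, n₀ k) (hpos : β ≠ 0 → ∀ k, 0 < n₀ k)
    {f : (Fin K → ℝ) → Fin K → ℝ} {B : ℝ}
    (hB : ∀ x ∈ stdSimplex ℝ (Fin K), ∀ k, |f x k| ≤ B) :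
    ∀ᵐ ω ∂μ, ∃ l, Tendsto (fun t => ∑ s ∈ Finset.range t, stepSize n₀ s *
      ∑ k, f (proportion (n s ω)) k *
        ((if X s ω = k then 1 else 0) - choiceProb Θ β ε (proportion (n s ω)) k))
      atTop (𝓝 l) := by
  have hfun : ∀ (g : (Fin K → ℕ) → ℝ) t, StronglyMeasurable[ℱ t] fun ω => g (n t ω) := fun g t =>
    ((measurable_of_countable g).comp (h.measurable_size t)).stronglyMeasurable
  have hk : ∀ k, ∀ᵐ ω ∂μ, ∃ l, Tendsto (fun t => ∑ s ∈ Finset.range t,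
      stepSize n₀ s * f (proportion (n s ω)) k *
        ((if X s ω = k then 1 else 0) - choiceProb Θ β ε (proportion (n s ω)) k))
      atTop (𝓝 l) := by
    intro k
    have hI : ∀ t, StronglyMeasurable[ℱ (t + 1)] fun ω => if X t ω = k then (1 : ℝ) else 0 :=
      fun t => ((measurable_of_countable fun i : Fin K => if i = k then (1 : ℝ) else 0).comp
        (h.adapted t)).stronglyMeasurable
    have hp1 : ∀ t ω, choiceProb Θ β ε (proportion (n t ω)) k ≤ 1 := fun t ω => by
      have hx := h.proportion_mem hn₀ hpos t ω
      rw [← hΘ.sum_choiceProb hβ hε hx]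
      exact Finset.single_le_sum (fun j _ => (hΘ.choiceProb_pos hβ hε hx j).le)
        (Finset.mem_univ k)
    have hdiff : ∀ t ω, |(if X t ω = k then (1 : ℝ) else 0) -
        choiceProb Θ β ε (proportion (n t ω)) k| ≤ 1 := fun t ω => by
      have h0 := hΘ.choiceProb_pos hβ hε (h.proportion_mem hn₀ hpos t ω) k
      have h1 := hp1 t ω
      rw [abs_le]
      split_ifs <;> constructor <;> linarith
    have hP := fun t => hfun (fun m => choiceProb Θ β ε (proportion m) k) t
    have hdm : ∀ t, StronglyMeasurable[ℱ (t + 1)] fun ω => (if X t ω = k then (1 : ℝ) else 0) -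
        choiceProb Θ β ε (proportion (n t ω)) k := fun t =>
      (hI t).sub ((hP t).mono (ℱ.mono t.le_succ))
    refine ae_exists_tendsto_sum_of_condExp_eq_zero (ℱ := ℱ) (c := fun t => stepSize n₀ t * B)
      (fun t => ?_) (fun t ω => ?_) ?_ fun t => ?_
    · exact ((hfun (fun m => stepSize n₀ t * f (proportion m) k) t).mono (ℱ.mono t.le_succ)).mul
        (hdm t)
    · have h1 := hB _ (h.proportion_mem hn₀ hpos t ω).1 k
      rw [abs_mul, abs_mul, abs_of_pos (stepSize_pos n₀ t)]
      have h2 : stepSize n₀ t * |f (proportion (n t ω)) k| ≤ stepSize n₀ t * B :=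
        mul_le_mul_of_nonneg_left h1 (stepSize_pos n₀ t).le
      exact (mul_le_of_le_one_right
        (mul_nonneg (stepSize_pos n₀ t).le (abs_nonneg _)) (hdiff t ω)).trans h2
    · simp only [mul_pow]
      exact (summable_stepSize_sq n₀).mul_right _
    · have hIi : Integrable ({ω | X t ω = k}.indicator fun _ => (1 : ℝ)) μ := by
        refine (integrable_const (1 : ℝ)).indicator ?_
        exact ℱ.le _ _ (h.adapted t (measurableSet_singleton k))
      have hPi : Integrable (fun ω => choiceProb Θ β ε (proportion (n t ω)) k) μ := by
        refine Integrable.of_bound ((hP t).mono (ℱ.le _)).aestronglyMeasurable 1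
          (ae_of_all _ fun ω => ?_)
        rw [Real.norm_of_nonneg (hΘ.choiceProb_pos hβ hε (h.proportion_mem hn₀ hpos t ω) k).le]
        exact hp1 t ω
      have hd : (fun ω => (if X t ω = k then (1 : ℝ) else 0) -
          choiceProb Θ β ε (proportion (n t ω)) k) =
          ({ω | X t ω = k}.indicator fun _ => (1 : ℝ)) -
            fun ω => choiceProb Θ β ε (proportion (n t ω)) k := by
        funext ω
        simp [Set.indicator_apply]
      have h1 : μ[fun ω => (if X t ω = k then (1 : ℝ) else 0) -
          choiceProb Θ β ε (proportion (n t ω)) k | ℱ t] =ᵐ[μ] 0 := by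
        rw [hd]
        filter_upwards [condExp_sub hIi hPi (ℱ t), h.law t k] with ω e1 e2
        rw [e1, Pi.sub_apply, e2, condExp_of_stronglyMeasurable (ℱ.le t) (hP t) hPi]
        simp
      have h2 := condExp_stronglyMeasurable_mul_of_bound (ℱ.le t)
        (hfun (fun m => stepSize n₀ t * f (proportion m) k) t)
        (g := fun ω => (if X t ω = k then (1 : ℝ) else 0) -
          choiceProb Θ β ε (proportion (n t ω)) k)
        (by rw [hd]; exact hIi.sub hPi) (stepSize n₀ t * B) (ae_of_all μ fun ω => by
          rw [Real.norm_eq_abs, abs_mul, abs_of_pos (stepSize_pos n₀ t)]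
          exact mul_le_mul_of_nonneg_left (hB _ (h.proportion_mem hn₀ hpos t ω).1 k)
            (stepSize_pos n₀ t).le)
      refine h2.trans ?_
      filter_upwards [h1] with ω e1
      rw [Pi.mul_apply, e1]
      simp
  filter_upwards [ae_all_iff.2 hk] with ω hω
  choose l hl using hω
  refine ⟨∑ k, l k, (tendsto_finsetSum _ fun k _ => hl k).congr fun t => ?_⟩
  rw [Finset.sum_comm]
  refine Finset.sum_congr rfl fun s _ => ?_
  rw [Finset.mul_sum]
  exact Finset.sum_congr rfl fun k _ => by ring

/-! ### Almost sure convergence of the proportions -/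

/-- The change of the shortfall in a step of size `γ` from `x` towards a point `q` of the unit cube;
in the process `q` is the unit vector of the entrant's group. -/
theorem shortfall_step_le (a γ : ℝ) {q y : Fin K → ℝ} (hx : x ∈ stdSimplex ℝ (Fin K))
    (hq0 : ∀ k, 0 ≤ q k) (hq1 : ∀ k, q k ≤ 1) (hy : ∀ k, y k = x k + γ * (q k - x k)) :
    shortfall a y ≤ shortfall a x - 2 * γ * ∑ k, max (a - x k) 0 * (q k - x k) + K * γ ^ 2 := by
  have h1 : ∀ k, max (a - y k) 0 ^ 2 ≤
      max (a - x k) 0 ^ 2 - 2 * γ * (max (a - x k) 0 * (q k - x k)) + γ ^ 2 := fun k => by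
    have h2 := max_zero_sq_add_le (a - x k) (-(γ * (q k - x k)))
    have h3 : (q k - x k) ^ 2 ≤ 1 := by
      have := hx.1 k
      have := le_one_of_mem_stdSimplex hx k
      exact (sq_le_one_iff_abs_le_one _).2 (abs_le.2 ⟨by linarith [hq0 k], by linarith [hq1 k]⟩)
    have h4 := mul_le_mul_of_nonneg_left h3 (sq_nonneg γ)
    have e : a - y k = a - x k + -(γ * (q k - x k)) := by rw [hy]; ring
    rw [e]
    linarith
  refine (Finset.sum_le_sum fun k _ => h1 k).trans_eq ?_
  rw [Finset.sum_add_distrib, Finset.sum_sub_distrib, ← Finset.mul_sum]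
  simp [shortfall]

/-- The change of the relative entropy in a step of size `γ` from `x` towards `q`, up to second
order in `γ`, as long as the step stays away from the boundary. -/
theorem relEntropy_step_le {b γ : ℝ} (hb : 0 < b) {q y : Fin K → ℝ}
    (hx : x ∈ stdSimplex ℝ (Fin K)) (hz : z ∈ stdSimplex ℝ (Fin K)) (hz0 : ∀ k, 0 < z k)
    (hxb : ∀ k, b ≤ x k) (hyb : ∀ k, b ≤ y k) (hq0 : ∀ k, 0 ≤ q k) (hq1 : ∀ k, q k ≤ 1)
    (hqs : ∑ k, q k = 1) (hy : ∀ k, y k = x k + γ * (q k - x k)) :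
    relEntropy z y ≤ relEntropy z x + γ * ∑ k, (1 - z k / x k) * (q k - x k) +
      K * (γ ^ 2 / b ^ 2) := by
  have h1 : ∀ k, z k * Real.log (z k / y k) ≤
      z k * Real.log (z k / x k) + γ * ((1 - z k / x k) * (q k - x k)) - γ * (q k - x k) +
        γ ^ 2 / b ^ 2 := fun k => by
    have hx0 := hb.trans_le (hxb k)
    have hy0 := hb.trans_le (hyb k)
    have h2 := Real.log_le_sub_one_of_pos (div_pos hx0 hy0)
    have h3 : Real.log (z k / y k) = Real.log (z k / x k) + Real.log (x k / y k) := by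
      rw [← Real.log_mul (div_pos (hz0 k) hx0).ne' (div_pos hx0 hy0).ne']
      congr 1
      field_simp
    have h4 : x k / y k - 1 = -(γ * (q k - x k)) / x k + (γ * (q k - x k)) ^ 2 / (x k * y k) := by
      have := hy0.ne'
      rw [hy k] at this ⊢
      field_simp
      ring
    have h5 : (γ * (q k - x k)) ^ 2 / (x k * y k) ≤ γ ^ 2 / b ^ 2 := by
      have h6 : (q k - x k) ^ 2 ≤ 1 := by
        have := hx.1 k
        have := le_one_of_mem_stdSimplex hx k
        exact (sq_le_one_iff_abs_le_one _).2 (abs_le.2 ⟨by linarith [hq0 k], by linarith [hq1 k]⟩)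
      have h7 : b ^ 2 ≤ x k * y k := by
        rw [sq]; exact mul_le_mul (hxb k) (hyb k) hb.le hx0.le
      have h8 : (γ * (q k - x k)) ^ 2 ≤ γ ^ 2 := by
        rw [mul_pow]; exact mul_le_of_le_one_right (sq_nonneg _) h6
      exact div_le_div₀ (sq_nonneg _) h8 (by positivity) h7
    have h9 : 0 ≤ γ ^ 2 / b ^ 2 := by positivity
    have h10 := le_one_of_mem_stdSimplex hz k
    have h11 : z k * Real.log (x k / y k) ≤
        z k * (-(γ * (q k - x k)) / x k) + γ ^ 2 / b ^ 2 := by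
      calc _ ≤ z k * (x k / y k - 1) := mul_le_mul_of_nonneg_left h2 (hz0 k).le
        _ ≤ z k * (-(γ * (q k - x k)) / x k) + z k * (γ ^ 2 / b ^ 2) := by
          rw [h4, mul_add]
          exact add_le_add_right (mul_le_mul_of_nonneg_left h5 (hz0 k).le) _
        _ ≤ _ := by
          exact add_le_add_right (mul_le_of_le_one_left h9 h10) _
    rw [h3, mul_add]
    refine (add_le_add_right h11 _).trans_eq ?_
    ring
  refine (Finset.sum_le_sum fun k _ => h1 k).trans_eq ?_
  rw [Finset.sum_add_distrib, Finset.sum_sub_distrib, Finset.sum_add_distrib, ← Finset.mul_sum,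
    ← Finset.mul_sum, Finset.sum_sub_distrib, hqs, hx.2]
  simp [relEntropy]

/-- Stochastic approximation in two stages: the repulsion from the boundary keeps the proportions
eventually in a compact part of the open simplex, where the relative entropy is smooth and decays
along the mean field. -/
theorem IsGroupProcess.ae_tendsto [IsProbabilityMeasure μ]
    (h : IsGroupProcess Θ β ε n₀ μ ℱ X n) (hK : 0 < K) (hΘ : IsAttractionFactor Θ) (hβ : 0 ≤ β)
    (hε : ∀ k, 0 ≤ ε k) (hn₀ : 0 < ∑ k, n₀ k) (hpos : β ≠ 0 → ∀ k, 0 < n₀ k)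
    (hz : z ∈ stateSpace K β) (hzf : choiceProb Θ β ε z = z) :
    ∀ᵐ ω ∂μ, Tendsto (fun t => proportion (n t ω)) atTop (𝓝 z) := by
  obtain ⟨a, ha, hrep⟩ := hΘ.exists_repulsion hK hβ hε
  have hz0 : ∀ k, 0 < z k := fun k => by rw [← hzf]; exact hΘ.choiceProb_pos hβ hε hz k
  set b := a / 2 with hb
  have hb0 : 0 < b := half_pos ha
  obtain ⟨κ, hκ, hdec⟩ := hΘ.exists_relEntropy_decay hβ hε hz hzf hb0
  have hB1 : ∀ x ∈ stdSimplex ℝ (Fin K), ∀ k, |max (a - x k) 0| ≤ a := fun x hx k => by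
    rw [abs_of_nonneg (le_max_right _ _)]
    exact max_le (by linarith [hx.1 k]) ha.le
  -- the weights of the relative entropy are truncated near the boundary to keep them bounded
  have hB2 : ∀ x ∈ stdSimplex ℝ (Fin K), ∀ k, |1 - z k / max (x k) b| ≤ 1 + 1 / b :=
    fun x _ k => by
    have h1 : 0 < max (x k) b := lt_max_of_lt_right hb0
    have h2 : z k / max (x k) b ≤ 1 / b :=
      div_le_div₀ zero_le_one (le_one_of_mem_stdSimplex hz.1 k) hb0 (le_max_right _ _)
    have h3 : 0 ≤ z k / max (x k) b := (div_pos (hz0 k) h1).le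
    rw [abs_le]
    constructor <;> linarith
  filter_upwards [h.ae_exists_tendsto_noise hΘ hβ hε hn₀ hpos hB1,
    h.ae_exists_tendsto_noise hΘ hβ hε hn₀ hpos hB2] with ω ⟨l₁, hl₁⟩ ⟨l₂, hl₂⟩
  have hmem := fun t => h.proportion_mem hn₀ hpos t ω
  have hq0 : ∀ t k, (0 : ℝ) ≤ if X t ω = k then 1 else 0 := fun t k => by split_ifs <;> norm_num
  have hq1 : ∀ t k, (if X t ω = k then (1 : ℝ) else 0) ≤ 1 := fun t k => by split_ifs <;> norm_num
  have hsq := (summable_stepSize_sq n₀).hasSum.tendsto_sum_nat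
  -- first stage: the shortfall, with the martingale part and the quadratic terms as perturbation
  have hshort : Tendsto (fun t => shortfall a (proportion (n t ω))) atTop (𝓝 0) := by
    refine tendsto_zero_of_perturbed_decay two_pos (fun t => (stepSize_pos n₀ t).le)
      (tendsto_stepSize n₀) (tendsto_sum_stepSize n₀)
      (Eventually.of_forall fun t => shortfall_nonneg _ _)
      ((hl₁.const_mul (-2)).add (hsq.const_mul (K : ℝ))) (Eventually.of_forall fun t => ?_)
    have h1 := shortfall_step_le a (stepSize n₀ t) (hmem t).1 (hq0 t) (hq1 t)
      (h.proportion_succ hn₀ t ω)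
    have h2 := mul_le_mul_of_nonneg_left (hrep a ha le_rfl _ (hmem t)) (stepSize_pos n₀ t).le
    have h3 : ∑ k, max (a - proportion (n t ω) k) 0 *
          ((if X t ω = k then 1 else 0) - proportion (n t ω) k) =
        ∑ k, max (a - proportion (n t ω) k) 0 *
          (choiceProb Θ β ε (proportion (n t ω)) k - proportion (n t ω) k) +
        ∑ k, max (a - proportion (n t ω) k) 0 *
          ((if X t ω = k then 1 else 0) - choiceProb Θ β ε (proportion (n t ω)) k) := by
      rw [← Finset.sum_add_distrib]
      exact Finset.sum_congr rfl fun k _ => by ring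
    rw [h3] at h1
    rw [Finset.sum_range_succ, Finset.sum_range_succ]
    linarith
  have hlow : ∀ᶠ t in atTop, ∀ k, b ≤ proportion (n t ω) k := by
    filter_upwards [hshort.eventually (ge_mem_nhds (show (0 : ℝ) < (a / 2) ^ 2 by positivity))]
      with t ht
    exact half_le_of_shortfall_le ha ht
  -- second stage: the relative entropy
  refine tendsto_of_relEntropy hz.1 hz0 ?_ ?_
  · filter_upwards [hlow] with t ht
    exact ⟨(hmem t).1, fun k => hb0.trans_le (ht k)⟩
  · refine tendsto_zero_of_perturbed_decay hκ (fun t => (stepSize_pos n₀ t).le)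
      (tendsto_stepSize n₀) (tendsto_sum_stepSize n₀) ?_
      (hl₂.add (hsq.const_mul (K / b ^ 2 : ℝ))) ?_
    · filter_upwards [hlow] with t ht
      exact relEntropy_nonneg (hmem t).1 hz.1 (fun k => hb0.trans_le (ht k)) hz0
    · filter_upwards [hlow, (tendsto_add_atTop_nat 1).eventually hlow] with t ht ht1
      have h1 := relEntropy_step_le hb0 (hmem t).1 hz.1 hz0 ht ht1 (hq0 t) (hq1 t) (by simp)
        (h.proportion_succ hn₀ t ω)
      have h2 := mul_le_mul_of_nonneg_left (hdec _ (hmem t).1 ht) (stepSize_pos n₀ t).le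
      have h3 : ∑ k, (1 - z k / proportion (n t ω) k) *
            ((if X t ω = k then 1 else 0) - proportion (n t ω) k) =
          ∑ k, (1 - z k / proportion (n t ω) k) *
            (choiceProb Θ β ε (proportion (n t ω)) k - proportion (n t ω) k) +
          ∑ k, (1 - z k / max (proportion (n t ω) k) b) *
            ((if X t ω = k then 1 else 0) - choiceProb Θ β ε (proportion (n t ω)) k) := by
        rw [← Finset.sum_add_distrib]
        refine Finset.sum_congr rfl fun k _ => ?_
        rw [max_eq_left (ht k)]
        ring
      rw [h3] at h1
      rw [Finset.sum_range_succ, Finset.sum_range_succ]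
      have h4 : (K : ℝ) * (stepSize n₀ t ^ 2 / b ^ 2) = K / b ^ 2 * stepSize n₀ t ^ 2 := by ring
      linarith

/-! ### The fixed point for slightly asymmetric biases -/

theorem abs_sub_inv_card_le {d : ℝ} (hK : 0 < K) (hz : z ∈ stdSimplex ℝ (Fin K))
    (h : ∀ j k, |z j - z k| ≤ d) (k : Fin K) : |z k - 1 / K| ≤ d := by
  have hKpos : (0 : ℝ) < K := Nat.cast_pos.2 hK
  have h1 : z k - 1 / K = (∑ j, (z k - z j)) / K := by
    rw [Finset.sum_sub_distrib, hz.2]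
    simp
    field_simp
  rw [h1, abs_div, abs_of_pos hKpos, div_le_iff₀ hKpos]
  refine (Finset.abs_sum_le_sum_abs _ _).trans ((Finset.sum_le_sum fun j _ => h k j).trans_eq ?_)
  simp [mul_comm]

/-- With constant attraction the potential decreases with the size, so that the biases control the
differences of the sizes in equilibrium. -/
theorem fixedPoint_abs_sub_le {θ e : ℝ} (hθ : 0 < θ) (he : 0 < e) (hβ : 0 ≤ β) {η : Fin K → ℝ}
    (hη : ∑ k, η k = 0) (hpos : ∀ k, 0 ≤ e + η k) (hz : z ∈ stateSpace K β)
    (hzf : choiceProb (fun _ _ => θ) β (fun k => e + η k) z = z) (j k : Fin K) :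
    |z j - z k| ≤ 2 / (K * e) * ‖η‖ := by
  have hΘ : IsAttractionFactor (K := K) fun _ _ => θ := Or.inr ⟨θ, hθ, rfl⟩
  have hK : (0 : ℝ) < K := Nat.cast_pos.2 (Fin.pos k)
  have hz0 : ∀ k, 0 < z k := fun k => by rw [← hzf]; exact hΘ.choiceProb_pos hβ hpos hz k
  have hfix := (hΘ.choiceProb_eq_iff hβ hpos hz).1 hzf
  set S := totalPotential (fun _ _ => θ) β (fun k => e + η k) z with hS
  have hSe : K * e ≤ S := by
    have h1 : S = ∑ k, θ * z k ^ (-β) + K * e := by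
      simp only [hS, totalPotential, attractionPotential, Finset.sum_add_distrib, hη]
      simp
    rw [h1]
    have : 0 ≤ ∑ k, θ * z k ^ (-β) := Finset.sum_nonneg fun k _ =>
      mul_nonneg hθ.le (Real.rpow_nonneg (hz0 k).le _)
    linarith
  have hη2 : ∀ i l, η i - η l ≤ 2 * ‖η‖ := fun i l => by
    have h1 := (abs_le.1 (abs_apply_le_norm η i)).2
    have h2 := (abs_le.1 (abs_apply_le_norm η l)).1
    linarith
  have key : ∀ i l, z i - z l ≤ 2 / (K * e) * ‖η‖ := by
    intro i l
    rcases le_total (z i) (z l) with hil | hil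
    · have : 0 ≤ 2 / (K * e) * ‖η‖ := by positivity
      linarith
    · have h1 : z i ^ (-β) ≤ z l ^ (-β) :=
        Real.rpow_le_rpow_of_nonpos (hz0 l) hil (by linarith)
      have h2 := mul_le_mul_of_nonneg_left h1 hθ.le
      have h3 := hfix i
      have h4 := hfix l
      simp only [attractionPotential] at h3 h4
      have h5 : S * (z i - z l) ≤ 2 * ‖η‖ := by linarith [hη2 i l]
      have h6 := mul_le_mul_of_nonneg_right hSe (sub_nonneg.2 hil)
      rw [div_mul_eq_mul_div, le_div_iff₀ (by positivity)]
      linarith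
  rw [abs_le]
  constructor
  · linarith [key k j]
  · exact key j k

/-- The first-order formula: by `fixedPoint_abs_sub_le` the fixed point deviates from the uniform
distribution by a multiple of `‖η‖`, so that linearizing the potential there turns the fixed point
equation into `D (z_k - 1 / K) = η_k + o(‖η‖)`, with `D` the denominator below. -/
theorem fixedPoint_first_order (hK : 0 < K) (hβ : 0 ≤ β) {θ e : ℝ} (hθ : 0 < θ) (he : 0 < e)
    {c : ℝ} (hc : 0 < c) : ∃ r > 0, ∀ η : Fin K → ℝ,
      ∑ k, η k = 0 → (∀ k, 0 ≤ e + η k) → ‖η‖ < r → ∀ z ∈ stateSpace K β,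
        choiceProb (fun _ _ => θ) β (fun k => e + η k) z = z →
          ∀ k, |z k - (1 / (K : ℝ) +
            η k / (θ * (K : ℝ) ^ (β + 1) * (1 + β) + K * e))| ≤ c * ‖η‖ := by
  have hΘ : IsAttractionFactor (K := K) fun _ _ => θ := Or.inr ⟨θ, hθ, rfl⟩
  have hKpos : (0 : ℝ) < K := Nat.cast_pos.2 hK
  set D := θ * (K : ℝ) ^ (β + 1) * (1 + β) + K * e with hD
  have hD0 : 0 < D := by positivity
  set A := 2 / (K * e) with hA
  have hA0 : 0 < A := by positivity
  -- the `K + 1` remainders of the linearization, each at most `c' A ‖η‖`, add up to `D c ‖η‖`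
  set c' := c * D / ((K + 1) * A) with hc'
  have hc'0 : 0 < c' := by positivity
  have hpow : (1 / (K : ℝ)) ^ (-β) * K = (K : ℝ) ^ (β + 1) := by
    rw [one_div, Real.inv_rpow hKpos.le, Real.rpow_neg hKpos.le, inv_inv,
      Real.rpow_add hKpos, Real.rpow_one]
  have hpow' : (1 / (K : ℝ)) ^ (-β - 1) = (K : ℝ) ^ (β + 1) := by
    rw [one_div, Real.inv_rpow hKpos.le, ← Real.rpow_neg hKpos.le, neg_sub, sub_neg_eq_add,
      add_comm]
  have hderiv : HasDerivAt (fun s : ℝ => θ * s ^ (-β)) (-(β * θ * (K : ℝ) ^ (β + 1))) (1 / K) := by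
    have h1 := (Real.hasDerivAt_rpow_const (x := 1 / (K : ℝ)) (p := -β)
      (Or.inl (by positivity))).const_mul θ
    rw [hpow'] at h1
    exact h1.congr_deriv (by ring)
  -- the linear approximation of the potential at the uniform distribution
  obtain ⟨ρ, hρ, hlin⟩ := Metric.eventually_nhds_iff.1
    ((hasDerivAt_iff_isLittleO.1 hderiv).def hc'0)
  refine ⟨ρ / A, by positivity, fun η hη hpos hηr z hz hzf k => ?_⟩
  have hdelta := abs_sub_inv_card_le hK hz.1 (fixedPoint_abs_sub_le hθ he hβ hη hpos hz hzf)
  rw [lt_div_iff₀ hA0] at hηr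
  set R : Fin K → ℝ := fun j => θ * z j ^ (-β) - θ * (1 / (K : ℝ)) ^ (-β) +
    β * θ * (K : ℝ) ^ (β + 1) * (z j - 1 / K) with hR
  have hRle : ∀ j, |R j| ≤ c' * (A * ‖η‖) := fun j => by
    have h1 := hlin (y := z j) (by rw [Real.dist_eq]; linarith [hdelta j])
    rw [Real.norm_eq_abs, Real.norm_eq_abs, smul_eq_mul] at h1
    have h2 : R j = θ * z j ^ (-β) - θ * (1 / (K : ℝ)) ^ (-β) -
        (z j - 1 / K) * -(β * θ * (K : ℝ) ^ (β + 1)) := by simp only [hR]; ring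
    rw [h2]
    exact h1.trans (mul_le_mul_of_nonneg_left (hdelta j) hc'0.le)
  have hfix := (hΘ.choiceProb_eq_iff hβ hpos hz).1 hzf k
  have hS : totalPotential (fun _ _ => θ) β (fun k => e + η k) z =
      θ * (K : ℝ) ^ (β + 1) + K * e + ∑ j, R j := by
    have h1 : ∑ j, R j = ∑ j, θ * z j ^ (-β) - θ * (K : ℝ) ^ (β + 1) := by
      simp only [hR, Finset.sum_add_distrib, Finset.sum_sub_distrib, ← Finset.mul_sum, hz.1.2]
      simp only [Finset.sum_const, Finset.card_univ, Fintype.card_fin, nsmul_eq_mul]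
      rw [← hpow]
      field_simp
      ring
    simp only [totalPotential, attractionPotential, Finset.sum_add_distrib, hη, h1]
    simp
    ring
  rw [hS] at hfix
  simp only [attractionPotential] at hfix
  have hmain : D * (z k - (1 / K + η k / D)) = R k - (∑ j, R j) * z k := by
    have h1 : D * (z k - (1 / K + η k / D)) = D * (z k - 1 / K) - η k := by field_simp; ring
    have h2 : θ * (K : ℝ) ^ (β + 1) * (1 / K) = θ * (1 / (K : ℝ)) ^ (-β) := by
      rw [← hpow]; field_simp
    have h3 : (K : ℝ) * e * (1 / K) = e := by field_simp
    rw [h1]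
    simp only [hD, hR] at hfix ⊢
    linear_combination -hfix - h2 - h3
  have hsum : |∑ j, R j| ≤ K * (c' * (A * ‖η‖)) := by
    refine (Finset.abs_sum_le_sum_abs _ _).trans ((Finset.sum_le_sum fun j _ => hRle j).trans_eq ?_)
    simp
  have hfinal : D * |z k - (1 / K + η k / D)| ≤ D * (c * ‖η‖) := by
    calc D * |z k - (1 / K + η k / D)| = |R k - (∑ j, R j) * z k| := by
          rw [← hmain, abs_mul, abs_of_pos hD0]
      _ ≤ |R k| + |∑ j, R j| * |z k| := by
          rw [← abs_mul]; exact abs_sub _ _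
      _ ≤ c' * (A * ‖η‖) + K * (c' * (A * ‖η‖)) * 1 := by
          have : |z k| ≤ 1 := by
            rw [abs_of_nonneg (hz.1.1 k)]; exact le_one_of_mem_stdSimplex hz.1 k
          have := hRle k
          gcongr
      _ = D * (c * ‖η‖) := by rw [hc']; field_simp; ring
  exact le_of_mul_le_mul_left hfinal hD0

end GroupDynamics

end

theorem mainTheorem1 (K : ℕ) (hK : 0 < K) (β : ℝ) (hβ : 0 ≤ β) :
    (∀ Θ : (Fin K → ℝ) → Fin K → ℝ, GroupDynamics.IsAttractionFactor Θ →
      ∀ ε : Fin K → ℝ, (∀ k, 0 ≤ ε k) →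
        ∃ z ∈ GroupDynamics.stateSpace K β,
          (∀ x ∈ GroupDynamics.stateSpace K β,
            GroupDynamics.choiceProb Θ β ε x = x ↔ x = z) ∧
          ((∀ j k, ε j = ε k) → ∀ k, z k = 1 / (K : ℝ)) ∧
          (∀ j k, z j < z k ↔ ε j < ε k) ∧
          (∀ n₀ : Fin K → ℕ, 0 < ∑ k, n₀ k → (β ≠ 0 → ∀ k, 0 < n₀ k) →
            ∀ (Ω : Type*) [mΩ : MeasurableSpace Ω] (μ : Measure Ω) [IsProbabilityMeasure μ]
              (ℱ : Filtration ℕ mΩ) (X : ℕ → Ω → Fin K) (n : ℕ → Ω → Fin K → ℕ),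
              GroupDynamics.IsGroupProcess Θ β ε n₀ μ ℱ X n →
                ∀ᵐ ω ∂μ, ∀ k,
                  Tendsto (fun t => GroupDynamics.proportion (n t ω) k) atTop (𝓝 (z k))) ∧
          GroupDynamics.IsGloballyAsymptoticallyStable Θ β ε z) ∧
    (∀ θ e : ℝ, 0 < θ → 0 < e → ∀ c > 0, ∃ r > 0, ∀ η : Fin K → ℝ,
      ∑ k, η k = 0 → (∀ k, 0 ≤ e + η k) → ‖η‖ < r →
        ∀ z ∈ GroupDynamics.stateSpace K β,
          GroupDynamics.choiceProb (fun _ _ => θ) β (fun k => e + η k) z = z →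
            ∀ k, |z k - (1 / (K : ℝ) +
              η k / (θ * (K : ℝ) ^ (β + 1) * (1 + β) + K * e))| ≤ c * ‖η‖) := by
  refine ⟨fun Θ hΘ ε hε => ?_, fun θ e hθ he c hc =>
    GroupDynamics.fixedPoint_first_order hK hβ hθ he hc⟩
  obtain ⟨z, hz, hzf⟩ := hΘ.exists_fixedPoint hK hβ hε
  refine ⟨z, hz, fun x hx => ⟨hΘ.fixedPoint_unique hβ hε hz hzf hx, fun h => h ▸ hzf⟩,
    fun heq k => hΘ.fixedPoint_of_equal_bias hβ hε hz hzf heq k,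
    fun j k => hΘ.fixedPoint_lt_iff hβ hε hz hzf j k, ?_,
    hΘ.isGloballyAsymptoticallyStable hK hβ hε hz hzf⟩
  intro n₀ hn₀ hpos Ω _ μ _ ℱ X n h
  filter_upwards [h.ae_tendsto hK hΘ hβ hε hn₀ hpos hz hzf] with ω hω
  exact tendsto_pi_nhds.1 hω
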